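/- Notation. Let $r\in\mathbb N$. For a finitely supported sequence $c$ on $\mathbb Z$ (of scalars, vectors or matrices) put $\widehat c(\xi)=\sum_{k\in\mathbb Z}c(k)e^{-ik\xi}$. For smooth $f,g$, "$f(\xi)=g(\xi)+O(|\xi|^{n})$ as $\xi\to0$" means $f^{(\ell)}(0)=g^{(\ell)}(0)$ for $0\le \ell<n$. Let $a:\mathbb Z\to\mathbb C^{r\times r}$ be a finitely supported mask, with subdivision operator $(\mathcal S_a w)(j)=2\sum_{k}w(k)a(j-2k)$; $\boldsymbol\delta I_r$ is the sequence with value $I_r$ at $0$ and $0$ elsewhere; $(w*u)(k)=\sum_l w(k-l)u(l)$. A finitely supported $v:\mathbb Z\to\mathbb C^{1\times r}$ is an order $n$ matching filter of $a$ if $\widehat v(0)\ne0$ and $\widehat v(2\xi)\widehat a(\xi)=\widehat v(\xi)+O(|\xi|^n)$; $a$ has order $n$ sum rules with $v$ if in addition $\widehat v(2\xi)\widehat a(\xi+\pi)=O(|\xi|^n)$. Let $\operatorname{sr}(a)$ be the largest $n$ for which $a$ has order $n$ sum rules with some $v$. Define $$\rho_j(a,v)_\infty=\sup\Big\{\limsup_{n\to\infty}\|(\mathcal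 S_a^n(\boldsymbol\delta I_r))*u\|_{\infty}^{1/n}: u:\mathbb Z\to\mathbb C^{r}\text{ finitely supported},\ \widehat v(\xi)\widehat u(\xi)=O(|\xi|^j)\Big\},$$ $$\operatorname{sm}_\infty(a)=-\log_2\rho_{\operatorname{sr}(a)}(a,v)_\infty,$$ where $v$ is any filter with which $a$ has order $\operatorname{sr}(a)$ sum rules (the theorem holds for every choice of $v$). Theorem. Let $m\in\mathbb N\cup\{0\}$, suppose that $1$ is an eigenvalue of $\widehat a(0)$ and that $m<\operatorname{sm}_\infty(a)\le m+1$. Then $1$ is a simple eigenvalue of $\widehat a(0)$, all other eigenvalues of $\widehat a(0)$ are less than $2^{-m}$ in modulus, and $a$ has an order $m+1$ matching filter. Let $\vartheta_a$ be any order $m+1$ matching filter of $a$. Then there is a unique $r\times1$ vector $\phi$ of compactly supported distributions on $\mathbb R$ with $\widehat\phi(2\xi)=\widehat a(\xi)\widehat\phi(\xi)$ and $\widehat{\vartheta_a}(0)\widehat\phi(0)=1$, and $\phi\in(C^m(\mathbb R))^r$. Let $u:\mathbb Z\to\mathbb C^{r}$ be finitely supported. Let $j$ be the least element of $\{0,\dots,m\}$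 with $[\widehat{\vartheta_a}\widehat u]^{(j)}(0)\ne0$, and $j=m$ if there is none; put $\beta_j=[\widehat{\vartheta_a}\widehat u]^{(j)}(0)/(i^jj!)$. Suppose that $$\widehat{\vartheta_a}(\xi)\widehat u(\xi)=\beta_j(i\xi)^j+O(|\xi|^{j+s}),\quad \xi\to0,$$ for an integer $s$ with $1\le s\le m+1-j$, and put $\nu=\min(s,\operatorname{sm}_\infty(a)-j)$. Then $\nu>0$, and for every $0<\varepsilon<\nu$ there is a constant $C>0$ such that for all integers $n\ge 0$ $$\sup_{k\in\mathbb Z}\big\|2^{jn}[(\mathcal S_a^n(\boldsymbol\delta I_r))*u](k)-\beta_j\phi^{(j)}(2^{-n}k)\big\|\le C2^{-(\nu-\varepsilon)n},$$ and such that for every $w_0:\mathbb Z\to\mathbb C^{1\times r}$, every real $K>0$, every integer $N\ge 0$ such that $a$ and $u$ are supported in $[-N,N]$, and all integers $n\ge 0$, $$\max_{k\in\mathbb Z\cap[-2^nK,2^nK]}\big|2^{jn}[(\mathcal S_a^nw_0)*u](k)-\beta_j\eta^{(j)}(2^{-n}k)\big|\le C\Big(\sum_{l\in\mathbb Z,\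 |l|\le K+N}\|w_0(l)\|\Big)2^{-(\nu-\varepsilon)n},$$ where $\eta=\sum_{k\in\mathbb Z}w_0(k)\phi(\cdot-k)\in C^m(\mathbb R)$. -/

import Mathlib

open scoped ContDiff

namespace VecSubdiv

/-- The symbol (Fourier series) `∑ k, c k * exp (-i k ξ)` of a finitely supported sequence `c`
of scalars, vectors or matrices. -/
noncomputable def symbol {E : Type*} [AddCommGroup E] [Module ℂ E] (c : ℤ →₀ E) (ξ : ℝ) : E :=
  c.sum fun k x => Complex.exp (-(Complex.I * (k : ℂ) * (ξ : ℂ))) • x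

/-- `f ξ = g ξ + O(|ξ| ^ n)` as `ξ → 0`, in the convention for smooth functions: the derivatives
of `f` and `g` at `0` of all the orders `0, …, n - 1` agree. -/
def AgreeToOrder {E : Type*} [NormedAddCommGroup E] [NormedSpace ℝ E] (n : ℕ) (f g : ℝ → E) :
    Prop :=
  ∀ j < n, iteratedDeriv j f 0 = iteratedDeriv j g 0

/-- The scalar trigonometric polynomial `v̂ û`, for a sequence `v` of rows and a sequence `u` of
columns. -/
noncomputable def pairing {r : ℕ} (v u : ℤ →₀ (Fin r → ℂ)) (ξ : ℝ) : ℂ :=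
  symbol v ξ ⬝ᵥ symbol u ξ

/-- The sequence `v` of rows is an order `n` matching filter of the mask `a`: `v̂ 0 ≠ 0` and
`v̂(2ξ) â(ξ) = v̂(ξ) + O(|ξ| ^ n)`. -/
def IsMatchingFilter {r : ℕ} (a : ℤ →₀ Matrix (Fin r) (Fin r) ℂ) (v : ℤ →₀ (Fin r → ℂ)) (n : ℕ) :
    Prop :=
  symbol v 0 ≠ 0 ∧
    AgreeToOrder n (fun ξ => Matrix.vecMul (symbol v (2 * ξ)) (symbol a ξ)) (symbol v)

/-- The mask `a` has order `n` sum rules with the matching filter `v`. -/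
def HasSumRules {r : ℕ} (a : ℤ →₀ Matrix (Fin r) (Fin r) ℂ) (v : ℤ →₀ (Fin r → ℂ)) (n : ℕ) :
    Prop :=
  IsMatchingFilter a v n ∧
    AgreeToOrder n (fun ξ => Matrix.vecMul (symbol v (2 * ξ)) (symbol a (ξ + Real.pi)))
      (fun _ => 0)

/-- The largest order of sum rules that the mask `a` has. -/
noncomputable def sr {r : ℕ} (a : ℤ →₀ Matrix (Fin r) (Fin r) ℂ) : ℕ :=
  sSup {n | ∃ v, HasSumRules a v n}

/-- The subdivision operator `(S_a w)(j) = 2 ∑ k, w(k) a(j - 2k)` on sequences of `s × r`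
matrices. -/
noncomputable def subdiv {s r : ℕ} (a : ℤ →₀ Matrix (Fin r) (Fin r) ℂ)
    (w : ℤ → Matrix (Fin s) (Fin r) ℂ) : ℤ → Matrix (Fin s) (Fin r) ℂ :=
  fun j => (2 : ℂ) • ∑ᶠ k : ℤ, w k * a (j - 2 * k)

/-- The sequence `δ I_r`: the identity matrix at `0` and zero elsewhere. -/
def deltaI (r : ℕ) : ℤ → Matrix (Fin r) (Fin r) ℂ :=
  Pi.single 0 1

/-- The convolution `(w * u)(k) = ∑ l, w(k - l) u(l)` of a sequence `w` of `s × r` matrices with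
a finitely supported sequence `u` of columns. -/
noncomputable def conv {s r : ℕ} (w : ℤ → Matrix (Fin s) (Fin r) ℂ) (u : ℤ →₀ (Fin r → ℂ))
    (k : ℤ) : Fin s → ℂ :=
  u.sum fun l x => Matrix.mulVec (w (k - l)) x

/-- `subdivData a u n = (S_a ^ n (δ I_r)) * u`. -/
noncomputable def subdivData {r : ℕ} (a : ℤ →₀ Matrix (Fin r) (Fin r) ℂ) (u : ℤ →₀ (Fin r → ℂ))
    (n : ℕ) : ℤ → Fin r → ℂ :=
  conv ((subdiv a)^[n] (deltaI r)) u

/-- `rhoInfty a v j` is the supremum, over all finitely supported sequences `u` of columns with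
`v̂(ξ) û(ξ) = O(|ξ| ^ j)`, of the upper limit of `‖(S_a ^ n (δ I_r)) * u‖ ^ (1 / n)`, where the
norm is the supremum norm. -/
noncomputable def rhoInfty {r : ℕ} (a : ℤ →₀ Matrix (Fin r) (Fin r) ℂ) (v : ℤ →₀ (Fin r → ℂ))
    (j : ℕ) : ENNReal :=
  ⨆ u ∈ {u : ℤ →₀ (Fin r → ℂ) | AgreeToOrder j (pairing v u) (fun _ => 0)},
    Filter.limsup (fun n : ℕ => (⨆ k : ℤ, ‖subdivData a u n k‖ₑ) ^ (1 / (n : ℝ))) Filter.atTop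

/-- The quantity `sm_∞(a) = - log₂ ρ_{sr(a)}(a, v)_∞`, where `v` is a matching filter with which
`a` has order `sr(a)` sum rules. -/
noncomputable def smInfty {r : ℕ} (a : ℤ →₀ Matrix (Fin r) (Fin r) ℂ) (v : ℤ →₀ (Fin r → ℂ)) :
    EReal :=
  -(ENNReal.log (rhoInfty a v (sr a)) / (Real.log 2 : ℝ))

/-- `1` is a simple eigenvalue of `â(0)` and all other eigenvalues of `â(0)` are less than
`2 ^ (-m)` in modulus. -/
def SpectralCondition {r : ℕ} (a : ℤ →₀ Matrix (Fin r) (Fin r) ℂ) (m : ℕ) : Prop :=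
  (symbol a 0).charpoly.rootMultiplicity 1 = 1 ∧
    ∀ z : ℂ, (symbol a 0).charpoly.IsRoot z → z ≠ 1 → ‖z‖ < ((2 : ℝ) ^ m)⁻¹

/-- The least `j ≤ m` such that the `j`-th derivative of `c` at `0` does not vanish, and `m` if
there is none. -/
noncomputable def ld (m : ℕ) (c : ℝ → ℂ) : ℕ :=
  sInf (insert m {j | iteratedDeriv j c 0 ≠ 0})

/-- The coefficient of `(iξ) ^ j` in the Taylor expansion of `c` at `0`. -/
noncomputable def taylorCoeff (j : ℕ) (c : ℝ → ℂ) : ℂ :=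
  iteratedDeriv j c 0 / (Complex.I ^ j * (j.factorial : ℂ))

/-- The space of smooth complex functions on the real line. -/
def smoothFunctions : Submodule ℂ (ℝ → ℂ) where
  carrier := {f | ContDiff ℝ ∞ f}
  add_mem' := by
    intro f g hf hg
    change ContDiff ℝ ∞ (f + g)
    exact ContDiff.add hf hg
  zero_mem' := by
    change ContDiff ℝ ∞ (fun _ : ℝ => (0 : ℂ))
    exact contDiff_const
  smul_mem' := by
    intro c f hf
    change ContDiff ℝ ∞ (c • f)
    exact ContDiff.const_smul c hf

/-- The smooth function `x ↦ exp (-i x ξ)`. -/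
noncomputable def expFunction (ξ : ℝ) : smoothFunctions :=
  ⟨fun x => Complex.exp (-(Complex.I * (x : ℂ) * (ξ : ℂ))), by
    change ContDiff ℝ ∞ (fun x : ℝ => Complex.exp (-(Complex.I * (x : ℂ) * (ξ : ℂ))))
    have h : ContDiff ℝ ∞ (fun x : ℝ => (x : ℂ)) := Complex.ofRealCLM.contDiff
    exact ((contDiff_const.mul h).mul contDiff_const).neg.cexp⟩

/-- A compactly supported distribution on the real line: a linear functional on the smooth
functions that is bounded by the suprema of finitely many derivatives over a compact interval. -/
structure CompactDistribution where
  /-- The underlying linear functional. -/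
  toLinearMap : smoothFunctions →ₗ[ℂ] ℂ
  bound : ∃ (n : ℕ) (R C : ℝ), ∀ (ψ : smoothFunctions) (M : ℝ),
    (∀ k ≤ n, ∀ x : ℝ, |x| ≤ R → ‖iteratedDeriv k (ψ : ℝ → ℂ) x‖ ≤ M) →
      ‖toLinearMap ψ‖ ≤ C * M

/-- The Fourier transform of a compactly supported distribution. -/
noncomputable def CompactDistribution.fourier (T : CompactDistribution) (ξ : ℝ) : ℂ :=
  T.toLinearMap (expFunction ξ)

/-- The vector `T` of compactly supported distributions satisfies the refinement equation
`T̂(2ξ) = â(ξ) T̂(ξ)` and the normalization `v̂(0) T̂(0) = 1`. -/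
def IsNormalizedRefinable {r : ℕ} (a : ℤ →₀ Matrix (Fin r) (Fin r) ℂ) (v : ℤ →₀ (Fin r → ℂ))
    (T : Fin r → CompactDistribution) : Prop :=
  (∀ ξ : ℝ, (fun i => (T i).fourier (2 * ξ)) =
      Matrix.mulVec (symbol a ξ) (fun i => (T i).fourier ξ)) ∧
    symbol v 0 ⬝ᵥ (fun i => (T i).fourier 0) = 1

/-- The vector `T` of distributions is given by integration against the vector function `φ`. -/
def IsGivenBy {r : ℕ} (T : Fin r → CompactDistribution) (φ : ℝ → Fin r → ℂ) : Prop :=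
  ∀ (i : Fin r) (ψ : smoothFunctions),
    (T i).toLinearMap ψ = ∫ x : ℝ, φ x i * (ψ : ℝ → ℂ) x

/-- The function `η = ∑ k, w₀(k) φ(· - k)` for a sequence `w₀` of rows. -/
noncomputable def shiftSum {r : ℕ} (w₀ : ℤ → Matrix (Fin 1) (Fin r) ℂ) (φ : ℝ → Fin r → ℂ)
    (x : ℝ) : ℂ :=
  ∑' k : ℤ, w₀ k 0 ⬝ᵥ φ (x - k)

end VecSubdiv

open VecSubdiv

/-!
The proof stays with the finitely supported sequences `u` and never passes to a joint spectral
radius.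

One step of subdivision acts on `u` through the coset operators `T_γ u = 2 (a * u)(2 · + γ)`, in
the sense that `(S_a ^ (n + 1) (δ I_r) * u)(2 k + γ) = (S_a ^ n (δ I_r) * T_γ u)(k)`
(`subdivData_succ`). If `a` has sum rules with `y`, then on the sequences `u` with `ŷ û = O(ξ ^ j)`
the operator `2 ^ j T_γ` is the identity modulo those with `ŷ û = O(ξ ^ (j + 1))`
(`pairing_coset_sub_isBigO`). The rest of the proof is built on this remark.

*Decay.* The definition of `sm_∞(a)` bounds the data by `p ^ n`, for each `p > 2 ^ (-σ)`, when
`v̂ û = O(ξ ^ sr(a))`. Descending in the order of vanishing, one gets the same bound for each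
`p > max (2 ^ (-σ)) (2 ^ (-l))` when `v̂ û = O(ξ ^ l)` (`decays_of_isBigO`).

*Spectrum.* Summing the data over `ℤ` shows that the powers of `â(0)` decay faster than
`2 ^ (-m n)` on the kernel of the row `v̂(0)`, which is the spectral condition. It makes matching
filters of the orders up to `m + 1` extendable and unique up to a factor. If `sr(a) ≤ m`, then a
filter of one order more and a sequence `u` whose pairing has the exact order `sr(a)` give a
discrete moment that is too large for the decay of the data (`IsMatchingFilter.le_of_decays`).
Hence `sr(a) ≥ m + 1`, and every matching filter of order `m + 1` inherits the sum rules of `v`.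

*Limits.* For `ŷ û = O(ξ ^ j)` and `j ≤ m` the step functions
`2 ^ (j n) (S_a ^ n (δ I_r) * u)(⌊2 ^ n x⌋)` converge uniformly, at a geometric rate. The limit is
continuous and depends only on the leading coefficient of `ŷ û`; its derivative is the limit of
order `j + 1` of the forward difference of `u`, by telescoping. So `φ`, the limit for
`ŷ û = 1 + O(ξ)` and `j = 0`, is in `C ^ m`, and the limits of order `j` are the multiples
`β φ^(j)` (`SmoothScheme.limitFn_eq_iteratedDeriv`). At dyadic points only `T_0` enters, and
`2 ^ j T_0 u - u` has a pairing of order `j + s`; this gives the rate of the theorem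
(`SmoothScheme.norm_sub_limitFn_le`).

*The distribution.* The Fourier transform of `φ` is a limit of Riemann sums, that is, of products
of values of `â`, which gives the refinement equation and the normalization. Two normalized
solutions differ by a function that is `O(ξ)` at `0` and is multiplied by products of `n` values of
`â`, of size `O((3 / 2) ^ n)`, on passing from `2 ^ (-n) ξ` to `ξ`; so they agree. A compactly
supported distribution is determined by its Fourier transform because its moments are the Taylor
coefficients of the transform and polynomials are dense in the smooth functions.
-/

namespace VecSubdiv

open Filter Topology Asymptotics

/-! ### Orders of vanishing at the origin -/

section Order

variable {E : Type*} [NormedAddCommGroup E] [NormedSpace ℝ E]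

theorem isBigO_pow_pow_nhds_zero {m n : ℕ} (h : m ≤ n) :
    (fun x : ℝ => x ^ n) =O[𝓝 0] fun x : ℝ => x ^ m := by
  obtain ⟨k, rfl⟩ := Nat.exists_eq_add_of_le h
  have h1 : (fun x : ℝ => x ^ k) =O[𝓝 0] (fun _ : ℝ => (1 : ℝ)) :=
    ((continuous_pow k).continuousAt (x := (0 : ℝ))).norm.isBoundedUnder_le.isBigO_one ℝ
  simpa [pow_add] using (isBigO_refl (fun x : ℝ => x ^ m) (𝓝 0)).mul h1

theorem eq_zero_of_pow_smul_isBigO {n : ℕ} {c : E}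
    (h : (fun x : ℝ => x ^ n • c) =O[𝓝 0] fun x : ℝ => x ^ (n + 1)) : c = 0 := by
  obtain ⟨K, hK⟩ := h.bound
  have h1 : ∀ᶠ x : ℝ in 𝓝[≠] 0, ‖c‖ ≤ K * ‖x‖ := by
    filter_upwards [hK.filter_mono nhdsWithin_le_nhds, self_mem_nhdsWithin] with x hx hx0
    have hpos : 0 < ‖x‖ ^ n := pow_pos (norm_pos_iff.2 hx0) n
    rw [norm_smul, norm_pow, norm_pow, pow_succ] at hx
    nlinarith
  have h2 : Tendsto (fun x : ℝ => K * ‖x‖) (𝓝[≠] 0) (𝓝 0) := by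
    have : ContinuousAt (fun x : ℝ => K * ‖x‖) 0 := by fun_prop
    simpa [ContinuousAt] using this.tendsto.mono_left nhdsWithin_le_nhds
  have h3 := ge_of_tendsto h2 h1
  exact norm_le_zero_iff.1 h3

theorem isBigO_pow_of_factor {n : ℕ} {f g : ℝ → E} (hg : ContinuousAt g 0)
    (h : ∀ᶠ x in 𝓝 (0 : ℝ), f x = x ^ n • g x) : f =O[𝓝 0] fun x : ℝ => x ^ n := by
  have h1 : g =O[𝓝 0] (fun _ : ℝ => (1 : ℝ)) := hg.norm.isBoundedUnder_le.isBigO_one ℝ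
  have h2 := (isBigO_refl (fun x : ℝ => x ^ n) (𝓝 0)).smul h1
  simp only [smul_eq_mul, mul_one] at h2
  exact h2.congr' (h.mono fun x hx => hx.symm) EventuallyEq.rfl

theorem sub_leading_isBigO {n : ℕ} {f g : ℝ → E} (hg : AnalyticAt ℝ g 0)
    (h : ∀ᶠ x in 𝓝 (0 : ℝ), f x = x ^ n • g x) :
    (fun x => f x - x ^ n • g 0) =O[𝓝 0] fun x : ℝ => x ^ (n + 1) := by
  have h1 : (fun x => g x - g 0) =O[𝓝 0] fun x : ℝ => x := by
    simpa using hg.differentiableAt.isBigO_sub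
  have h2 := (isBigO_refl (fun x : ℝ => x ^ n) (𝓝 0)).smul h1
  simp only [smul_eq_mul, ← pow_succ] at h2
  refine h2.congr' (h.mono fun x hx => ?_) EventuallyEq.rfl
  simp only [hx, smul_sub]

variable [CompleteSpace E]

/-- An analytic function is `O(x ^ n)` at `0` exactly when its first `n` derivatives vanish. -/
theorem isBigO_pow_iff_iteratedDeriv {f : ℝ → E} (hf : AnalyticAt ℝ f 0) (n : ℕ) :
    (f =O[𝓝 0] fun x : ℝ => x ^ n) ↔ ∀ j < n, iteratedDeriv j f 0 = 0 := by
  rw [← natCast_le_analyticOrderAt_iff_iteratedDeriv_eq_zero hf]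
  constructor
  · induction n with
    | zero => simp
    | succ n ih =>
      intro h
      obtain ⟨g, hg, hfg⟩ := (natCast_le_analyticOrderAt hf).1
        (ih (h.trans (isBigO_pow_pow_nhds_zero n.le_succ)))
      simp only [sub_zero] at hfg
      have hg0 : g 0 = 0 := eq_zero_of_pow_smul_isBigO (n := n) <| by
        simpa using h.sub (sub_leading_isBigO hg hfg)
      obtain ⟨k, hk, hgk⟩ := (natCast_le_analyticOrderAt hg (n := 1)).1 <|
        (natCast_le_analyticOrderAt_iff_iteratedDeriv_eq_zero hg).2 <| by
          intro i hi
          obtain rfl : i = 0 := by omega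
          simpa using hg0
      refine (natCast_le_analyticOrderAt hf).2 ⟨k, hk, ?_⟩
      filter_upwards [hfg, hgk] with x h1 h2
      simp only [sub_zero] at h2 ⊢
      rw [h1, h2, smul_smul, pow_one, pow_succ]
  · intro h
    obtain ⟨g, hg, hfg⟩ := (natCast_le_analyticOrderAt hf).1 h
    exact isBigO_pow_of_factor hg.continuousAt (by simpa using hfg)

/-- An analytic function of size `O(x ^ n)` has a leading coefficient at the order `n`. -/
theorem exists_leading_coeff {f : ℝ → E} (hf : AnalyticAt ℝ f 0) {n : ℕ}
    (h : f =O[𝓝 0] fun x : ℝ => x ^ n) :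
    ∃ c : E, (fun x => f x - x ^ n • c) =O[𝓝 0] fun x : ℝ => x ^ (n + 1) := by
  rw [isBigO_pow_iff_iteratedDeriv hf, ← natCast_le_analyticOrderAt_iff_iteratedDeriv_eq_zero hf]
    at h
  obtain ⟨g, hg, hfg⟩ := (natCast_le_analyticOrderAt hf).1 h
  exact ⟨g 0, sub_leading_isBigO hg (by simpa using hfg)⟩

theorem agreeToOrder_iff_isBigO {f g : ℝ → E} (hf : AnalyticAt ℝ f 0) (hg : AnalyticAt ℝ g 0)
    (n : ℕ) : AgreeToOrder n f g ↔ (fun x => f x - g x) =O[𝓝 0] fun x : ℝ => x ^ n := by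
  rw [isBigO_pow_iff_iteratedDeriv (hf.fun_sub hg)]
  refine forall₂_congr fun j _ => ?_
  rw [iteratedDeriv_fun_sub hf.contDiffAt hg.contDiffAt, sub_eq_zero]

end Order

theorem isBigO_pow_comp_mul {E : Type*} [NormedAddCommGroup E] {n : ℕ} {f : ℝ → E}
    (h : f =O[𝓝 0] fun x : ℝ => x ^ n) (c : ℝ) :
    (fun x => f (c * x)) =O[𝓝 0] fun x : ℝ => x ^ n := by
  have h1 : Tendsto (fun x : ℝ => c * x) (𝓝 0) (𝓝 0) := by
    have : ContinuousAt (fun x : ℝ => c * x) 0 := by fun_prop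
    simpa [ContinuousAt] using this
  refine (h.comp_tendsto h1).trans ?_
  simp only [Function.comp_def, mul_pow]
  exact isBigO_const_mul_self _ _ _

theorem isBigO_pow_mul {n : ℕ} {f g : ℝ → ℂ} (h : f =O[𝓝 0] fun x : ℝ => x ^ n)
    (hg : ContinuousAt g 0) : (fun x => g x * f x) =O[𝓝 0] fun x : ℝ => x ^ n := by
  have h1 : g =O[𝓝 0] (fun _ : ℝ => (1 : ℝ)) := hg.norm.isBoundedUnder_le.isBigO_one ℝ
  simpa using h1.mul h

/-! ### Symbols of finitely supported sequences -/

section Symbol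

variable {E : Type*} [AddCommGroup E] [Module ℂ E]

theorem symbol_add (c d : ℤ →₀ E) (ξ : ℝ) : symbol (c + d) ξ = symbol c ξ + symbol d ξ :=
  Finsupp.sum_add_index' (by simp) (by simp)

theorem symbol_single (k : ℤ) (x : E) (ξ : ℝ) :
    symbol (Finsupp.single k x) ξ = Complex.exp (-(Complex.I * (k : ℂ) * (ξ : ℂ))) • x :=
  Finsupp.sum_single_index (by simp)

theorem symbol_smul (t : ℂ) (c : ℤ →₀ E) (ξ : ℝ) : symbol (t • c) ξ = t • symbol c ξ := by
  rw [symbol, Finsupp.sum_smul_index' (by simp), symbol, Finsupp.smul_sum]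
  simp [smul_comm t]

theorem symbol_zero (ξ : ℝ) : symbol (0 : ℤ →₀ E) ξ = 0 := by simp [symbol]

theorem symbol_neg (c : ℤ →₀ E) (ξ : ℝ) : symbol (-c) ξ = -symbol c ξ := by
  rw [← neg_one_smul ℂ c, symbol_smul, neg_one_smul]

theorem symbol_sub (c d : ℤ →₀ E) (ξ : ℝ) : symbol (c - d) ξ = symbol c ξ - symbol d ξ := by
  rw [sub_eq_add_neg, symbol_add, symbol_neg, sub_eq_add_neg]

theorem symbol_comp_linear {F : Type*} [AddCommGroup F] [Module ℂ F] (L : E →ₗ[ℂ] F)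
    (c : ℤ →₀ E) (ξ : ℝ) : L (symbol c ξ) = symbol (c.mapRange L (map_zero L)) ξ := by
  induction c using Finsupp.induction_linear with
  | zero => simp [symbol_zero]
  | add c d hc hd => rw [symbol_add, map_add, hc, hd, Finsupp.mapRange_add (map_add L), symbol_add]
  | single k x => simp [symbol_single]

end Symbol

theorem analyticAt_exp_mul (z : ℂ) (ξ : ℝ) :
    AnalyticAt ℝ (fun ξ : ℝ => Complex.exp (z * (ξ : ℂ))) ξ := by
  have h1 : AnalyticAt ℝ (fun ξ : ℝ => z * (ξ : ℂ)) ξ :=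
    analyticAt_const.mul (Complex.ofRealCLM.analyticAt ξ)
  have h2 : AnalyticAt ℝ Complex.exp (z * (ξ : ℂ)) :=
    (Complex.differentiable_exp.analyticAt _).restrictScalars
  exact h2.comp (f := fun ξ : ℝ => z * (ξ : ℂ)) h1

theorem analyticAt_symbol {E : Type*} [NormedAddCommGroup E] [NormedSpace ℂ E] (c : ℤ →₀ E)
    (ξ : ℝ) : AnalyticAt ℝ (symbol c) ξ := by
  induction c using Finsupp.induction_linear with
  | zero =>
    have : symbol (0 : ℤ →₀ E) = fun _ => 0 := funext symbol_zero
    rw [this]; exact analyticAt_const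
  | add c d hc hd =>
    have : symbol (c + d) = symbol c + symbol d := funext (symbol_add c d)
    rw [this]; exact hc.add hd
  | single k x =>
    have : symbol (Finsupp.single k x) =
        fun ξ : ℝ => Complex.exp (-(Complex.I * (k : ℂ)) * (ξ : ℂ)) • x := by
      funext ξ
      rw [symbol_single, neg_mul]
    rw [this]
    exact (analyticAt_exp_mul _ ξ).smul analyticAt_const

section Vectors

variable {r : ℕ}

theorem analyticAt_symbol_apply (c : ℤ →₀ (Fin r → ℂ)) (i : Fin r) (ξ : ℝ) :
    AnalyticAt ℝ (fun ξ => symbol c ξ i) ξ :=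
  ((ContinuousLinearMap.proj (R := ℝ) (φ := fun _ : Fin r => ℂ) i).analyticAt _).comp
    (analyticAt_symbol c ξ)

theorem analyticAt_symbol_entry (a : ℤ →₀ Matrix (Fin r) (Fin r) ℂ) (i j : Fin r) (ξ : ℝ) :
    AnalyticAt ℝ (fun ξ => symbol a ξ i j) ξ := by
  have h := fun ξ => symbol_comp_linear (Matrix.entryLinearMap ℂ ℂ i j) a ξ
  simp only [Matrix.entryLinearMap_apply] at h
  rw [show (fun ξ => symbol a ξ i j) = symbol _ from funext h]
  exact analyticAt_symbol _ ξ

theorem analyticAt_pairing (v u : ℤ →₀ (Fin r → ℂ)) (ξ : ℝ) : AnalyticAt ℝ (pairing v u) ξ := by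
  change AnalyticAt ℝ (fun ξ => ∑ i, symbol v ξ i * symbol u ξ i) ξ
  exact Finset.analyticAt_fun_sum _ fun i _ =>
    (analyticAt_symbol_apply v i ξ).fun_mul (analyticAt_symbol_apply u i ξ)

theorem analyticAt_vecMul_symbol (a : ℤ →₀ Matrix (Fin r) (Fin r) ℂ) {f : ℝ → Fin r → ℂ} {ξ t : ℝ}
    (hf : AnalyticAt ℝ f ξ) :
    AnalyticAt ℝ (fun ξ => Matrix.vecMul (f ξ) (symbol a (ξ + t))) ξ := by
  refine analyticAt_pi_iff.2 fun j => ?_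
  change AnalyticAt ℝ (fun ξ => ∑ i, f ξ i * symbol a (ξ + t) i j) ξ
  refine Finset.analyticAt_fun_sum _ fun i _ => ?_
  refine AnalyticAt.fun_mul (((ContinuousLinearMap.proj (R := ℝ)
    (φ := fun _ : Fin r => ℂ) i).analyticAt _).comp hf) ?_
  exact (analyticAt_symbol_entry a i j (ξ + t)).comp_of_eq (by fun_prop) rfl

theorem analyticAt_symbol_two_mul (v : ℤ →₀ (Fin r → ℂ)) (ξ : ℝ) :
    AnalyticAt ℝ (fun ξ => symbol v (2 * ξ)) ξ :=
  (analyticAt_symbol v (2 * ξ)).comp_of_eq (by fun_prop) rfl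

theorem continuous_symbol (c : ℤ →₀ (Fin r → ℂ)) : Continuous (symbol c) :=
  continuous_iff_continuousAt.2 fun ξ => (analyticAt_symbol c ξ).continuousAt

/-- A matching filter of order `n`, in terms of growth at the origin. -/
theorem isMatchingFilter_iff {a : ℤ →₀ Matrix (Fin r) (Fin r) ℂ} {v : ℤ →₀ (Fin r → ℂ)} {n : ℕ} :
    IsMatchingFilter a v n ↔ symbol v 0 ≠ 0 ∧
      (fun ξ => Matrix.vecMul (symbol v (2 * ξ)) (symbol a ξ) - symbol v ξ) =O[𝓝 0]
        fun ξ : ℝ => ξ ^ n := by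
  rw [IsMatchingFilter, agreeToOrder_iff_isBigO _ (analyticAt_symbol v 0)]
  simpa using analyticAt_vecMul_symbol a (t := 0) (analyticAt_symbol_two_mul v 0)

theorem hasSumRules_iff {a : ℤ →₀ Matrix (Fin r) (Fin r) ℂ} {v : ℤ →₀ (Fin r → ℂ)} {n : ℕ} :
    HasSumRules a v n ↔ IsMatchingFilter a v n ∧
      (fun ξ => Matrix.vecMul (symbol v (2 * ξ)) (symbol a (ξ + Real.pi))) =O[𝓝 0]
        fun ξ : ℝ => ξ ^ n := by
  rw [HasSumRules, agreeToOrder_iff_isBigO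
    (analyticAt_vecMul_symbol a (analyticAt_symbol_two_mul v 0)) analyticAt_const]
  simp only [sub_zero]

theorem isBigO_dotProduct_left {n : ℕ} {f g : ℝ → Fin r → ℂ}
    (hf : f =O[𝓝 0] fun ξ : ℝ => ξ ^ n) (hg : ContinuousAt g 0) :
    (fun ξ => f ξ ⬝ᵥ g ξ) =O[𝓝 0] fun ξ : ℝ => ξ ^ n := by
  refine IsBigO.fun_sum fun i _ => ?_
  simp only [mul_comm (f _ i)]
  exact isBigO_pow_mul (isBigO_pi.1 hf i) (continuousAt_pi.1 hg i)

theorem isBigO_vecMul_symbol (a : ℤ →₀ Matrix (Fin r) (Fin r) ℂ) {n : ℕ} {f : ℝ → Fin r → ℂ}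
    (hf : f =O[𝓝 0] fun ξ : ℝ => ξ ^ n) (t : ℝ) :
    (fun ξ => Matrix.vecMul (f ξ) (symbol a (ξ + t))) =O[𝓝 0] fun ξ : ℝ => ξ ^ n := by
  refine isBigO_pi.2 fun j => ?_
  refine isBigO_dotProduct_left hf (continuousAt_pi.2 fun i => ?_)
  exact ((analyticAt_symbol_entry a i j (0 + t)).comp_of_eq (f := fun ξ : ℝ => ξ + t)
    (by fun_prop) rfl).continuousAt

end Vectors

/-! ### The subdivision operator and its cosets -/

section Combinatorics

variable {r s : ℕ}

theorem conv_add (w : ℤ → Matrix (Fin s) (Fin r) ℂ) (u u' : ℤ →₀ (Fin r → ℂ)) (k : ℤ) :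
    conv w (u + u') k = conv w u k + conv w u' k :=
  Finsupp.sum_add_index' (by simp) (by simp [Matrix.mulVec_add])

theorem conv_smul (w : ℤ → Matrix (Fin s) (Fin r) ℂ) (t : ℂ) (u : ℤ →₀ (Fin r → ℂ)) (k : ℤ) :
    conv w (t • u) k = t • conv w u k := by
  rw [conv, Finsupp.sum_smul_index' (by simp), conv, Finsupp.smul_sum]
  simp [Matrix.mulVec_smul]

theorem conv_zero (w : ℤ → Matrix (Fin s) (Fin r) ℂ) (k : ℤ) :
    conv w (0 : ℤ →₀ (Fin r → ℂ)) k = 0 := by simp [conv]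

theorem conv_single (w : ℤ → Matrix (Fin s) (Fin r) ℂ) (l : ℤ) (x : Fin r → ℂ) (k : ℤ) :
    conv w (Finsupp.single l x) k = Matrix.mulVec (w (k - l)) x :=
  Finsupp.sum_single_index (by simp)

/-- Twice the convolution of the mask `a`, spread out by the factor `d`, with the sequence `u`. -/
noncomputable def dilConv (a : ℤ →₀ Matrix (Fin r) (Fin r) ℂ) (u : ℤ →₀ (Fin r → ℂ)) (d : ℤ) :
    ℤ →₀ (Fin r → ℂ) :=
  a.sum fun p A => u.sum fun l x => Finsupp.single (d * p + l) ((2 : ℂ) • Matrix.mulVec A x)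

theorem symbol_finsuppSum {ι M E : Type*} [Zero M] [AddCommGroup E] [Module ℂ E] (c : ι →₀ M)
    (g : ι → M → (ℤ →₀ E)) (ξ : ℝ) :
    symbol (c.sum g) ξ = c.sum fun i x => symbol (g i x) ξ := by
  let L : (ℤ →₀ E) →+ E :=
    { toFun := fun c => symbol c ξ
      map_zero' := symbol_zero ξ
      map_add' := fun c d => symbol_add c d ξ }
  exact map_finsuppSum L c g

theorem symbol_dilConv (a : ℤ →₀ Matrix (Fin r) (Fin r) ℂ) (u : ℤ →₀ (Fin r → ℂ)) (d : ℤ)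
    (ξ : ℝ) : symbol (dilConv a u d) ξ =
      (2 : ℂ) • Matrix.mulVec (symbol a (d * ξ)) (symbol u ξ) := by
  rw [dilConv, symbol_finsuppSum]
  simp only [symbol_finsuppSum, symbol_single]
  rw [symbol, symbol, Finsupp.sum, Finsupp.sum, Matrix.sum_mulVec, Finset.smul_sum]
  refine Finset.sum_congr rfl fun p _ => ?_
  rw [Finsupp.sum, Finsupp.sum, Matrix.mulVec_sum, Finset.smul_sum]
  refine Finset.sum_congr rfl fun l _ => ?_
  have h : Complex.exp (-(Complex.I * ((d * p + l : ℤ) : ℂ) * (ξ : ℂ))) =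
      Complex.exp (-(Complex.I * (p : ℂ) * ((d * ξ : ℝ) : ℂ))) *
        Complex.exp (-(Complex.I * (l : ℂ) * (ξ : ℂ))) := by
    rw [← Complex.exp_add]
    congr 1
    push_cast
    ring
  rw [h, Matrix.smul_mulVec, Matrix.mulVec_smul]
  module

theorem dilConv_apply (a : ℤ →₀ Matrix (Fin r) (Fin r) ℂ) (u : ℤ →₀ (Fin r → ℂ)) (d k : ℤ) :
    dilConv a u d k = a.sum fun p A => (2 : ℂ) • Matrix.mulVec A (u (k - d * p)) := by
  rw [dilConv, Finsupp.sum_apply]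
  refine Finset.sum_congr rfl fun p _ => ?_
  simp only
  rw [Finsupp.sum_apply, Finsupp.sum, Finset.sum_eq_single (k - d * p)]
  · simp
  · intro l _ hl
    rw [Finsupp.single_apply, if_neg (by omega)]
  · intro h
    simp [Finsupp.notMem_support_iff.1 h]

theorem two_mul_add_injective (γ : ℤ) : Function.Injective fun k : ℤ => 2 * k + γ := by
  intro x y h
  simp only at h
  omega

/-- The sequence `k ↦ c (2 k + γ)`. -/
noncomputable def downsample {E : Type*} [Zero E] (c : ℤ →₀ E) (γ : ℤ) : ℤ →₀ E :=
  c.comapDomain (fun k => 2 * k + γ) (two_mul_add_injective γ).injOn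

theorem downsample_apply {E : Type*} [Zero E] (c : ℤ →₀ E) (γ k : ℤ) :
    downsample c γ k = c (2 * k + γ) := rfl

theorem downsample_add {E : Type*} [AddCommGroup E] (c d : ℤ →₀ E) (γ : ℤ) :
    downsample (c + d) γ = downsample c γ + downsample d γ := by
  ext; simp [downsample_apply]

theorem downsample_single_two_mul_add {E : Type*} [AddCommGroup E] (k γ : ℤ) (x : E) :
    downsample (Finsupp.single (2 * k + γ) x) γ = Finsupp.single k x := by
  classical
  ext l
  rw [downsample_apply, Finsupp.single_apply, Finsupp.single_apply]
  simp

theorem downsample_single_of_not_even {E : Type*} [AddCommGroup E] {p γ : ℤ} (h : ¬ Even (γ - p))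
    (x : E) : downsample (Finsupp.single p x) γ = 0 := by
  classical
  ext l
  rw [downsample_apply, Finsupp.single_apply, if_neg]
  · rfl
  · rintro rfl
    exact h ⟨-l, by ring⟩

/-- The coset operator `T_γ u = 2 (a * u)(2 · + γ)`, through which one step of subdivision acts
on the sequence `u`. -/
noncomputable def coset (a : ℤ →₀ Matrix (Fin r) (Fin r) ℂ) (u : ℤ →₀ (Fin r → ℂ)) (γ : ℤ) :
    ℤ →₀ (Fin r → ℂ) :=
  downsample (dilConv a u 1) γ

theorem subdiv_apply (a : ℤ →₀ Matrix (Fin r) (Fin r) ℂ) (w : ℤ → Matrix (Fin s) (Fin r) ℂ)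
    (j : ℤ) : subdiv a w j =
      (2 : ℂ) • a.sum fun q A => if Even (j - q) then w ((j - q) / 2) * A else 0 := by
  rw [subdiv, Finsupp.sum, ← Finset.sum_filter]
  congr 1
  rw [finsum_eq_sum_of_support_subset (s := (a.support.filter fun q => Even (j - q)).image
    fun q => (j - q) / 2)]
  · rw [Finset.sum_image]
    · refine Finset.sum_congr rfl fun q hq => ?_
      obtain ⟨t, ht⟩ := (Finset.mem_filter.1 hq).2
      rw [show j - 2 * ((j - q) / 2) = q by omega]
    · intro q hq q' hq' h
      obtain ⟨t, ht⟩ := (Finset.mem_filter.1 hq).2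
      obtain ⟨t', ht'⟩ := (Finset.mem_filter.1 hq').2
      simp only at h
      omega
  · intro p hp
    simp only [Finset.coe_image, Finset.coe_filter, Set.mem_image, Set.mem_ofPred_eq]
    refine ⟨j - 2 * p, ⟨?_, ⟨p, by ring⟩⟩, by omega⟩
    rw [Finsupp.mem_support_iff]
    intro h0
    simp [h0] at hp

theorem conv_downsample (w : ℤ → Matrix (Fin s) (Fin r) ℂ) (c : ℤ →₀ (Fin r → ℂ)) (γ k : ℤ) :
    conv w (downsample c γ) k = c.sum fun q x =>
      if Even (2 * k + γ - q) then Matrix.mulVec (w ((2 * k + γ - q) / 2)) x else 0 := by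
  induction c using Finsupp.induction_linear with
  | zero => simp [downsample, conv_zero]
  | add c d hc hd =>
    rw [downsample_add, conv_add, hc, hd, Finsupp.sum_add_index']
    · simp
    · intro p x y
      split_ifs <;> simp [Matrix.mulVec_add]
  | single p x =>
    rw [Finsupp.sum_single_index (by simp)]
    split_ifs with h
    · obtain ⟨t, ht⟩ := h
      obtain rfl : p = 2 * (k - t) + γ := by omega
      rw [downsample_single_two_mul_add, conv_single]
      congr 2
      omega
    · rw [downsample_single_of_not_even, conv_zero]
      intro h'
      obtain ⟨t, ht⟩ := h'
      exact h ⟨k + t, by omega⟩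

/-- One step of subdivision on the left of `u` is a coset operator applied to `u`. -/
theorem conv_subdiv (a : ℤ →₀ Matrix (Fin r) (Fin r) ℂ) (w : ℤ → Matrix (Fin s) (Fin r) ℂ)
    (u : ℤ →₀ (Fin r → ℂ)) (γ k : ℤ) :
    conv (subdiv a w) u (2 * k + γ) = conv w (coset a u γ) k := by
  rw [coset, conv_downsample, dilConv, Finsupp.sum_sum_index]
  rotate_left
  · simp
  · intro p x y
    split_ifs <;> simp [Matrix.mulVec_add]
  simp only [conv, subdiv_apply, Finsupp.sum]
  simp only [Finset.smul_sum, Matrix.sum_mulVec]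
  rw [Finset.sum_comm]
  refine Finset.sum_congr rfl fun q _ => ?_
  have := Finsupp.sum_sum_index (f := u)
    (g := fun l x => Finsupp.single (1 * q + l) ((2 : ℂ) • Matrix.mulVec (a q) x))
    (h := fun p x =>
      if Even (2 * k + γ - p) then Matrix.mulVec (w ((2 * k + γ - p) / 2)) x else 0)
    (by simp) (by intro p x y; split_ifs <;> simp [Matrix.mulVec_add])
  simp only [Finsupp.sum] at this
  rw [this]
  refine Finset.sum_congr rfl fun l _ => ?_
  have h2 := Finsupp.sum_single_index (a := 1 * q + l) (b := (2 : ℂ) • Matrix.mulVec (a q) (u l))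
    (h := fun p x =>
      if Even (2 * k + γ - p) then Matrix.mulVec (w ((2 * k + γ - p) / 2)) x else 0) (by simp)
  simp only [Finsupp.sum] at h2
  rw [h2, show 2 * k + γ - (1 * q + l) = 2 * k + γ - l - q by ring]
  split_ifs
  · rw [Matrix.smul_mulVec, Matrix.mulVec_smul, Matrix.mulVec_mulVec]
  · simp

theorem conv_deltaI (u : ℤ →₀ (Fin r → ℂ)) (k : ℤ) : conv (deltaI r) u k = u k := by
  rw [conv, Finsupp.sum, Finset.sum_eq_single k]
  · simp [deltaI]
  · intro l _ hl
    rw [deltaI, Pi.single_eq_of_ne (by omega), Matrix.zero_mulVec]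
  · intro h
    simp [Finsupp.notMem_support_iff.1 h]

theorem subdivData_zero (a : ℤ →₀ Matrix (Fin r) (Fin r) ℂ) (u : ℤ →₀ (Fin r → ℂ)) (k : ℤ) :
    subdivData a u 0 k = u k := conv_deltaI u k

theorem subdivData_succ (a : ℤ →₀ Matrix (Fin r) (Fin r) ℂ) (u : ℤ →₀ (Fin r → ℂ)) (n : ℕ)
    (γ k : ℤ) : subdivData a u (n + 1) (2 * k + γ) = subdivData a (coset a u γ) n k := by
  rw [subdivData, Function.iterate_succ_apply', conv_subdiv, subdivData]

theorem subdivData_add (a : ℤ →₀ Matrix (Fin r) (Fin r) ℂ) (u u' : ℤ →₀ (Fin r → ℂ)) (n : ℕ)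
    (k : ℤ) : subdivData a (u + u') n k = subdivData a u n k + subdivData a u' n k :=
  conv_add _ _ _ _

theorem subdivData_smul (a : ℤ →₀ Matrix (Fin r) (Fin r) ℂ) (t : ℂ) (u : ℤ →₀ (Fin r → ℂ)) (n : ℕ)
    (k : ℤ) : subdivData a (t • u) n k = t • subdivData a u n k :=
  conv_smul _ _ _ _

theorem subdivData_sub (a : ℤ →₀ Matrix (Fin r) (Fin r) ℂ) (u u' : ℤ →₀ (Fin r → ℂ)) (n : ℕ)
    (k : ℤ) : subdivData a (u - u') n k = subdivData a u n k - subdivData a u' n k := by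
  rw [sub_eq_add_neg, ← neg_one_smul ℂ u', subdivData_add, subdivData_smul, neg_one_smul,
    sub_eq_add_neg]

/-- The subdivision scheme with arbitrary initial data, as a superposition of shifts of the scheme
with initial data `δ I_r`. -/
theorem conv_iterate_subdiv (a : ℤ →₀ Matrix (Fin r) (Fin r) ℂ)
    (w : ℤ → Matrix (Fin s) (Fin r) ℂ) (n : ℕ) (u : ℤ →₀ (Fin r → ℂ)) (k : ℤ) :
    conv ((subdiv a)^[n] w) u k =
      ∑ᶠ l : ℤ, Matrix.mulVec (w l) (subdivData a u n (k - 2 ^ n * l)) := by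
  induction n generalizing u k with
  | zero =>
    simp only [Function.iterate_zero, id, subdivData_zero, pow_zero, one_mul]
    rw [finsum_eq_sum_of_support_subset (s := u.support.image fun l => k - l)]
    · rw [Finset.sum_image (by intro x _ y _ h; simpa using h), conv, Finsupp.sum]
      simp
    · intro p hp
      simp only [Finset.coe_image, Set.mem_image, Finset.mem_coe, Finsupp.mem_support_iff]
      refine ⟨k - p, fun h => hp (by simp [h]), by ring⟩
  | succ n ih =>
    obtain ⟨q, γ, rfl⟩ : ∃ q γ : ℤ, k = 2 * q + γ := ⟨k, -k, by ring⟩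
    rw [Function.iterate_succ_apply', conv_subdiv, ih]
    refine finsum_congr fun l => ?_
    rw [← subdivData_succ]
    congr 2
    ring

/-- The data `S_a ^ n (δ I_r) * u`, as a finitely supported sequence. -/
noncomputable def iterSeq (a : ℤ →₀ Matrix (Fin r) (Fin r) ℂ) (u : ℤ →₀ (Fin r → ℂ)) :
    ℕ → (ℤ →₀ (Fin r → ℂ))
  | 0 => u
  | n + 1 => dilConv a (iterSeq a u n) (2 ^ n)

theorem subdiv_deltaI (a : ℤ →₀ Matrix (Fin r) (Fin r) ℂ) (j : ℤ) :
    subdiv a (deltaI r) j = (2 : ℂ) • a j := by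
  rw [subdiv, finsum_eq_single _ 0]
  · simp [deltaI]
  · intro k hk
    rw [deltaI, Pi.single_eq_of_ne hk, zero_mul]

theorem coe_iterSeq (a : ℤ →₀ Matrix (Fin r) (Fin r) ℂ) (u : ℤ →₀ (Fin r → ℂ)) (n : ℕ) (k : ℤ) :
    iterSeq a u n k = subdivData a u n k := by
  induction n generalizing k with
  | zero => rw [iterSeq, subdivData_zero]
  | succ n ih =>
    rw [iterSeq, dilConv_apply, subdivData, Function.iterate_succ_apply, conv_iterate_subdiv,
      finsum_eq_sum_of_support_subset (s := a.support), Finsupp.sum]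
    · refine Finset.sum_congr rfl fun p _ => ?_
      rw [subdiv_deltaI, Matrix.smul_mulVec, ih]
    · intro p hp
      rw [Finset.mem_coe, Finsupp.mem_support_iff]
      intro h
      simp [subdiv_deltaI, h] at hp

theorem symbol_iterSeq_succ (a : ℤ →₀ Matrix (Fin r) (Fin r) ℂ) (u : ℤ →₀ (Fin r → ℂ)) (n : ℕ)
    (ξ : ℝ) : symbol (iterSeq a u (n + 1)) ξ =
      (2 : ℂ) • Matrix.mulVec (symbol a (2 ^ n * ξ)) (symbol (iterSeq a u n) ξ) := by
  rw [iterSeq, symbol_dilConv]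
  push_cast
  rfl

theorem subdivData_eq_zero {a : ℤ →₀ Matrix (Fin r) (Fin r) ℂ} {u : ℤ →₀ (Fin r → ℂ)} {N N' : ℤ}
    (ha : ∀ k : ℤ, N < |k| → a k = 0) (hu : ∀ k : ℤ, N' < |k| → u k = 0) (n : ℕ) (k : ℤ)
    (hk : (2 ^ n - 1) * N + N' < |k|) : subdivData a u n k = 0 := by
  induction n generalizing k with
  | zero =>
    rw [subdivData_zero]
    exact hu k (by simpa using hk)
  | succ n ih =>
    rw [← coe_iterSeq, iterSeq, dilConv_apply]
    refine Finset.sum_eq_zero fun p hp => ?_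
    have hp' : |p| ≤ N := by
      by_contra! h
      exact (Finsupp.mem_support_iff.1 hp) (ha p h)
    have h2 : |(2 : ℤ) ^ n * p| ≤ 2 ^ n * N := by
      rw [abs_mul, abs_of_pos (by positivity : (0 : ℤ) < 2 ^ n)]
      gcongr
    have h3 : |k| ≤ |k - 2 ^ n * p| + |2 ^ n * p| := by
      simpa using abs_add_le (k - 2 ^ n * p) (2 ^ n * p)
    simp only
    rw [coe_iterSeq, ih]
    · simp
    · rw [pow_succ] at hk
      linarith

theorem exists_support_bound {E : Type*} [Zero E] (c : ℤ →₀ E) :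
    ∃ N : ℕ, ∀ k : ℤ, (N : ℤ) < |k| → c k = 0 := by
  refine ⟨c.support.sup Int.natAbs, fun k hk => ?_⟩
  by_contra h
  have := Finset.le_sup (f := Int.natAbs) (Finsupp.mem_support_iff.2 h)
  rw [Int.abs_eq_natAbs] at hk
  omega

/-- The forward difference `u (· + 1) - u`. -/
noncomputable def fwd (u : ℤ →₀ (Fin r → ℂ)) : ℤ →₀ (Fin r → ℂ) :=
  u.mapDomain (fun k => k - 1) - u

theorem symbol_fwd (u : ℤ →₀ (Fin r → ℂ)) (ξ : ℝ) :
    symbol (fwd u) ξ = (Complex.exp (Complex.I * ξ) - 1) • symbol u ξ := by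
  rw [fwd, symbol_sub, sub_smul, one_smul]
  congr 1
  rw [symbol, Finsupp.sum_mapDomain_index (by simp) (by simp), symbol, Finsupp.smul_sum]
  refine Finset.sum_congr rfl fun k _ => ?_
  simp only [smul_smul, ← Complex.exp_add]
  congr 2
  push_cast
  ring

theorem subdivData_fwd (a : ℤ →₀ Matrix (Fin r) (Fin r) ℂ) (u : ℤ →₀ (Fin r → ℂ)) (n : ℕ)
    (k : ℤ) : subdivData a (fwd u) n k = subdivData a u n (k + 1) - subdivData a u n k := by
  rw [fwd, subdivData_sub]
  congr 1
  rw [subdivData, conv, Finsupp.sum_mapDomain_index (by simp) (by simp [Matrix.mulVec_add]),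
    subdivData, conv]
  refine Finset.sum_congr rfl fun l _ => ?_
  simp only
  rw [show k - (l - 1) = k + 1 - l by ring]

/-- The symbol of a coset sequence, from the values of the symbol at `ξ` and `ξ + π`. -/
theorem symbol_downsample {E : Type*} [AddCommGroup E] [Module ℂ E] (c : ℤ →₀ E) (γ : ℤ) (ξ : ℝ) :
    (2 : ℂ) • symbol (downsample c γ) (2 * ξ) =
      Complex.exp (Complex.I * γ * ξ) • (symbol c ξ + (-1 : ℂ) ^ γ • symbol c (ξ + Real.pi)) := by
  induction c using Finsupp.induction_linear with
  | zero => simp [downsample, symbol_zero]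
  | add c d hc hd =>
    rw [downsample_add, symbol_add, smul_add, hc, hd, symbol_add, symbol_add]
    module
  | single p x =>
    have hpi : Complex.exp (-(Complex.I * (p : ℂ) * ((ξ + Real.pi : ℝ) : ℂ))) =
        Complex.exp (-(Complex.I * (p : ℂ) * (ξ : ℂ))) * (-1) ^ (-p) := by
      rw [← Complex.exp_pi_mul_I, ← Complex.exp_int_mul, ← Complex.exp_add]
      congr 1
      push_cast
      ring
    rw [symbol_single, symbol_single, hpi]
    have h2 : (-1 : ℂ) ^ γ * (-1) ^ (-p) = (-1) ^ (γ - p) := by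
      rw [← zpow_add₀ (by norm_num), sub_eq_add_neg]
    by_cases h : Even (γ - p)
    · have h' := h
      obtain ⟨t, ht⟩ := h
      obtain rfl : p = 2 * (-t) + γ := by omega
      have h3 : Complex.exp (-(Complex.I * ((-t : ℤ) : ℂ) * ((2 * ξ : ℝ) : ℂ))) =
          Complex.exp (Complex.I * γ * ξ) *
            Complex.exp (-(Complex.I * ((2 * -t + γ : ℤ) : ℂ) * (ξ : ℂ))) := by
        rw [← Complex.exp_add]
        congr 1
        push_cast
        ring
      rw [downsample_single_two_mul_add, symbol_single, smul_smul ((-1 : ℂ) ^ γ), mul_left_comm, h2,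
        h'.neg_one_zpow, mul_one, h3]
      module
    · rw [downsample_single_of_not_even h, symbol_zero, smul_smul ((-1 : ℂ) ^ γ), mul_left_comm, h2,
        (Int.not_even_iff_odd.1 h).neg_one_zpow]
      simp

end Combinatorics

/-! ### The pairing with a matching filter -/

section Pairing

variable {r : ℕ}

theorem pairing_sub (y u u' : ℤ →₀ (Fin r → ℂ)) (ξ : ℝ) :
    pairing y (u - u') ξ = pairing y u ξ - pairing y u' ξ := by
  simp [pairing, symbol_sub, dotProduct_sub]

theorem pairing_smul (y u : ℤ →₀ (Fin r → ℂ)) (t : ℂ) (ξ : ℝ) :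
    pairing y (t • u) ξ = t * pairing y u ξ := by
  simp [pairing, symbol_smul, dotProduct_smul]

theorem pairing_fwd (y u : ℤ →₀ (Fin r → ℂ)) (ξ : ℝ) :
    pairing y (fwd u) ξ = (Complex.exp (Complex.I * ξ) - 1) * pairing y u ξ := by
  simp [pairing, symbol_fwd, dotProduct_smul]

theorem pairing_isBigO_pow_zero (y u : ℤ →₀ (Fin r → ℂ)) :
    pairing y u =O[𝓝 0] fun ξ : ℝ => ξ ^ 0 := by
  simpa using (analyticAt_pairing y u 0).continuousAt.norm.isBoundedUnder_le.isBigO_one ℝ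

theorem exp_mul_sub_one_isBigO (z : ℂ) :
    (fun ξ : ℝ => Complex.exp (z * ξ) - 1) =O[𝓝 0] fun ξ : ℝ => ξ ^ 1 := by
  refine (isBigO_pow_iff_iteratedDeriv
    ((analyticAt_exp_mul z 0).fun_sub analyticAt_const) 1).2 fun j hj => ?_
  obtain rfl : j = 0 := by omega
  simp

theorem iteratedDeriv_exp_mul (z : ℂ) (j : ℕ) :
    iteratedDeriv j (fun ξ : ℝ => Complex.exp (z * ξ)) =
      fun ξ : ℝ => z ^ j * Complex.exp (z * ξ) := by
  induction j with
  | zero => simp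
  | succ j ih =>
    rw [iteratedDeriv_succ, ih]
    funext ξ
    have h1 : HasDerivAt (fun ξ : ℝ => z * (ξ : ℂ)) z ξ := by
      simpa using (Complex.ofRealCLM.hasDerivAt (x := ξ)).const_mul z
    rw [(h1.cexp.const_mul (z ^ j)).deriv]
    ring

theorem exp_mul_sub_linear_isBigO (z : ℂ) :
    (fun ξ : ℝ => Complex.exp (z * ξ) - 1 - z * ξ) =O[𝓝 0] fun ξ : ℝ => ξ ^ 2 := by
  have h1 : AnalyticAt ℝ (fun ξ : ℝ => Complex.exp (z * ξ) - 1) 0 :=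
    (analyticAt_exp_mul z 0).fun_sub analyticAt_const
  have h2 : AnalyticAt ℝ (fun ξ : ℝ => z * (ξ : ℂ)) 0 :=
    analyticAt_const.mul (Complex.ofRealCLM.analyticAt 0)
  have h3 : ∀ ξ : ℝ, HasDerivAt (fun ξ : ℝ => z * (ξ : ℂ)) z ξ := fun ξ => by
    simpa using (Complex.ofRealCLM.hasDerivAt (x := ξ)).const_mul z
  refine (isBigO_pow_iff_iteratedDeriv (h1.fun_sub h2) 2).2 fun j hj => ?_
  interval_cases j
  · simp
  · rw [iteratedDeriv_one, (((h3 0).cexp.sub_const 1).fun_sub (h3 0)).deriv]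
    simp

theorem isBigO_const_mul_I_pow (β : ℂ) (j : ℕ) :
    (fun ξ : ℝ => β * (Complex.I * (ξ : ℂ)) ^ j) =O[𝓝 0] fun ξ : ℝ => ξ ^ j := by
  refine IsBigO.of_bound ‖β‖ (Eventually.of_forall fun ξ => ?_)
  simp

theorem isBigO_of_leading {f : ℝ → ℂ} {β : ℂ} {j n : ℕ} (hn : j ≤ n)
    (h : (fun ξ => f ξ - β * (Complex.I * (ξ : ℂ)) ^ j) =O[𝓝 0] fun ξ : ℝ => ξ ^ n) :
    f =O[𝓝 0] fun ξ : ℝ => ξ ^ j := by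
  simpa using (h.trans (isBigO_pow_pow_nhds_zero hn)).add (isBigO_const_mul_I_pow β j)

theorem exists_leading_coeff_I {f : ℝ → ℂ} (hf : AnalyticAt ℝ f 0) {j : ℕ}
    (h : f =O[𝓝 0] fun ξ : ℝ => ξ ^ j) : ∃ β : ℂ,
      (fun ξ => f ξ - β * (Complex.I * (ξ : ℂ)) ^ j) =O[𝓝 0] fun ξ : ℝ => ξ ^ (j + 1) := by
  obtain ⟨c, hc⟩ := exists_leading_coeff hf h
  refine ⟨c / Complex.I ^ j, hc.congr_left fun ξ => ?_⟩
  rw [mul_pow, ← mul_assoc, div_mul_cancel₀ _ (pow_ne_zero _ Complex.I_ne_zero)]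
  simp [mul_comm]

theorem continuousAt_exp_mul (z : ℂ) :
    ContinuousAt (fun ξ : ℝ => Complex.exp (z * (ξ : ℂ))) 0 :=
  (analyticAt_exp_mul z 0).continuousAt

/-- The sum rules cancel the contribution of the frequency `ξ + π` to a coset sequence. -/
theorem pairing_coset_isBigO {a : ℤ →₀ Matrix (Fin r) (Fin r) ℂ} {y : ℤ →₀ (Fin r → ℂ)} {M : ℕ}
    (hy : HasSumRules a y M) (u : ℤ →₀ (Fin r → ℂ)) (γ : ℤ) :
    (fun ξ : ℝ => pairing y (coset a u γ) (2 * ξ) -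
      Complex.exp (Complex.I * γ * ξ) * pairing y u ξ) =O[𝓝 0] fun ξ : ℝ => ξ ^ M := by
  rw [hasSumRules_iff, isMatchingFilter_iff] at hy
  obtain ⟨⟨-, h1⟩, h2⟩ := hy
  have hu : ContinuousAt (symbol u) 0 := (continuous_symbol u).continuousAt
  have hu' : ContinuousAt (fun ξ => symbol u (ξ + Real.pi)) 0 :=
    ((continuous_symbol u).comp (continuous_add_const _)).continuousAt
  have h3 := isBigO_pow_mul ((isBigO_dotProduct_left h1 hu).add
    ((isBigO_dotProduct_left h2 hu').const_mul_left ((-1 : ℂ) ^ γ)))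
    (continuousAt_exp_mul (Complex.I * γ))
  refine h3.congr_left fun ξ => ?_
  have h4 : symbol (coset a u γ) (2 * ξ) = Complex.exp (Complex.I * γ * ξ) •
      (Matrix.mulVec (symbol a ξ) (symbol u ξ) +
        (-1 : ℂ) ^ γ • Matrix.mulVec (symbol a (ξ + Real.pi)) (symbol u (ξ + Real.pi))) := by
    have h := symbol_downsample (dilConv a u 1) γ ξ
    rw [symbol_dilConv, symbol_dilConv, smul_comm ((-1 : ℂ) ^ γ), ← smul_add,
      smul_comm _ (2 : ℂ)] at h
    simpa [coset] using smul_right_injective _ (two_ne_zero (α := ℂ)) h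
  rw [pairing, h4, dotProduct_smul, dotProduct_add, dotProduct_smul, Matrix.dotProduct_mulVec,
    Matrix.dotProduct_mulVec, sub_dotProduct, pairing]
  simp only [smul_eq_mul]
  ring

theorem pairing_coset_isBigO' {a : ℤ →₀ Matrix (Fin r) (Fin r) ℂ} {y : ℤ →₀ (Fin r → ℂ)} {M : ℕ}
    (hy : HasSumRules a y M) {u : ℤ →₀ (Fin r → ℂ)} {β : ℂ} {j n : ℕ} (hn : n ≤ M)
    (hu : (fun ξ => pairing y u ξ - β * (Complex.I * (ξ : ℂ)) ^ j) =O[𝓝 0] fun ξ : ℝ => ξ ^ n)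
    (γ : ℤ) :
    (fun ξ : ℝ => pairing y ((2 : ℂ) ^ j • coset a u γ) ξ -
      Complex.exp (Complex.I * γ / 2 * ξ) * (β * (Complex.I * (ξ : ℂ)) ^ j))
        =O[𝓝 0] fun ξ : ℝ => ξ ^ n := by
  have h1 := isBigO_pow_comp_mul ((pairing_coset_isBigO hy u γ).trans
    (isBigO_pow_pow_nhds_zero hn)) 2⁻¹
  have h2 := isBigO_pow_mul (isBigO_pow_comp_mul hu 2⁻¹) (continuousAt_exp_mul (Complex.I * γ / 2))
  refine ((h1.add h2).const_mul_left ((2 : ℂ) ^ j)).congr_left fun ξ => ?_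
  have e1 : Complex.I * γ * ((2⁻¹ * ξ : ℝ) : ℂ) = Complex.I * γ / 2 * ξ := by
    push_cast
    ring
  have e2 : (2 : ℂ) ^ j * (Complex.I * ((2⁻¹ * ξ : ℝ) : ℂ)) ^ j = (Complex.I * ξ) ^ j := by
    rw [← mul_pow]
    push_cast
    congr 1
    ring
  rw [pairing_smul, ← e2, e1, show (2 : ℝ) * (2⁻¹ * ξ) = ξ by ring]
  ring

theorem pairing_coset_zero_sub_isBigO {a : ℤ →₀ Matrix (Fin r) (Fin r) ℂ} {y : ℤ →₀ (Fin r → ℂ)}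
    {M : ℕ} (hy : HasSumRules a y M) {u : ℤ →₀ (Fin r → ℂ)} {β : ℂ} {j n : ℕ} (hn : n ≤ M)
    (hu : (fun ξ => pairing y u ξ - β * (Complex.I * (ξ : ℂ)) ^ j) =O[𝓝 0] fun ξ : ℝ => ξ ^ n) :
    pairing y ((2 : ℂ) ^ j • coset a u 0 - u) =O[𝓝 0] fun ξ : ℝ => ξ ^ n := by
  refine ((pairing_coset_isBigO' hy hn hu 0).sub hu).congr_left fun ξ => ?_
  rw [pairing_sub]
  simp

/-- On sequences whose pairing with the matching filter vanishes to the order `j`, the coset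
operators act as `2 ^ (-j)` modulo those whose pairing vanishes to the order `j + 1`. -/
theorem pairing_coset_sub_isBigO {a : ℤ →₀ Matrix (Fin r) (Fin r) ℂ} {y : ℤ →₀ (Fin r → ℂ)}
    {M : ℕ} (hy : HasSumRules a y M) {u : ℤ →₀ (Fin r → ℂ)} {j : ℕ} (hj : j + 1 ≤ M)
    (hu : pairing y u =O[𝓝 0] fun ξ : ℝ => ξ ^ j) (γ : ℤ) :
    pairing y ((2 : ℂ) ^ j • coset a u γ - u) =O[𝓝 0] fun ξ : ℝ => ξ ^ (j + 1) := by
  obtain ⟨β, hβ⟩ := exists_leading_coeff_I (analyticAt_pairing y u 0) hu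
  have h1 := (exp_mul_sub_one_isBigO (Complex.I * γ / 2)).mul (isBigO_const_mul_I_pow β j)
  simp only [← pow_add, add_comm 1 j] at h1
  refine (((pairing_coset_isBigO' hy hj hβ γ).sub hβ).add h1).congr_left fun ξ => ?_
  rw [pairing_sub]
  ring

theorem pairing_fwd_isBigO {y u : ℤ →₀ (Fin r → ℂ)} {j : ℕ}
    (hu : pairing y u =O[𝓝 0] fun ξ : ℝ => ξ ^ j) :
    pairing y (fwd u) =O[𝓝 0] fun ξ : ℝ => ξ ^ (j + 1) := by
  have h := (exp_mul_sub_one_isBigO Complex.I).mul hu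
  simp only [← pow_add, add_comm 1 j] at h
  exact h.congr_left fun ξ => (pairing_fwd y u ξ).symm

theorem pairing_fwd_leading {y u : ℤ →₀ (Fin r → ℂ)} {β : ℂ} {j : ℕ}
    (hu : (fun ξ => pairing y u ξ - β * (Complex.I * (ξ : ℂ)) ^ j) =O[𝓝 0]
      fun ξ : ℝ => ξ ^ (j + 1)) :
    (fun ξ => pairing y (fwd u) ξ - β * (Complex.I * (ξ : ℂ)) ^ (j + 1)) =O[𝓝 0]
      fun ξ : ℝ => ξ ^ (j + 2) := by
  have h1 := (exp_mul_sub_one_isBigO Complex.I).mul hu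
  have h2 := (exp_mul_sub_linear_isBigO Complex.I).mul (isBigO_const_mul_I_pow β j)
  simp only [← pow_add] at h1 h2
  rw [show 1 + (j + 1) = j + 2 by ring] at h1
  rw [add_comm 2 j] at h2
  refine (h1.add h2).congr_left fun ξ => ?_
  rw [pairing_fwd]
  ring

theorem pairing_iterate_fwd_leading {y u : ℤ →₀ (Fin r → ℂ)} {β : ℂ}
    (hu : (fun ξ => pairing y u ξ - β) =O[𝓝 0] fun ξ : ℝ => ξ ^ 1) (j : ℕ) :
    (fun ξ => pairing y (fwd^[j] u) ξ - β * (Complex.I * (ξ : ℂ)) ^ j) =O[𝓝 0]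
      fun ξ : ℝ => ξ ^ (j + 1) := by
  induction j with
  | zero => simpa using hu
  | succ j ih =>
    rw [Function.iterate_succ_apply']
    exact pairing_fwd_leading ih

theorem symbol_iterate_fwd (u : ℤ →₀ (Fin r → ℂ)) (j : ℕ) (ξ : ℝ) :
    symbol (fwd^[j] u) ξ = (Complex.exp (Complex.I * ξ) - 1) ^ j • symbol u ξ := by
  induction j with
  | zero => simp
  | succ j ih => rw [Function.iterate_succ_apply', symbol_fwd, ih, smul_smul, pow_succ']

theorem exists_dotProduct_eq_one {x : Fin r → ℂ} (hx : x ≠ 0) : ∃ z, x ⬝ᵥ z = 1 := by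
  obtain ⟨i, hi⟩ := Function.ne_iff.1 hx
  exact ⟨Pi.single i (x i)⁻¹, by simpa using mul_inv_cancel₀ hi⟩

theorem isBigO_pow_one_of_eq_zero {E : Type*} [NormedAddCommGroup E] [NormedSpace ℝ E]
    [CompleteSpace E] {f : ℝ → E} (hf : AnalyticAt ℝ f 0) (h : f 0 = 0) :
    f =O[𝓝 0] fun ξ : ℝ => ξ ^ 1 := by
  refine (isBigO_pow_iff_iteratedDeriv hf 1).2 fun j hj => ?_
  obtain rfl : j = 0 := by omega
  simpa using h

/-- The Taylor coefficients of the pairing are corrected one at a time, by iterated differences. -/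
theorem exists_pairing_eq_one {y : ℤ →₀ (Fin r → ℂ)} (hy : symbol y 0 ≠ 0) (n : ℕ) :
    ∃ u : ℤ →₀ (Fin r → ℂ), (fun ξ => pairing y u ξ - 1) =O[𝓝 0] fun ξ : ℝ => ξ ^ (n + 1) := by
  induction n with
  | zero =>
    obtain ⟨x, hx⟩ := exists_dotProduct_eq_one hy
    refine ⟨Finsupp.single 0 x, isBigO_pow_one_of_eq_zero
      ((analyticAt_pairing y _ 0).fun_sub analyticAt_const) ?_⟩
    simp [pairing, symbol_single, hx]
  | succ n ih =>
    obtain ⟨u, hu⟩ := ih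
    obtain ⟨c, hc⟩ := exists_leading_coeff_I
      ((analyticAt_pairing y u 0).fun_sub analyticAt_const) hu
    have h := pairing_iterate_fwd_leading (hu.trans (isBigO_pow_pow_nhds_zero (by omega))) (n + 1)
    refine ⟨u - c • fwd^[n + 1] u, (hc.sub (h.const_mul_left c)).congr_left fun ξ => ?_⟩
    rw [pairing_sub, pairing_smul]
    ring

theorem exists_pairing_isBigO {y : ℤ →₀ (Fin r → ℂ)} (hy : symbol y 0 ≠ 0) {w : Fin r → ℂ}
    (hw : symbol y 0 ⬝ᵥ w = 0) (n : ℕ) : ∃ u : ℤ →₀ (Fin r → ℂ),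
      pairing y u =O[𝓝 0] (fun ξ : ℝ => ξ ^ (n + 1)) ∧ symbol u 0 = w := by
  induction n with
  | zero =>
    refine ⟨Finsupp.single 0 w, isBigO_pow_one_of_eq_zero (analyticAt_pairing y _ 0) ?_, ?_⟩
    · simp [pairing, symbol_single, hw]
    · simp [symbol_single]
  | succ n ih =>
    obtain ⟨u, hu, hu0⟩ := ih
    obtain ⟨u₀, hu₀⟩ := exists_pairing_eq_one hy 0
    obtain ⟨c, hc⟩ := exists_leading_coeff_I (analyticAt_pairing y u 0) hu
    have h := pairing_iterate_fwd_leading hu₀ (n + 1)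
    refine ⟨u - c • fwd^[n + 1] u₀, (hc.sub (h.const_mul_left c)).congr_left fun ξ => ?_, ?_⟩
    · rw [pairing_sub, pairing_smul]
      ring
    · rw [symbol_sub, symbol_smul, symbol_iterate_fwd, hu0]
      simp

/-! ### Extension and uniqueness of matching filters -/

theorem vecMul_symbol_leading (a : ℤ →₀ Matrix (Fin r) (Fin r) ℂ) {f : ℝ → Fin r → ℂ}
    {c : Fin r → ℂ} {n : ℕ}
    (hf : (fun ξ => f ξ - ξ ^ n • c) =O[𝓝 0] fun ξ : ℝ => ξ ^ (n + 1)) :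
    (fun ξ => Matrix.vecMul (f (2 * ξ)) (symbol a ξ) -
      ξ ^ n • ((2 : ℂ) ^ n • Matrix.vecMul c (symbol a 0))) =O[𝓝 0]
        fun ξ : ℝ => ξ ^ (n + 1) := by
  have h1 := isBigO_vecMul_symbol a (isBigO_pow_comp_mul hf 2) 0
  have h2 : (fun ξ => Matrix.vecMul c (symbol a (ξ + 0)) - Matrix.vecMul c (symbol a 0)) =O[𝓝 0]
      fun ξ : ℝ => ξ ^ 1 := by
    refine isBigO_pow_one_of_eq_zero ?_ (by simp)
    exact (analyticAt_vecMul_symbol a analyticAt_const).fun_sub analyticAt_const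
  have h3 := (isBigO_refl (fun ξ : ℝ => ξ ^ n) (𝓝 0)).smul (h2.const_smul_left ((2 : ℂ) ^ n))
  simp only [smul_eq_mul, ← pow_add] at h3
  refine (h1.add h3).congr_left fun ξ => ?_
  have h4 : ((2 * ξ) ^ n • c : Fin r → ℂ) = ξ ^ n • (2 : ℂ) ^ n • c := by
    ext i
    simp [mul_pow]
    ring
  simp only [add_zero, Pi.smul_apply]
  rw [h4, Matrix.sub_vecMul, Matrix.smul_vecMul, Matrix.smul_vecMul, smul_sub, smul_sub]
  abel

theorem exists_vecMul_eq {A : Matrix (Fin r) (Fin r) ℂ} {t : ℂ} (hA : (t • A - 1).det ≠ 0)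
    (c : Fin r → ℂ) : ∃ x : Fin r → ℂ, t • Matrix.vecMul x A - x = c := by
  have hu : IsUnit (t • A - 1).det := isUnit_iff_ne_zero.2 hA
  refine ⟨Matrix.vecMul c (t • A - 1)⁻¹, ?_⟩
  have h : Matrix.vecMul (Matrix.vecMul c (t • A - 1)⁻¹) (t • A - 1) = c := by
    rw [Matrix.vecMul_vecMul, Matrix.nonsing_inv_mul _ hu, Matrix.vecMul_one]
  rwa [Matrix.vecMul_sub, Matrix.vecMul_smul, Matrix.vecMul_one] at h

theorem eq_zero_of_vecMul_eq {A : Matrix (Fin r) (Fin r) ℂ} {t : ℂ} (hA : (t • A - 1).det ≠ 0)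
    {x : Fin r → ℂ} (h : t • Matrix.vecMul x A - x = 0) : x = 0 := by
  have h1 : Matrix.vecMul x (t • A - 1) = 0 := by
    rwa [Matrix.vecMul_sub, Matrix.vecMul_smul, Matrix.vecMul_one]
  exact Matrix.eq_zero_of_vecMul_eq_zero hA h1

theorem symbol_iterate_fwd_single_leading (x : Fin r → ℂ) (n : ℕ) :
    (fun ξ => symbol (fwd^[n] (Finsupp.single 0 x)) ξ - ξ ^ n • Complex.I ^ n • x) =O[𝓝 0]
      fun ξ : ℝ => ξ ^ (n + 1) := by
  have h1 : (fun ξ : ℝ => (Complex.exp (Complex.I * ξ) - 1) ^ n - (Complex.I * ξ) ^ n) =O[𝓝 0]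
      fun ξ : ℝ => ξ ^ (n + 1) := by
    induction n with
    | zero => simpa using isBigO_zero _ _
    | succ n ih =>
      have h2 := (exp_mul_sub_one_isBigO Complex.I).mul ih
      have h3 := (exp_mul_sub_linear_isBigO Complex.I).mul (isBigO_const_mul_I_pow 1 n)
      simp only [← pow_add] at h2 h3
      rw [show 1 + (n + 1) = n + 1 + 1 by ring] at h2
      rw [show 2 + n = n + 1 + 1 by ring] at h3
      refine (h2.add h3).congr_left fun ξ => ?_
      ring
  have h2 := h1.smul (isBigO_refl (fun _ : ℝ => x) (𝓝 0))
  have h3 : (fun _ : ℝ => x) =O[𝓝 0] fun _ : ℝ => (1 : ℝ) := isBigO_const_const _ one_ne_zero _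
  have h4 := h1.smul h3
  simp only [smul_eq_mul, mul_one] at h4
  refine h4.congr_left fun ξ => ?_
  rw [symbol_iterate_fwd, symbol_single, sub_smul]
  ext i
  simp [mul_pow]
  ring

/-- A matching filter of order `n` extends to one of order `n + 1`, provided that `2 ^ (-n)` is not
an eigenvalue of `â(0)`. -/
theorem IsMatchingFilter.exists_succ {a : ℤ →₀ Matrix (Fin r) (Fin r) ℂ} {v : ℤ →₀ (Fin r → ℂ)}
    {n : ℕ} (hv : IsMatchingFilter a v n) (hn : n ≠ 0)
    (hdet : ((2 : ℂ) ^ n • symbol a 0 - 1).det ≠ 0) :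
    ∃ y, IsMatchingFilter a y (n + 1) ∧
      (fun ξ => symbol y ξ - symbol v ξ) =O[𝓝 0] fun ξ : ℝ => ξ ^ n := by
  rw [isMatchingFilter_iff] at hv
  obtain ⟨hv0, hv⟩ := hv
  have han : AnalyticAt ℝ
      (fun ξ => Matrix.vecMul (symbol v (2 * ξ)) (symbol a ξ) - symbol v ξ) 0 := by
    have := (analyticAt_vecMul_symbol a (t := 0) (analyticAt_symbol_two_mul v 0)).fun_sub
      (analyticAt_symbol v 0)
    simpa using this
  obtain ⟨c, hc⟩ := exists_leading_coeff han hv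
  obtain ⟨x, hx⟩ := exists_vecMul_eq hdet (-(Complex.I ^ n)⁻¹ • c)
  set q := fwd^[n] (Finsupp.single (0 : ℤ) x) with hq
  have hq1 : (fun ξ => symbol q ξ - ξ ^ n • Complex.I ^ n • x) =O[𝓝 0] fun ξ : ℝ => ξ ^ (n + 1) :=
    symbol_iterate_fwd_single_leading x n
  have hq2 := (vecMul_symbol_leading a hq1).sub hq1
  refine ⟨v + q, isMatchingFilter_iff.2 ⟨?_, (hc.add hq2).congr_left fun ξ => ?_⟩, ?_⟩
  · rw [symbol_add, hq, symbol_iterate_fwd]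
    simpa [hn] using hv0
  · have h5 : (2 : ℂ) ^ n • Matrix.vecMul (Complex.I ^ n • x) (symbol a 0) - Complex.I ^ n • x
        = -c := by
      rw [Matrix.smul_vecMul, smul_comm, ← smul_sub, hx, smul_smul, mul_neg,
        mul_inv_cancel₀ (pow_ne_zero _ Complex.I_ne_zero), neg_one_smul]
    have h6 : ξ ^ n • (2 : ℂ) ^ n • Matrix.vecMul (Complex.I ^ n • x) (symbol a 0) =
        ξ ^ n • Complex.I ^ n • x - ξ ^ n • c := by
      rw [← smul_sub, ← neg_add_eq_sub, ← h5, sub_add_cancel]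
    rw [h6, symbol_add, symbol_add, Matrix.add_vecMul]
    abel
  · have h7 : (fun ξ : ℝ => ξ ^ n • Complex.I ^ n • x) =O[𝓝 0] fun ξ : ℝ => ξ ^ n :=
      isBigO_pow_of_factor continuousAt_const (Eventually.of_forall fun _ => rfl)
    refine ((hq1.trans (isBigO_pow_pow_nhds_zero n.le_succ)).add h7).congr_left fun ξ => ?_
    rw [symbol_add]
    simp

/-- Matching filters are determined by their values at `0`, up to their order, provided that the
numbers `2 ^ (-n)` with `0 < n < M` are not eigenvalues of `â(0)`. -/
theorem IsMatchingFilter.sub_isBigO {a : ℤ →₀ Matrix (Fin r) (Fin r) ℂ} {v y : ℤ →₀ (Fin r → ℂ)}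
    {M : ℕ} (hv : IsMatchingFilter a v M) (hy : IsMatchingFilter a y M) {t : ℂ}
    (h0 : symbol y 0 = t • symbol v 0)
    (hdet : ∀ n, 0 < n → n < M → ((2 : ℂ) ^ n • symbol a 0 - 1).det ≠ 0) :
    (fun ξ => symbol y ξ - t • symbol v ξ) =O[𝓝 0] fun ξ : ℝ => ξ ^ M := by
  have hd : ∀ ξ, symbol (y - t • v) ξ = symbol y ξ - t • symbol v ξ := fun ξ => by
    rw [symbol_sub, symbol_smul]
  simp only [← hd]
  have h1 : (fun ξ => Matrix.vecMul (symbol (y - t • v) (2 * ξ)) (symbol a ξ) -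
      symbol (y - t • v) ξ) =O[𝓝 0] fun ξ : ℝ => ξ ^ M := by
    refine ((isMatchingFilter_iff.1 hy).2.sub
      ((isMatchingFilter_iff.1 hv).2.const_smul_left t)).congr_left fun ξ => ?_
    rw [hd, hd, Matrix.sub_vecMul, Matrix.smul_vecMul, Pi.smul_apply, smul_sub]
    abel
  have key : ∀ n ≤ M, symbol (y - t • v) =O[𝓝 0] fun ξ : ℝ => ξ ^ n := by
    intro n
    induction n with
    | zero =>
      intro _
      simpa using (continuous_symbol _).continuousAt.norm.isBoundedUnder_le.isBigO_one ℝ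
    | succ n ih =>
      intro hn
      rcases Nat.eq_zero_or_pos n with rfl | hpos
      · exact isBigO_pow_one_of_eq_zero (analyticAt_symbol _ 0) (by rw [hd, h0, sub_self])
      obtain ⟨c, hc⟩ := exists_leading_coeff (analyticAt_symbol (y - t • v) 0) (ih (by omega))
      have h2 := ((h1.trans (isBigO_pow_pow_nhds_zero hn)).sub
        (vecMul_symbol_leading a hc)).add hc
      have h3 : (2 : ℂ) ^ n • Matrix.vecMul c (symbol a 0) - c = 0 := by
        refine eq_zero_of_pow_smul_isBigO (n := n) (h2.congr_left fun ξ => ?_)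
        rw [smul_sub]
        abel
      have h4 := eq_zero_of_vecMul_eq (hdet n hpos (by omega)) h3
      simpa [h4] using hc
  exact key M le_rfl

/-- The pairing of the subdivision data with a dilated matching filter. -/
theorem IsMatchingFilter.dotProduct_iterSeq_isBigO {a : ℤ →₀ Matrix (Fin r) (Fin r) ℂ}
    {y : ℤ →₀ (Fin r → ℂ)} {M : ℕ} (hy : IsMatchingFilter a y M) (u : ℤ →₀ (Fin r → ℂ)) (n : ℕ) :
    (fun ξ => symbol y (2 ^ n * ξ) ⬝ᵥ symbol (iterSeq a u n) ξ - 2 ^ n * pairing y u ξ) =O[𝓝 0]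
      fun ξ : ℝ => ξ ^ M := by
  induction n with
  | zero => simpa [iterSeq, pairing] using isBigO_zero _ _
  | succ n ih =>
    have h1 := isBigO_dotProduct_left
      (isBigO_pow_comp_mul (isMatchingFilter_iff.1 hy).2 (2 ^ n))
      (continuous_symbol (iterSeq a u n)).continuousAt
    refine ((h1.add ih).const_mul_left (2 : ℂ)).congr_left fun ξ => ?_
    rw [symbol_iterSeq_succ, dotProduct_smul, Matrix.dotProduct_mulVec, sub_dotProduct,
      show (2 : ℝ) ^ (n + 1) * ξ = 2 * (2 ^ n * ξ) by ring, smul_eq_mul]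
    ring

end Pairing

/-! ### Decay of the subdivision data -/

section Decay

variable {r : ℕ}

/-- The data `S_a ^ n (δ I_r) * u` decay at least like `p ^ n`, uniformly. -/
def Decays (a : ℤ →₀ Matrix (Fin r) (Fin r) ℂ) (u : ℤ →₀ (Fin r → ℂ)) (p : ℝ) : Prop :=
  ∃ C : ℝ, ∀ (n : ℕ) (k : ℤ), ‖subdivData a u n k‖ ≤ C * p ^ n

theorem exists_norm_subdivData_le (a : ℤ →₀ Matrix (Fin r) (Fin r) ℂ) (u : ℤ →₀ (Fin r → ℂ))
    (n : ℕ) : ∃ B : ℝ, 0 ≤ B ∧ ∀ k, ‖subdivData a u n k‖ ≤ B := by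
  refine ⟨∑ k ∈ (iterSeq a u n).support, ‖iterSeq a u n k‖, by positivity, fun k => ?_⟩
  rw [← coe_iterSeq]
  by_cases hk : k ∈ (iterSeq a u n).support
  · exact Finset.single_le_sum (f := fun k => ‖iterSeq a u n k‖) (fun _ _ => norm_nonneg _) hk
  · rw [Finsupp.notMem_support_iff.1 hk, norm_zero]
    positivity

theorem Decays.of_eventually {a : ℤ →₀ Matrix (Fin r) (Fin r) ℂ} {u : ℤ →₀ (Fin r → ℂ)} {p : ℝ}
    (hp : 0 < p) (h : ∀ᶠ n : ℕ in atTop, ∀ k, ‖subdivData a u n k‖ ≤ p ^ n) : Decays a u p := by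
  obtain ⟨n₀, hn₀⟩ := eventually_atTop.1 h
  choose B hB0 hB using exists_norm_subdivData_le a u
  -- the finitely many exceptional `n` are absorbed into the constant
  refine ⟨1 + ∑ n ∈ Finset.range n₀, B n / p ^ n, fun n k => ?_⟩
  have hS : 0 ≤ ∑ n ∈ Finset.range n₀, B n / p ^ n :=
    Finset.sum_nonneg fun i _ => div_nonneg (hB0 i) (by positivity)
  have hpn : 0 < p ^ n := by positivity
  rcases le_or_gt n₀ n with hn | hn
  · exact (hn₀ n hn k).trans (le_mul_of_one_le_left hpn.le (by linarith))
  · have h1 : B n / p ^ n ≤ ∑ n ∈ Finset.range n₀, B n / p ^ n :=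
      Finset.single_le_sum (f := fun n => B n / p ^ n)
        (fun i _ => div_nonneg (hB0 i) (by positivity)) (Finset.mem_range.2 hn)
    rw [div_le_iff₀ hpn] at h1
    nlinarith [hB n k]

theorem rhoInfty_eq {a : ℤ →₀ Matrix (Fin r) (Fin r) ℂ} {v : ℤ →₀ (Fin r → ℂ)} {σ : ℝ}
    (hσ : smInfty a v = (σ : EReal)) :
    rhoInfty a v (sr a) = ENNReal.ofReal ((2 : ℝ) ^ (-σ)) := by
  have hlog : 0 < Real.log 2 := Real.log_pos one_lt_two
  have h1 : ENNReal.log (rhoInfty a v (sr a)) = ((-σ * Real.log 2 : ℝ) : EReal) := by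
    unfold smInfty at hσ
    induction h : ENNReal.log (rhoInfty a v (sr a)) with
    | bot =>
      rw [h, EReal.bot_div_of_pos_ne_top (by exact_mod_cast hlog) (EReal.coe_ne_top _)] at hσ
      simp at hσ
    | top =>
      rw [h, EReal.top_div_of_pos_ne_top (by exact_mod_cast hlog) (EReal.coe_ne_top _)] at hσ
      simp at hσ
    | coe x =>
      rw [h, ← EReal.coe_div, ← EReal.coe_neg, EReal.coe_eq_coe_iff] at hσ
      rw [← hσ]
      congr 1
      field_simp
  rw [← ENNReal.exp_log (rhoInfty a v (sr a)), h1, EReal.exp_coe, Real.rpow_def_of_pos two_pos,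
    mul_comm]

theorem decays_of_smInfty {a : ℤ →₀ Matrix (Fin r) (Fin r) ℂ} {v : ℤ →₀ (Fin r → ℂ)} {σ : ℝ}
    (hσ : smInfty a v = (σ : EReal)) {u : ℤ →₀ (Fin r → ℂ)}
    (hu : pairing v u =O[𝓝 0] fun ξ : ℝ => ξ ^ (sr a)) {p : ℝ} (hp : (2 : ℝ) ^ (-σ) < p) :
    Decays a u p := by
  have hp0 : 0 < p := (Real.rpow_pos_of_pos two_pos _).trans hp
  have h1 : limsup (fun n : ℕ => (⨆ k : ℤ, ‖subdivData a u n k‖ₑ) ^ (1 / (n : ℝ))) atTop <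
      ENNReal.ofReal p := by
    refine lt_of_le_of_lt ?_ ((ENNReal.ofReal_lt_ofReal_iff hp0).2 hp)
    rw [← rhoInfty_eq hσ, rhoInfty]
    refine le_iSup₂ (f := fun (u : ℤ →₀ (Fin r → ℂ))
      (_ : u ∈ {u | AgreeToOrder (sr a) (pairing v u) fun _ => 0}) =>
      limsup (fun n : ℕ => (⨆ k : ℤ, ‖subdivData a u n k‖ₑ) ^ (1 / (n : ℝ))) atTop) u ?_
    change AgreeToOrder _ _ _
    rw [agreeToOrder_iff_isBigO (analyticAt_pairing v u 0) analyticAt_const]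
    simpa using hu
  refine Decays.of_eventually hp0 ?_
  filter_upwards [eventually_lt_of_limsup_lt h1, eventually_gt_atTop 0] with n hn hn0 k
  have hn' : (n : ℝ) ≠ 0 := by exact_mod_cast hn0.ne'
  have h2 : (⨆ k : ℤ, ‖subdivData a u n k‖ₑ) ≤ ENNReal.ofReal p ^ n := by
    have h3 := ENNReal.rpow_le_rpow hn.le (Nat.cast_nonneg n)
    rwa [← ENNReal.rpow_mul, one_div, inv_mul_cancel₀ hn', ENNReal.rpow_one,
      ENNReal.rpow_natCast] at h3
  have h4 := (le_iSup (fun k : ℤ => ‖subdivData a u n k‖ₑ) k).trans h2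
  rw [← ENNReal.ofReal_pow hp0.le, ← ofReal_norm] at h4
  exact (ENNReal.ofReal_le_ofReal_iff (by positivity)).1 h4

theorem exists_eq_two_mul_add (k : ℤ) : ∃ q γ : ℤ, k = 2 * q + γ ∧ (γ = 0 ∨ γ = 1) := by
  rcases Int.even_or_odd' k with ⟨q, h | h⟩
  · exact ⟨q, 0, by omega, Or.inl rfl⟩
  · exact ⟨q, 1, by omega, Or.inr rfl⟩

theorem subdivData_succ_eq (a : ℤ →₀ Matrix (Fin r) (Fin r) ℂ) (u : ℤ →₀ (Fin r → ℂ)) (j n : ℕ)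
    (γ k : ℤ) : (2 : ℂ) ^ j • subdivData a u (n + 1) (2 * k + γ) =
      subdivData a u n k + subdivData a ((2 : ℂ) ^ j • coset a u γ - u) n k := by
  rw [subdivData_succ, subdivData_sub, subdivData_smul]
  abel

/-- The decay rate for sequences whose pairing with `v` vanishes to a lower order: on the quotient
of two consecutive such spaces the coset operators are the scalar `2 ^ (-l)`. -/
theorem decays_of_isBigO {a : ℤ →₀ Matrix (Fin r) (Fin r) ℂ} {v : ℤ →₀ (Fin r → ℂ)} {M : ℕ}
    (hv : HasSumRules a v M) {ρ : ℝ} (hρ : 0 < ρ)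
    (hM : ∀ u, (pairing v u =O[𝓝 0] fun ξ : ℝ => ξ ^ M) → ∀ p, ρ < p → Decays a u p)
    {l : ℕ} (hl : l ≤ M) (u : ℤ →₀ (Fin r → ℂ))
    (hu : pairing v u =O[𝓝 0] fun ξ : ℝ => ξ ^ l) (p : ℝ) (hp : ρ < p)
    (hpl : ((2 : ℝ) ^ l)⁻¹ < p) : Decays a u p := by
  induction hl using Nat.decreasingInduction generalizing u with
  | self => exact hM u hu p hp
  | of_succ l hlM ih =>
    have hp0 : 0 < p := hρ.trans hp
    have h2l : (0 : ℝ) < 2 ^ l := by positivity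
    have hpl' : ((2 : ℝ) ^ (l + 1))⁻¹ < p := by
      refine lt_of_le_of_lt ?_ hpl
      gcongr
      · norm_num
      · omega
    obtain ⟨C₀, hC₀⟩ := ih _ (pairing_coset_sub_isBigO hv hlM hu 0) hpl'
    obtain ⟨C₁, hC₁⟩ := ih _ (pairing_coset_sub_isBigO hv hlM hu 1) hpl'
    obtain ⟨B, hB0, hB⟩ := exists_norm_subdivData_le a u 0
    set C := max 0 (max C₀ C₁) with hC
    have hq : 0 < 2 ^ l * p - 1 := by
      rw [inv_lt_iff_one_lt_mul₀ h2l] at hpl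
      linarith [mul_comm p (2 ^ l)]
    -- the errors `C p ^ n` of the single steps sum up as a geometric series of ratio `2 ^ l p > 1`
    refine ⟨max B (C / (2 ^ l * p - 1)), fun n => ?_⟩
    induction n with
    | zero => intro k; simpa using Or.inl (hB k)
    | succ n ihn =>
      intro k
      obtain ⟨q, γ, rfl, hγ⟩ := exists_eq_two_mul_add k
      have h1 := subdivData_succ_eq a u l n γ q
      have h2 : ‖subdivData a ((2 : ℂ) ^ l • coset a u γ - u) n q‖ ≤ C * p ^ n := by
        rcases hγ with rfl | rfl
        · refine (hC₀ n q).trans (mul_le_mul_of_nonneg_right ?_ (by positivity))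
          simp [hC]
        · refine (hC₁ n q).trans (mul_le_mul_of_nonneg_right ?_ (by positivity))
          simp [hC]
      have h3 := congrArg norm h1
      rw [norm_smul, norm_pow, Complex.norm_ofNat] at h3
      have h4 := norm_add_le (subdivData a u n q)
        (subdivData a ((2 : ℂ) ^ l • coset a u γ - u) n q)
      set D := max B (C / (2 ^ l * p - 1)) with hD
      have h5 : C ≤ D * (2 ^ l * p - 1) := by
        rw [← div_le_iff₀ hq]
        exact le_max_right _ _
      have h6 := ihn q
      refine le_of_mul_le_mul_left ?_ h2l
      calc 2 ^ l * ‖subdivData a u (n + 1) (2 * q + γ)‖ ≤ D * p ^ n + C * p ^ n := by linarith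
        _ = (D + C) * p ^ n := by ring
        _ ≤ (D * (2 ^ l * p)) * p ^ n := by gcongr; linarith
        _ = 2 ^ l * (D * p ^ (n + 1)) := by ring

theorem exists_iterSeq_support_subset (a : ℤ →₀ Matrix (Fin r) (Fin r) ℂ) (u : ℤ →₀ (Fin r → ℂ)) :
    ∃ L : ℕ, ∀ n, (iterSeq a u n).support ⊆ Finset.Icc (-(2 ^ n * L : ℤ)) (2 ^ n * L) := by
  obtain ⟨N, hN⟩ := exists_support_bound a
  obtain ⟨N', hN'⟩ := exists_support_bound u
  refine ⟨N + N', fun n k hk => ?_⟩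
  rw [Finset.mem_Icc, ← abs_le]
  by_contra! h
  refine (Finsupp.mem_support_iff.1 hk) ?_
  rw [coe_iterSeq]
  refine subdivData_eq_zero hN hN' n k (lt_of_le_of_lt ?_ h)
  have h1 : (1 : ℤ) ≤ 2 ^ n := one_le_pow₀ (by norm_num)
  push_cast
  nlinarith [Int.natCast_nonneg N, Int.natCast_nonneg N']

theorem card_Icc_two_pow_le (n L : ℕ) :
    ((Finset.Icc (-(2 ^ n * L : ℤ)) (2 ^ n * L)).card : ℝ) ≤ 2 ^ n * (2 * L + 1) := by
  have h : (Finset.Icc (-(2 ^ n * L : ℤ)) (2 ^ n * L)).card = 2 * (2 ^ n * L) + 1 := by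
    rw [Int.card_Icc]
    have h0 : (2 ^ n * L : ℤ) = ((2 ^ n * L : ℕ) : ℤ) := by push_cast; rfl
    rw [h0]
    omega
  rw [h]
  push_cast
  have h1 : (1 : ℝ) ≤ 2 ^ n := one_le_pow₀ (by norm_num)
  nlinarith

theorem Decays.sum_norm_le {a : ℤ →₀ Matrix (Fin r) (Fin r) ℂ} {u : ℤ →₀ (Fin r → ℂ)} {p : ℝ}
    (h : Decays a u p) : ∃ C : ℝ, ∀ n,
      ∑ k ∈ (iterSeq a u n).support, ‖iterSeq a u n k‖ ≤ C * (2 * p) ^ n := by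
  obtain ⟨C, hC⟩ := h
  obtain ⟨L, hL⟩ := exists_iterSeq_support_subset a u
  refine ⟨(2 * L + 1) * C, fun n => ?_⟩
  have h0 : 0 ≤ C * p ^ n := (norm_nonneg _).trans (hC n 0)
  calc ∑ k ∈ (iterSeq a u n).support, ‖iterSeq a u n k‖
      ≤ ∑ k ∈ (iterSeq a u n).support, C * p ^ n :=
        Finset.sum_le_sum fun k _ => by rw [coe_iterSeq]; exact hC n k
    _ = (iterSeq a u n).support.card * (C * p ^ n) := by rw [Finset.sum_const, nsmul_eq_mul]
    _ ≤ (2 ^ n * (2 * L + 1)) * (C * p ^ n) := by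
        gcongr
        exact le_trans (by exact_mod_cast Finset.card_le_card (hL n)) (card_Icc_two_pow_le n L)
    _ = _ := by rw [mul_pow]; ring

theorem norm_symbol_le (c : ℤ →₀ (Fin r → ℂ)) (ξ : ℝ) :
    ‖symbol c ξ‖ ≤ ∑ k ∈ c.support, ‖c k‖ := by
  refine (norm_sum_le _ _).trans (Finset.sum_le_sum fun k _ => ?_)
  have h : -(Complex.I * (k : ℂ) * (ξ : ℂ)) = ((-(k * ξ) : ℝ) : ℂ) * Complex.I := by
    push_cast
    ring
  rw [norm_smul, h, Complex.norm_exp_ofReal_mul_I, one_mul]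

theorem norm_dotProduct_le_card (x z : Fin r → ℂ) : ‖x ⬝ᵥ z‖ ≤ r * (‖x‖ * ‖z‖) := by
  refine (norm_sum_le _ _).trans ?_
  calc ∑ i, ‖x i * z i‖ ≤ ∑ _i : Fin r, ‖x‖ * ‖z‖ := Finset.sum_le_sum fun i _ => by
        rw [norm_mul]
        gcongr <;> exact norm_le_pi_norm _ i
    _ = r * (‖x‖ * ‖z‖) := by simp

theorem symbol_dotProduct_symbol (y s : ℤ →₀ (Fin r → ℂ)) (d ξ : ℝ) :
    symbol y (d * ξ) ⬝ᵥ symbol s ξ = ∑ l ∈ y.support, ∑ k ∈ s.support,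
      Complex.exp (-(Complex.I * (d * l + k)) * ξ) * (y l ⬝ᵥ s k) := by
  rw [symbol, symbol, Finsupp.sum, Finsupp.sum, sum_dotProduct]
  refine Finset.sum_congr rfl fun l _ => ?_
  rw [dotProduct_sum]
  refine Finset.sum_congr rfl fun k _ => ?_
  rw [smul_dotProduct, dotProduct_smul, smul_eq_mul, smul_eq_mul, ← mul_assoc, ← Complex.exp_add]
  congr 2
  push_cast
  ring

theorem norm_iteratedDeriv_dotProduct_le (y s : ℤ →₀ (Fin r → ℂ)) (d : ℝ) (j : ℕ) {B : ℝ}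
    (hB : ∀ l ∈ y.support, ∀ k ∈ s.support, |d * l + k| ≤ B) :
    ‖iteratedDeriv j (fun ξ => symbol y (d * ξ) ⬝ᵥ symbol s ξ) 0‖ ≤
      B ^ j * (r * ((∑ l ∈ y.support, ‖y l‖) * ∑ k ∈ s.support, ‖s k‖)) := by
  have han : ∀ (z c : ℂ), AnalyticAt ℝ (fun ξ : ℝ => Complex.exp (z * ξ) * c) 0 := fun z c =>
    (analyticAt_exp_mul z 0).fun_mul analyticAt_const
  have h1 : iteratedDeriv j (fun ξ => symbol y (d * ξ) ⬝ᵥ symbol s ξ) 0 =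
      ∑ l ∈ y.support, ∑ k ∈ s.support, (-(Complex.I * (d * l + k))) ^ j * (y l ⬝ᵥ s k) := by
    rw [show (fun ξ => symbol y (d * ξ) ⬝ᵥ symbol s ξ) = _ from
      funext (symbol_dotProduct_symbol y s d)]
    rw [iteratedDeriv_fun_sum fun l _ =>
      (Finset.analyticAt_fun_sum _ fun k _ => han _ _).contDiffAt]
    refine Finset.sum_congr rfl fun l _ => ?_
    rw [iteratedDeriv_fun_sum fun k _ => (han _ _).contDiffAt]
    refine Finset.sum_congr rfl fun k _ => ?_
    rw [iteratedDeriv_mul_const_field, iteratedDeriv_exp_mul]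
    simp
  rw [h1, Finset.sum_mul_sum, Finset.mul_sum, Finset.mul_sum]
  refine (norm_sum_le _ _).trans (Finset.sum_le_sum fun l hl => ?_)
  rw [Finset.mul_sum, Finset.mul_sum]
  refine (norm_sum_le _ _).trans (Finset.sum_le_sum fun k hk => ?_)
  rw [norm_mul, norm_pow, norm_neg, norm_mul, Complex.norm_I, one_mul]
  have h2 : ‖(d * l + k : ℂ)‖ = |d * l + k| := by
    rw [← Real.norm_eq_abs, ← Complex.norm_real]
    push_cast
    rfl
  rw [h2]
  have h3 := hB l hl k hk
  have h4 : 0 ≤ B := (abs_nonneg _).trans h3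
  gcongr
  exact norm_dotProduct_le_card _ _

theorem iteratedDeriv_mul_I_pow (c : ℂ) (j : ℕ) :
    iteratedDeriv j (fun ξ : ℝ => c * (Complex.I * (ξ : ℂ)) ^ j) 0 =
      c * Complex.I ^ j * j.factorial := by
  have h : (fun ξ : ℝ => c * (Complex.I * (ξ : ℂ)) ^ j) =
      fun ξ : ℝ => ξ ^ j • (c * Complex.I ^ j) := by
    funext ξ
    rw [mul_pow, Complex.real_smul]
    push_cast
    ring
  rw [h, iteratedDeriv_smul_const (by fun_prop), iteratedDeriv_fun_pow_zero, if_pos rfl,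
    Complex.real_smul]
  push_cast
  ring

end Decay

section Spectral

variable {r : ℕ}

/-- The subdivision data of a sequence whose pairing with a matching filter has the exact order `j`
cannot decay faster than `2 ^ (-j n)`: their `j`-th discrete moments would be too small. -/
theorem IsMatchingFilter.le_of_decays {a : ℤ →₀ Matrix (Fin r) (Fin r) ℂ} {y u : ℤ →₀ (Fin r → ℂ)}
    {j : ℕ} (hy : IsMatchingFilter a y (j + 1))
    (hu : (fun ξ => pairing y u ξ - 1 * (Complex.I * (ξ : ℂ)) ^ j) =O[𝓝 0]
      fun ξ : ℝ => ξ ^ (j + 1)) {p : ℝ} (hp : 0 < p) (hd : Decays a u p) :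
    ((2 : ℝ) ^ j)⁻¹ ≤ p := by
  by_contra! hlt
  obtain ⟨C, hC⟩ := hd.sum_norm_le
  obtain ⟨L, hL⟩ := exists_iterSeq_support_subset a u
  obtain ⟨L', hL'⟩ := exists_support_bound y
  set Y := ∑ l ∈ y.support, ‖y l‖ with hY
  have hY0 : 0 ≤ Y := Finset.sum_nonneg fun _ _ => norm_nonneg _
  have key : ∀ n : ℕ, (j.factorial : ℝ) ≤ ((L' + L : ℝ) ^ j * (r * (Y * C))) * (2 ^ j * p) ^ n := by
    intro n
    have h1 := ((hy.dotProduct_iterSeq_isBigO u n).add (hu.const_mul_left (2 ^ n)))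
    have han : AnalyticAt ℝ
        (fun ξ => symbol y (2 ^ n * ξ) ⬝ᵥ symbol (iterSeq a u n) ξ) 0 := by
      change AnalyticAt ℝ
        (fun ξ => ∑ i, symbol y (2 ^ n * ξ) i * symbol (iterSeq a u n) ξ i) 0
      refine Finset.analyticAt_fun_sum _ fun i _ => ?_
      exact ((analyticAt_symbol_apply y i (2 ^ n * 0)).comp_of_eq (f := fun ξ : ℝ => 2 ^ n * ξ)
        (by fun_prop) rfl).fun_mul (analyticAt_symbol_apply _ i 0)
    have han' : AnalyticAt ℝ (fun ξ : ℝ => (2 : ℂ) ^ n * (Complex.I * (ξ : ℂ)) ^ j) 0 :=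
      analyticAt_const.fun_mul ((analyticAt_const.fun_mul (Complex.ofRealCLM.analyticAt 0)).fun_pow
        j)
    have h2 : (fun ξ => symbol y (2 ^ n * ξ) ⬝ᵥ symbol (iterSeq a u n) ξ -
        (2 : ℂ) ^ n * (Complex.I * (ξ : ℂ)) ^ j) =O[𝓝 0] fun ξ : ℝ => ξ ^ (j + 1) :=
      h1.congr_left fun ξ => by ring
    have h3 := (agreeToOrder_iff_isBigO han han' (j + 1)).2 h2 j (by omega)
    rw [iteratedDeriv_mul_I_pow] at h3
    have h4 := norm_iteratedDeriv_dotProduct_le y (iterSeq a u n) (2 ^ n) j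
      (B := 2 ^ n * (L' + L)) (by
        intro l hl k hk
        have hl' : |l| ≤ L' := by
          by_contra! h
          exact (Finsupp.mem_support_iff.1 hl) (hL' l h)
        have hk' : |k| ≤ 2 ^ n * L := by
          have := hL n hk
          rwa [Finset.mem_Icc, ← abs_le] at this
        have hl'' : |(l : ℝ)| ≤ L' := by exact_mod_cast hl'
        have hk'' : |(k : ℝ)| ≤ 2 ^ n * L := by exact_mod_cast hk'
        calc |(2 : ℝ) ^ n * l + k| ≤ |(2 : ℝ) ^ n * l| + |(k : ℝ)| := abs_add_le _ _
          _ = 2 ^ n * |(l : ℝ)| + |(k : ℝ)| := by rw [abs_mul, abs_of_pos (by positivity)]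
          _ ≤ 2 ^ n * L' + 2 ^ n * L := by gcongr
          _ = _ := by ring)
    rw [h3, norm_mul, norm_mul, norm_pow, norm_pow, Complex.norm_I, one_pow, mul_one,
      Complex.norm_ofNat, Complex.norm_natCast] at h4
    have h5 : (2 : ℝ) ^ n * j.factorial ≤
        2 ^ n * (((L' + L : ℝ) ^ j * (r * (Y * C))) * (2 ^ j * p) ^ n) := by
      refine h4.trans ?_
      calc _ ≤ ((2 : ℝ) ^ n * (L' + L)) ^ j * (r * (Y * (C * (2 * p) ^ n))) := by
            gcongr
            exact hC n
        _ = _ := by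
            rw [mul_pow, mul_pow 2 p n, mul_pow _ p n, ← pow_mul, ← pow_mul, mul_comm n j]
            ring
    exact le_of_mul_le_mul_left h5 (by positivity)
  have h1 : Tendsto (fun n : ℕ => ((L' + L : ℝ) ^ j * (r * (Y * C))) * (2 ^ j * p) ^ n) atTop
      (𝓝 0) := by
    have : 2 ^ j * p < 1 := by
      have h2j : (0 : ℝ) < 2 ^ j := by positivity
      calc 2 ^ j * p < 2 ^ j * (2 ^ j)⁻¹ := by gcongr
        _ = 1 := mul_inv_cancel₀ h2j.ne'
    simpa using (tendsto_pow_atTop_nhds_zero_of_lt_one (by positivity) this).const_mul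
      ((L' + L : ℝ) ^ j * (r * (Y * C)))
  have h2 : (j.factorial : ℝ) ≤ 0 := ge_of_tendsto' h1 key
  have h3 : (0 : ℝ) < j.factorial := by exact_mod_cast j.factorial_pos
  linarith

/-! ### The spectrum of `â(0)` -/

theorem symbol_iterSeq_zero (a : ℤ →₀ Matrix (Fin r) (Fin r) ℂ) (u : ℤ →₀ (Fin r → ℂ)) (n : ℕ) :
    symbol (iterSeq a u n) 0 = (2 : ℂ) ^ n • Matrix.mulVec (symbol a 0 ^ n) (symbol u 0) := by
  induction n with
  | zero => simp [iterSeq]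
  | succ n ih =>
    rw [symbol_iterSeq_succ, mul_zero, ih, Matrix.mulVec_smul, Matrix.mulVec_mulVec, ← pow_succ',
      smul_smul, ← pow_succ']

theorem Decays.norm_pow_mulVec_le {a : ℤ →₀ Matrix (Fin r) (Fin r) ℂ} {u : ℤ →₀ (Fin r → ℂ)}
    {p : ℝ} (h : Decays a u p) :
    ∃ C : ℝ, ∀ n : ℕ, ‖Matrix.mulVec (symbol a 0 ^ n) (symbol u 0)‖ ≤ C * p ^ n := by
  obtain ⟨C, hC⟩ := h.sum_norm_le
  refine ⟨C, fun n => ?_⟩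
  have h1 := (norm_symbol_le (iterSeq a u n) 0).trans (hC n)
  rw [symbol_iterSeq_zero, norm_smul, norm_pow, Complex.norm_ofNat, mul_pow, mul_left_comm] at h1
  exact le_of_mul_le_mul_left h1 (by positivity)

/-- The powers of `A` decay at least like `p ^ n` on the kernel of the row `x`. -/
def KerDecay (A : Matrix (Fin r) (Fin r) ℂ) (x : Fin r → ℂ) (p : ℝ) : Prop :=
  ∀ w, x ⬝ᵥ w = 0 → ∃ C : ℝ, ∀ n : ℕ, ‖Matrix.mulVec (A ^ n) w‖ ≤ C * p ^ n

theorem KerDecay.tendsto {A : Matrix (Fin r) (Fin r) ℂ} {x : Fin r → ℂ} {p : ℝ}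
    (h : KerDecay A x p) (hp : 0 < p) (hp1 : p < 1) {w : Fin r → ℂ} (hw : x ⬝ᵥ w = 0) :
    Tendsto (fun n : ℕ => Matrix.mulVec (A ^ n) w) atTop (𝓝 0) := by
  obtain ⟨C, hC⟩ := h w hw
  refine squeeze_zero_norm hC ?_
  simpa using (tendsto_pow_atTop_nhds_zero_of_lt_one hp.le hp1).const_mul C

theorem pow_mulVec_of_eigen {A : Matrix (Fin r) (Fin r) ℂ} {z : ℂ} {w : Fin r → ℂ}
    (h : Matrix.mulVec A w = z • w) (n : ℕ) : Matrix.mulVec (A ^ n) w = z ^ n • w := by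
  induction n with
  | zero => simp
  | succ n ih =>
    rw [pow_succ', ← Matrix.mulVec_mulVec, ih, Matrix.mulVec_smul, h, smul_smul, pow_succ]

theorem KerDecay.norm_le {A : Matrix (Fin r) (Fin r) ℂ} {x : Fin r → ℂ} {p : ℝ}
    (h : KerDecay A x p) (hp : 0 < p) {z : ℂ} {w : Fin r → ℂ} (hw0 : w ≠ 0) (hw : x ⬝ᵥ w = 0)
    (hz : Matrix.mulVec A w = z • w) : ‖z‖ ≤ p := by
  by_contra! hlt
  obtain ⟨C, hC⟩ := h w hw
  have h1 : Tendsto (fun n : ℕ => C * (p / ‖z‖) ^ n) atTop (𝓝 0) := by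
    have h2 : p / ‖z‖ < 1 := (div_lt_one (hp.trans hlt)).2 hlt
    simpa using (tendsto_pow_atTop_nhds_zero_of_lt_one (by positivity) h2).const_mul C
  have h3 : ∀ n, ‖w‖ ≤ C * (p / ‖z‖) ^ n := by
    intro n
    have h4 := hC n
    rw [pow_mulVec_of_eigen hz, norm_smul, norm_pow] at h4
    have h5 : 0 < ‖z‖ ^ n := pow_pos (hp.trans hlt) n
    rw [div_pow, ← mul_div_assoc, le_div_iff₀ h5]
    linarith
  exact hw0 (norm_le_zero_iff.1 (ge_of_tendsto' h1 h3))

theorem exists_mulVec_eq_smul_of_isRoot {A : Matrix (Fin r) (Fin r) ℂ} {z : ℂ}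
    (h : A.charpoly.IsRoot z) : ∃ w, w ≠ 0 ∧ Matrix.mulVec A w = z • w := by
  rw [Polynomial.IsRoot, Matrix.eval_charpoly] at h
  obtain ⟨w, hw, hw'⟩ := Matrix.exists_mulVec_eq_zero_iff.2 h
  refine ⟨w, hw, ?_⟩
  rw [Matrix.sub_mulVec, sub_eq_zero] at hw'
  rw [← hw']
  simp

theorem exists_vecMul_eq_of_isRoot {A : Matrix (Fin r) (Fin r) ℂ}
    (h : A.charpoly.IsRoot 1) : ∃ w, w ≠ 0 ∧ Matrix.vecMul w A = w := by
  rw [Polynomial.IsRoot, Matrix.eval_charpoly] at h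
  obtain ⟨w, hw, hw'⟩ := Matrix.exists_vecMul_eq_zero_iff.2 h
  refine ⟨w, hw, ?_⟩
  rw [Matrix.vecMul_sub, sub_eq_zero] at hw'
  rw [← hw']
  simp

theorem KerDecay.spectralCondition {a : ℤ →₀ Matrix (Fin r) (Fin r) ℂ} {x : Fin r → ℂ} {p : ℝ}
    {m : ℕ} (h : KerDecay (symbol a 0) x p) (hp : 0 < p) (hpm : p < ((2 : ℝ) ^ m)⁻¹)
    (hx : Matrix.vecMul x (symbol a 0) = x) (ha : (symbol a 0).charpoly.IsRoot 1) :
    SpectralCondition a m := by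
  set A := symbol a 0 with hA
  have hp1 : p < 1 := hpm.trans_le (inv_le_one_of_one_le₀ (one_le_pow₀ (by norm_num)))
  constructor
  · refine le_antisymm ?_ ((Polynomial.rootMultiplicity_pos (Matrix.charpoly_monic A).ne_zero).2 ha)
    rw [← Matrix.charpoly_toLin', ← LinearMap.finrank_maxGenEigenspace_eq]
    -- the row `x` is injective on the generalized eigenspace
    set G := Module.End.maxGenEigenspace (Matrix.toLin' A) 1 with hG
    let f : (Fin r → ℂ) →ₗ[ℂ] ℂ := dotProductBilin ℂ ℂ x
    have hf : ∀ w, f w = x ⬝ᵥ w := fun w => rfl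
    have hinj : Function.Injective (f.domRestrict G) := by
      rw [← LinearMap.ker_eq_bot, LinearMap.ker_eq_bot']
      rintro ⟨w, hw⟩ hw0
      rw [LinearMap.domRestrict_apply] at hw0
      rw [Subtype.ext_iff]
      simp only [ZeroMemClass.coe_zero] at hw0 ⊢
      obtain ⟨k, hk⟩ := Module.End.mem_maxGenEigenspace _ _ _ |>.1 hw
      have hN : ∀ w, f w = 0 → (Matrix.toLin' A - (1 : ℂ) • (1 : Module.End ℂ (Fin r → ℂ))) w = 0 →
          w = 0 := by
        intro w hw1 hw2
        by_contra hne
        have h3 : Matrix.mulVec A w = (1 : ℂ) • w := by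
          simpa [sub_eq_zero] using hw2
        have := h.norm_le hp hne (by rw [← hf, hw1]) h3
        simp at this
        linarith
      have hf' : ∀ w, f ((Matrix.toLin' A - (1 : ℂ) • (1 : Module.End ℂ (Fin r → ℂ))) w) = 0 := by
        intro w
        simp [hf, dotProduct_sub, Matrix.dotProduct_mulVec, hx]
      induction k with
      | zero => simpa using hk
      | succ k ih =>
        apply ih
        cases k with
        | zero =>
          rw [pow_one] at hk
          simpa using hN w hw0 hk
        | succ k =>
          refine hN _ ?_ ?_
          · rw [pow_succ', Module.End.mul_apply]
            exact hf' _
          · rwa [pow_succ', Module.End.mul_apply] at hk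
    have := LinearMap.finrank_le_finrank_of_injective hinj
    simpa using this
  · intro z hz hz1
    obtain ⟨w, hw0, hw⟩ := exists_mulVec_eq_smul_of_isRoot hz
    refine lt_of_le_of_lt (h.norm_le hp hw0 ?_ hw) hpm
    have h1 : x ⬝ᵥ w = z * (x ⬝ᵥ w) := by
      conv_lhs => rw [← hx, ← Matrix.dotProduct_mulVec, hw, dotProduct_smul, smul_eq_mul]
    have h2 : (z - 1) * (x ⬝ᵥ w) = 0 := by linear_combination -h1
    exact (mul_eq_zero.1 h2).resolve_left (sub_ne_zero.2 hz1)

theorem SpectralCondition.det_ne_zero {a : ℤ →₀ Matrix (Fin r) (Fin r) ℂ} {m : ℕ}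
    (h : SpectralCondition a m) {n : ℕ} (hn : 0 < n) (hnm : n ≤ m) :
    ((2 : ℂ) ^ n • symbol a 0 - 1).det ≠ 0 := by
  intro hdet
  have h2 : (2 : ℂ) ^ n ≠ 0 := pow_ne_zero _ two_ne_zero
  obtain ⟨w, hw, hw'⟩ := Matrix.exists_mulVec_eq_zero_iff.2 hdet
  have h3 : (symbol a 0).charpoly.IsRoot ((2 : ℂ) ^ n)⁻¹ := by
    rw [Polynomial.IsRoot, Matrix.eval_charpoly]
    refine Matrix.exists_mulVec_eq_zero_iff.1 ⟨w, hw, ?_⟩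
    rw [Matrix.sub_mulVec, Matrix.one_mulVec, Matrix.smul_mulVec, sub_eq_zero] at hw'
    rw [Matrix.sub_mulVec, sub_eq_zero]
    have : Matrix.mulVec (Matrix.scalar (Fin r) ((2 : ℂ) ^ n)⁻¹) w = ((2 : ℂ) ^ n)⁻¹ • w := by
      simp
    rw [this]
    conv_lhs => rw [← hw', smul_smul, inv_mul_cancel₀ h2, one_smul]
  have h4 := h.2 _ h3 (by
    intro h1
    have := congrArg norm h1
    rw [norm_inv, norm_pow, Complex.norm_ofNat, norm_one, inv_eq_one] at this
    exact (one_lt_pow₀ (by norm_num : (1 : ℝ) < 2) hn.ne').ne' this)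
  rw [norm_inv, norm_pow, Complex.norm_ofNat] at h4
  have h5 : ((2 : ℝ) ^ m)⁻¹ ≤ (2 ^ n)⁻¹ := by
    gcongr
    norm_num
  linarith

theorem exists_eq_smul_of_ker_le {x y : Fin r → ℂ} (hx : x ≠ 0)
    (h : ∀ w, x ⬝ᵥ w = 0 → y ⬝ᵥ w = 0) : ∃ t : ℂ, y = t • x := by
  obtain ⟨z, hz⟩ := exists_dotProduct_eq_one hx
  refine ⟨y ⬝ᵥ z, dotProduct_eq _ _ fun w => ?_⟩
  have h1 := h (w - (x ⬝ᵥ w) • z) (by simp [dotProduct_sub, hz])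
  rw [dotProduct_sub, dotProduct_smul, sub_eq_zero, smul_eq_mul] at h1
  rw [h1, smul_dotProduct, smul_eq_mul, mul_comm]

theorem vecMul_pow_of_vecMul_eq {A : Matrix (Fin r) (Fin r) ℂ} {x : Fin r → ℂ}
    (hx : Matrix.vecMul x A = x) (n : ℕ) : Matrix.vecMul x (A ^ n) = x := by
  induction n with
  | zero => simp
  | succ n ih => rw [pow_succ, ← Matrix.vecMul_vecMul, ih, hx]

theorem KerDecay.exists_eq_smul {A : Matrix (Fin r) (Fin r) ℂ} {x y : Fin r → ℂ} {p : ℝ}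
    (h : KerDecay A x p) (hp : 0 < p) (hp1 : p < 1) (hx : x ≠ 0) (hy : Matrix.vecMul y A = y) :
    ∃ t : ℂ, y = t • x := by
  refine exists_eq_smul_of_ker_le hx fun w hw => ?_
  have h1 : ∀ n : ℕ, y ⬝ᵥ Matrix.mulVec (A ^ n) w = y ⬝ᵥ w := fun n => by
    rw [Matrix.dotProduct_mulVec, vecMul_pow_of_vecMul_eq hy]
  have hcont : Continuous fun w : Fin r → ℂ => y ⬝ᵥ w := by
    unfold dotProduct
    fun_prop
  have h2 := (hcont.tendsto 0).comp (h.tendsto hp hp1 hw)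
  simp only [Function.comp_def, h1, dotProduct_zero] at h2
  exact tendsto_nhds_unique tendsto_const_nhds h2

theorem IsMatchingFilter.vecMul_zero {a : ℤ →₀ Matrix (Fin r) (Fin r) ℂ} {v : ℤ →₀ (Fin r → ℂ)}
    {n : ℕ} (hv : IsMatchingFilter a v n) (hn : n ≠ 0) :
    Matrix.vecMul (symbol v 0) (symbol a 0) = symbol v 0 := by
  simpa using hv.2 0 (Nat.pos_of_ne_zero hn)

theorem IsMatchingFilter.mono {a : ℤ →₀ Matrix (Fin r) (Fin r) ℂ} {v : ℤ →₀ (Fin r → ℂ)}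
    {n n' : ℕ} (hv : IsMatchingFilter a v n) (hn : n' ≤ n) : IsMatchingFilter a v n' :=
  ⟨hv.1, fun j hj => hv.2 j (hj.trans_le hn)⟩

theorem HasSumRules.mono {a : ℤ →₀ Matrix (Fin r) (Fin r) ℂ} {v : ℤ →₀ (Fin r → ℂ)}
    {n n' : ℕ} (hv : HasSumRules a v n) (hn : n' ≤ n) : HasSumRules a v n' :=
  ⟨hv.1.mono hn, fun j hj => hv.2 j (hj.trans_le hn)⟩

theorem kerDecay_of_decays {a : ℤ →₀ Matrix (Fin r) (Fin r) ℂ} {v : ℤ →₀ (Fin r → ℂ)}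
    (hv0 : symbol v 0 ≠ 0) {M : ℕ} {p : ℝ}
    (h : ∀ u, (pairing v u =O[𝓝 0] fun ξ : ℝ => ξ ^ M) → Decays a u p) :
    KerDecay (symbol a 0) (symbol v 0) p := by
  intro w hw
  obtain ⟨u, hu, rfl⟩ := exists_pairing_isBigO hv0 hw M
  exact (h u (hu.trans (isBigO_pow_pow_nhds_zero M.le_succ))).norm_pow_mulVec_le

theorem isBigO_pairing_of_sub {y v u : ℤ →₀ (Fin r → ℂ)} {t : ℂ} {M l : ℕ} (hl : l ≤ M)
    (h : (fun ξ => symbol y ξ - t • symbol v ξ) =O[𝓝 0] fun ξ : ℝ => ξ ^ M)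
    (hu : pairing v u =O[𝓝 0] fun ξ : ℝ => ξ ^ l) :
    pairing y u =O[𝓝 0] fun ξ : ℝ => ξ ^ l := by
  have h1 := (isBigO_dotProduct_left h (continuous_symbol u).continuousAt).trans
    (isBigO_pow_pow_nhds_zero hl)
  refine (h1.add (hu.const_mul_left t)).congr_left fun ξ => ?_
  rw [sub_dotProduct, smul_dotProduct, smul_eq_mul, pairing, pairing]
  ring

/-- If the data with vanishing pairing of order `n₀` decay faster than `2 ^ (-m n)`, then `n₀`
exceeds `m`, and the spectral condition holds. -/
theorem spectralCondition_and_lt {a : ℤ →₀ Matrix (Fin r) (Fin r) ℂ} {v : ℤ →₀ (Fin r → ℂ)}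
    {n₀ m : ℕ} (ha : (symbol a 0).charpoly.IsRoot 1) (hv : IsMatchingFilter a v n₀) {p : ℝ}
    (hp : 0 < p) (hpm : p < ((2 : ℝ) ^ m)⁻¹)
    (h : ∀ u, (pairing v u =O[𝓝 0] fun ξ : ℝ => ξ ^ n₀) → Decays a u p) :
    SpectralCondition a m ∧ m < n₀ := by
  have key : ∀ y, IsMatchingFilter a y (n₀ + 1) →
      ((fun ξ => symbol v ξ - (1 : ℂ) • symbol y ξ) =O[𝓝 0] fun ξ : ℝ => ξ ^ n₀) → m < n₀ := by
    intro y hy hvy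
    by_contra! hle
    obtain ⟨u₀, hu₀⟩ := exists_pairing_eq_one hy.1 0
    have h1 := pairing_iterate_fwd_leading hu₀ n₀
    have h2 := isBigO_pairing_of_sub le_rfl hvy (isBigO_of_leading n₀.le_succ h1)
    have h3 := hy.le_of_decays h1 hp (h _ h2)
    have h4 : ((2 : ℝ) ^ m)⁻¹ ≤ (2 ^ n₀)⁻¹ := by
      gcongr
      norm_num
    linarith
  rcases Nat.eq_zero_or_pos n₀ with rfl | hpos
  · exfalso
    obtain ⟨w, hw0, hw⟩ := exists_vecMul_eq_of_isRoot ha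
    have hs : symbol (Finsupp.single (0 : ℤ) w) = fun _ => w := by
      funext ξ
      simp [symbol_single]
    -- a left eigenvector of `â(0)` is a matching filter of order one
    refine Nat.not_lt_zero m (key (Finsupp.single 0 w) ⟨by rwa [hs], ?_⟩ ?_)
    · intro j hj
      obtain rfl : j = 0 := by omega
      simpa [hs] using hw
    · rw [hs]
      have hc : ContinuousAt (fun ξ => symbol v ξ - (1 : ℂ) • w) 0 :=
        ((continuous_symbol v).sub continuous_const).continuousAt
      simpa using hc.norm.isBoundedUnder_le.isBigO_one ℝ
  · have hsp := (kerDecay_of_decays hv.1 h).spectralCondition hp hpm (hv.vecMul_zero hpos.ne') ha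
    refine ⟨hsp, ?_⟩
    by_contra! hle
    obtain ⟨y, hy, hvy⟩ := hv.exists_succ hpos.ne' (hsp.det_ne_zero hpos hle)
    refine absurd (key y hy (hvy.neg_left.congr_left fun ξ => ?_)) (by omega)
    simp

/-- A mask with sum rules has sum rules with each of its matching filters. -/
theorem IsMatchingFilter.hasSumRules {a : ℤ →₀ Matrix (Fin r) (Fin r) ℂ}
    {v y : ℤ →₀ (Fin r → ℂ)} {M : ℕ} {t : ℂ} (hv : HasSumRules a v M)
    (hy : IsMatchingFilter a y M)
    (h : (fun ξ => symbol y ξ - t • symbol v ξ) =O[𝓝 0] fun ξ : ℝ => ξ ^ M) :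
    HasSumRules a y M := by
  rw [hasSumRules_iff] at hv ⊢
  refine ⟨hy, ?_⟩
  have h1 := isBigO_vecMul_symbol a (isBigO_pow_comp_mul h 2) Real.pi
  refine (h1.add (hv.2.const_smul_left t)).congr_left fun ξ => ?_
  rw [Matrix.sub_vecMul, Matrix.smul_vecMul, Pi.smul_apply]
  abel

end Spectral

/-! ### Limits of the scaled subdivision data -/

section Limit

variable {r : ℕ}

/-- The mask `a` has order `m + 1` sum rules with the matching filter `y`, and the data
`S_a ^ n (δ I_r) * u` decay at each rate above `max ρ (2 ^ (-l))` as soon as the pairing of `y` with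
`u` vanishes to the order `l`, where `ρ < 2 ^ (-m)`. -/
structure SmoothScheme (a : ℤ →₀ Matrix (Fin r) (Fin r) ℂ) (y : ℤ →₀ (Fin r → ℂ)) (m : ℕ)
    (ρ : ℝ) : Prop where
  sumRules : HasSumRules a y (m + 1)
  pos : 0 < ρ
  lt : ρ < ((2 : ℝ) ^ m)⁻¹
  decays : ∀ l ≤ m + 1, ∀ u, (pairing y u =O[𝓝 0] fun ξ : ℝ => ξ ^ l) →
    ∀ p, ρ < p → ((2 : ℝ) ^ l)⁻¹ < p → Decays a u p

/-- The step function `x ↦ 2 ^ (j n) (S_a ^ n (δ I_r) * u)(⌊2 ^ n x⌋)`. -/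
noncomputable def stepFn (a : ℤ →₀ Matrix (Fin r) (Fin r) ℂ) (u : ℤ →₀ (Fin r → ℂ)) (j n : ℕ)
    (x : ℝ) : Fin r → ℂ :=
  (2 : ℂ) ^ (j * n) • subdivData a u n ⌊(2 : ℝ) ^ n * x⌋

/-- The limit of the step functions `stepFn a u j n` as `n → ∞`. -/
noncomputable def limitFn (a : ℤ →₀ Matrix (Fin r) (Fin r) ℂ) (u : ℤ →₀ (Fin r → ℂ)) (j : ℕ)
    (x : ℝ) : Fin r → ℂ :=
  limUnder atTop fun n => stepFn a u j n x

variable {a : ℤ →₀ Matrix (Fin r) (Fin r) ℂ} {y u : ℤ →₀ (Fin r → ℂ)} {m : ℕ} {ρ : ℝ}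

theorem SmoothScheme.exists_rate (h : SmoothScheme a y m ρ) {j : ℕ} (hj : j ≤ m) :
    ∃ p, 0 < p ∧ ρ < p ∧ ((2 : ℝ) ^ (j + 1))⁻¹ < p ∧ 2 ^ j * p < 1 := by
  have h1 : max ρ ((2 : ℝ) ^ (j + 1))⁻¹ < ((2 : ℝ) ^ j)⁻¹ := by
    refine max_lt (h.lt.trans_le ?_) ?_
    · gcongr
      norm_num
    · gcongr
      · norm_num
      · omega
  obtain ⟨p, hp1, hp2⟩ := exists_between h1
  have h2 := (le_max_left _ _).trans_lt hp1
  refine ⟨p, h.pos.trans h2, h2, (le_max_right _ _).trans_lt hp1, ?_⟩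
  have h2j : (0 : ℝ) < 2 ^ j := by positivity
  calc 2 ^ j * p < 2 ^ j * (2 ^ j)⁻¹ := by gcongr
    _ = 1 := mul_inv_cancel₀ h2j.ne'

theorem floor_two_mul (t : ℝ) : ∃ γ : ℤ, (γ = 0 ∨ γ = 1) ∧ ⌊2 * t⌋ = 2 * ⌊t⌋ + γ := by
  refine ⟨⌊2 * t⌋ - 2 * ⌊t⌋, ?_, by ring⟩
  have h1 : 2 * ⌊t⌋ ≤ ⌊2 * t⌋ := Int.le_floor.2 (by push_cast; linarith [Int.floor_le t])
  have h2 : ⌊2 * t⌋ < 2 * ⌊t⌋ + 2 :=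
    Int.floor_lt.2 (by push_cast; linarith [Int.lt_floor_add_one t])
  omega

theorem scaled_succ_sub (a : ℤ →₀ Matrix (Fin r) (Fin r) ℂ) (u : ℤ →₀ (Fin r → ℂ)) (j n : ℕ)
    (γ k : ℤ) : (2 : ℂ) ^ (j * (n + 1)) • subdivData a u (n + 1) (2 * k + γ) -
      (2 : ℂ) ^ (j * n) • subdivData a u n k =
        (2 : ℂ) ^ (j * n) • subdivData a ((2 : ℂ) ^ j • coset a u γ - u) n k := by
  rw [mul_add, mul_one, pow_add, mul_smul, subdivData_succ_eq, smul_add, add_sub_cancel_left]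

theorem norm_two_pow_smul (j n : ℕ) (x : Fin r → ℂ) :
    ‖(2 : ℂ) ^ (j * n) • x‖ = (2 ^ j) ^ n * ‖x‖ := by
  rw [norm_smul, norm_pow, Complex.norm_ofNat, pow_mul]

theorem Decays.exists_scaled {p : ℝ} (h : Decays a u p) (j : ℕ) :
    ∃ C : ℝ, 0 ≤ C ∧ ∀ (n : ℕ) (k : ℤ),
      ‖(2 : ℂ) ^ (j * n) • subdivData a u n k‖ ≤ C * (2 ^ j * p) ^ n := by
  obtain ⟨C, hC⟩ := h
  refine ⟨C, by simpa using (norm_nonneg _).trans (hC 0 0), fun n k => ?_⟩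
  rw [norm_two_pow_smul, mul_pow, mul_left_comm]
  gcongr
  exact hC n k

theorem SmoothScheme.stepFn_succ_sub (h : SmoothScheme a y m ρ) {j : ℕ} (hj : j ≤ m)
    (hu : pairing y u =O[𝓝 0] fun ξ : ℝ => ξ ^ j) :
    ∃ C q : ℝ, 0 ≤ C ∧ 0 < q ∧ q < 1 ∧
      ∀ n x, dist (stepFn a u j n x) (stepFn a u j (n + 1) x) ≤ C * q ^ n := by
  obtain ⟨p, hp0, hp1, hp2, hp3⟩ := h.exists_rate hj
  have hd := fun γ => h.decays (j + 1) (by omega) _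
    (pairing_coset_sub_isBigO h.sumRules (by omega) hu γ) p hp1 hp2
  obtain ⟨C₀, hC₀, h₀⟩ := (hd 0).exists_scaled j
  obtain ⟨C₁, hC₁, h₁⟩ := (hd 1).exists_scaled j
  refine ⟨max C₀ C₁, 2 ^ j * p, le_max_of_le_left hC₀, by positivity, hp3, fun n x => ?_⟩
  obtain ⟨γ, hγ, hfl⟩ := floor_two_mul ((2 : ℝ) ^ n * x)
  rw [dist_eq_norm', stepFn, stepFn, pow_succ', mul_assoc, hfl, scaled_succ_sub]
  rcases hγ with rfl | rfl
  · exact (h₀ n _).trans (by gcongr; exact le_max_left _ _)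
  · exact (h₁ n _).trans (by gcongr; exact le_max_right _ _)

theorem SmoothScheme.tendsto_stepFn (h : SmoothScheme a y m ρ) {j : ℕ} (hj : j ≤ m)
    (hu : pairing y u =O[𝓝 0] fun ξ : ℝ => ξ ^ j) (x : ℝ) :
    Tendsto (fun n => stepFn a u j n x) atTop (𝓝 (limitFn a u j x)) := by
  obtain ⟨C, q, -, -, hq1, hC⟩ := h.stepFn_succ_sub hj hu
  exact (cauchySeq_of_le_geometric q C hq1 fun n => hC n x).tendsto_limUnder

theorem SmoothScheme.norm_stepFn_sub_limitFn (h : SmoothScheme a y m ρ) {j : ℕ} (hj : j ≤ m)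
    (hu : pairing y u =O[𝓝 0] fun ξ : ℝ => ξ ^ j) :
    ∃ C q : ℝ, 0 ≤ C ∧ 0 < q ∧ q < 1 ∧
      ∀ n x, ‖stepFn a u j n x - limitFn a u j x‖ ≤ C * q ^ n := by
  obtain ⟨C, q, hC0, hq0, hq1, hC⟩ := h.stepFn_succ_sub hj hu
  have : 0 < 1 - q := by linarith
  refine ⟨C / (1 - q), q, by positivity, hq0, hq1, fun n x => ?_⟩
  rw [← dist_eq_norm, div_mul_eq_mul_div]
  exact dist_le_of_le_geometric_of_tendsto q C hq1 (fun n => hC n x) (h.tendsto_stepFn hj hu x) n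

theorem SmoothScheme.limitFn_eq_zero (h : SmoothScheme a y m ρ) {j : ℕ} (hj : j ≤ m)
    (hu : pairing y u =O[𝓝 0] fun ξ : ℝ => ξ ^ (j + 1)) (x : ℝ) : limitFn a u j x = 0 := by
  obtain ⟨p, hp0, hp1, hp2, hp3⟩ := h.exists_rate hj
  obtain ⟨C, hC, hb⟩ := (h.decays (j + 1) (by omega) _ hu p hp1 hp2).exists_scaled j
  refine Tendsto.limUnder_eq (squeeze_zero_norm (fun n => hb n _) ?_)
  simpa using (tendsto_pow_atTop_nhds_zero_of_lt_one (by positivity) hp3).const_mul C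

theorem stepFn_sub_smul (u w : ℤ →₀ (Fin r → ℂ)) (c : ℂ) (j n : ℕ) (x : ℝ) :
    stepFn a (u - c • w) j n x = stepFn a u j n x - c • stepFn a w j n x := by
  rw [stepFn, subdivData_sub, subdivData_smul, smul_sub, smul_comm, stepFn, stepFn]

/-- The limit depends on `u` only through the leading coefficient of its pairing with `y`. -/
theorem SmoothScheme.limitFn_eq_smul (h : SmoothScheme a y m ρ) {j : ℕ} (hj : j ≤ m)
    {w : ℤ →₀ (Fin r → ℂ)} {β : ℂ}
    (hu : (fun ξ => pairing y u ξ - β * (Complex.I * (ξ : ℂ)) ^ j) =O[𝓝 0]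
      fun ξ : ℝ => ξ ^ (j + 1))
    (hw : (fun ξ => pairing y w ξ - 1 * (Complex.I * (ξ : ℂ)) ^ j) =O[𝓝 0]
      fun ξ : ℝ => ξ ^ (j + 1)) (x : ℝ) : limitFn a u j x = β • limitFn a w j x := by
  have h1 : pairing y (u - β • w) =O[𝓝 0] fun ξ : ℝ => ξ ^ (j + 1) := by
    refine (hu.sub (hw.const_mul_left β)).congr_left fun ξ => ?_
    rw [pairing_sub, pairing_smul]
    ring
  have hu' := isBigO_of_leading j.le_succ hu
  have hw' := isBigO_of_leading j.le_succ hw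
  have h2 := h.tendsto_stepFn hj (h1.trans (isBigO_pow_pow_nhds_zero j.le_succ)) x
  have h3 := (h.tendsto_stepFn hj hu' x).sub ((h.tendsto_stepFn hj hw' x).const_smul β)
  simp only [← stepFn_sub_smul] at h3
  rw [← sub_eq_zero, tendsto_nhds_unique h3 h2, h.limitFn_eq_zero hj h1]

theorem exists_pow_mul_lt {C q ε : ℝ} (hq0 : 0 < q) (hq1 : q < 1) (hε : 0 < ε) :
    ∀ᶠ n : ℕ in atTop, C * q ^ n < ε := by
  have h := (tendsto_pow_atTop_nhds_zero_of_lt_one hq0.le hq1).const_mul C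
  rw [mul_zero] at h
  exact h.eventually_lt_const hε

theorem SmoothScheme.continuous_limitFn (h : SmoothScheme a y m ρ) {j : ℕ} (hj : j ≤ m)
    (hu : pairing y u =O[𝓝 0] fun ξ : ℝ => ξ ^ j) : Continuous (limitFn a u j) := by
  obtain ⟨C, q, hC0, hq0, hq1, hC⟩ := h.norm_stepFn_sub_limitFn hj hu
  obtain ⟨p, hp0, hp1, hp2, hp3⟩ := h.exists_rate hj
  obtain ⟨C', hC', hb⟩ :=
    (h.decays (j + 1) (by omega) _ (pairing_fwd_isBigO hu) p hp1 hp2).exists_scaled j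
  -- at the scale `2 ^ (-n)` the step function takes at most two neighbouring values, whose
  -- difference belongs to the forward difference of `u`
  have key : ∀ (n : ℕ) (x z : ℝ), x ≤ z → z < x + (2 ^ n)⁻¹ →
      ‖limitFn a u j z - limitFn a u j x‖ ≤ 2 * C * q ^ n + C' * (2 ^ j * p) ^ n := by
    intro n x z hxz hzx
    have h2n : (0 : ℝ) < 2 ^ n := by positivity
    have h1 : (2 : ℝ) ^ n * z < 2 ^ n * x + 1 := by
      calc (2 : ℝ) ^ n * z < 2 ^ n * (x + (2 ^ n)⁻¹) := by gcongr
        _ = _ := by rw [mul_add, mul_inv_cancel₀ h2n.ne']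
    have h2 : ⌊(2 : ℝ) ^ n * x⌋ ≤ ⌊(2 : ℝ) ^ n * z⌋ := Int.floor_mono (by gcongr)
    have h3 : ⌊(2 : ℝ) ^ n * z⌋ ≤ ⌊(2 : ℝ) ^ n * x⌋ + 1 := by
      rw [← Int.floor_add_one]
      exact Int.floor_mono h1.le
    have h4 : ‖stepFn a u j n z - stepFn a u j n x‖ ≤ C' * (2 ^ j * p) ^ n := by
      rcases h2.eq_or_lt with he | hlt
      · rw [stepFn, stepFn, he, sub_self, norm_zero]
        positivity
      · have he : ⌊(2 : ℝ) ^ n * z⌋ = ⌊(2 : ℝ) ^ n * x⌋ + 1 := by omega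
        rw [stepFn, stepFn, he, ← smul_sub, ← subdivData_fwd]
        exact hb n _
    have h5 := hC n x
    have h6 := hC n z
    rw [norm_sub_rev] at h6
    have h7 : limitFn a u j z - limitFn a u j x = (limitFn a u j z - stepFn a u j n z) +
        (stepFn a u j n z - stepFn a u j n x) + (stepFn a u j n x - limitFn a u j x) := by abel
    rw [h7]
    refine (norm_add₃_le).trans ?_
    linarith
  refine Metric.continuous_iff.2 fun x ε hε => ?_
  obtain ⟨n, hn1, hn2⟩ := ((exists_pow_mul_lt (C := 2 * C) hq0 hq1 (half_pos hε)).and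
    (exists_pow_mul_lt (C := C') (q := 2 ^ j * p) (by positivity) hp3 (half_pos hε))).exists
  refine ⟨(2 ^ n)⁻¹, by positivity, fun z hz => ?_⟩
  rw [Real.dist_eq, abs_lt] at hz
  rcases le_total x z with hxz | hxz
  · rw [dist_eq_norm]
    refine (key n x z hxz (by linarith)).trans_lt (by linarith)
  · rw [dist_eq_norm']
    refine (key n z x hxz (by linarith)).trans_lt (by linarith)

theorem tendsto_inv_two_pow_mul_floor (x : ℝ) :
    Tendsto (fun n : ℕ => ((2 : ℝ) ^ n)⁻¹ * (⌊(2 : ℝ) ^ n * x⌋ : ℝ)) atTop (𝓝 x) := by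
  have h1 : Tendsto (fun n : ℕ => x - (2⁻¹ : ℝ) ^ n) atTop (𝓝 (x - 0)) :=
    tendsto_const_nhds.sub (tendsto_pow_atTop_nhds_zero_of_lt_one (by norm_num) (by norm_num))
  rw [sub_zero] at h1
  refine tendsto_of_tendsto_of_tendsto_of_le_of_le h1 tendsto_const_nhds (fun n => ?_)
    fun n => ?_
  · have h2n : (0 : ℝ) < 2 ^ n := by positivity
    simp only [inv_pow]
    rw [← mul_le_mul_iff_right₀ h2n, mul_sub, mul_inv_cancel₀ h2n.ne',
      mul_inv_cancel_left₀ h2n.ne']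
    linarith [Int.lt_floor_add_one ((2 : ℝ) ^ n * x)]
  · have h2n : (0 : ℝ) < 2 ^ n := by positivity
    simp only
    rw [inv_mul_le_iff₀ h2n]
    exact Int.floor_le _

/-- A mean value estimate: discrete telescoping, passed to the limit. -/
theorem SmoothScheme.norm_limitFn_sub_le (h : SmoothScheme a y m ρ) {j : ℕ} (hj : j + 1 ≤ m)
    (hu : pairing y u =O[𝓝 0] fun ξ : ℝ => ξ ^ j) {c : Fin r → ℂ} {ε b₀ b₁ b₂ : ℝ} (hb : b₁ ≤ b₂)
    (hb₀ : b₀ < b₁)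
    (hε : ∀ z, b₀ < z → z ≤ b₂ → ‖limitFn a (fwd u) (j + 1) z - c‖ ≤ ε) :
    ‖limitFn a u j b₂ - limitFn a u j b₁ - (b₂ - b₁) • c‖ ≤ (b₂ - b₁) * ε := by
  obtain ⟨C, q, hC0, hq0, hq1, hC⟩ := h.norm_stepFn_sub_limitFn hj (pairing_fwd_isBigO hu)
  let k : ℝ → ℕ → ℤ := fun x n => ⌊(2 : ℝ) ^ n * x⌋
  have hk : ∀ x, Tendsto (fun n : ℕ => ((2 : ℝ) ^ n)⁻¹ * k x n) atTop (𝓝 x) :=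
    tendsto_inv_two_pow_mul_floor
  have hdiff : Tendsto (fun n : ℕ => ((2 : ℝ) ^ n)⁻¹ * ((k b₂ n - k b₁ n : ℤ) : ℝ)) atTop
      (𝓝 (b₂ - b₁)) := by
    refine ((hk b₂).sub (hk b₁)).congr fun n => ?_
    push_cast
    ring
  have hleft : Tendsto (fun n => ‖stepFn a u j n b₂ - stepFn a u j n b₁ -
      (((2 : ℝ) ^ n)⁻¹ * ((k b₂ n - k b₁ n : ℤ) : ℝ)) • c‖) atTop
      (𝓝 ‖limitFn a u j b₂ - limitFn a u j b₁ - (b₂ - b₁) • c‖) :=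
    (((h.tendsto_stepFn (by omega) hu b₂).sub (h.tendsto_stepFn (by omega) hu b₁)).sub
      (hdiff.smul_const c)).norm
  have hright : Tendsto (fun n => (((2 : ℝ) ^ n)⁻¹ * ((k b₂ n - k b₁ n : ℤ) : ℝ)) *
      (ε + C * q ^ n)) atTop (𝓝 ((b₂ - b₁) * (ε + C * 0))) :=
    hdiff.mul (tendsto_const_nhds.add
      ((tendsto_pow_atTop_nhds_zero_of_lt_one hq0.le hq1).const_mul C))
  rw [mul_zero, add_zero] at hright
  refine le_of_tendsto_of_tendsto hleft hright ?_
  have hsmall : ∀ᶠ n : ℕ in atTop, 1 * (2⁻¹ : ℝ) ^ n < b₁ - b₀ :=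
    exists_pow_mul_lt (by norm_num) (by norm_num) (by linarith)
  filter_upwards [hsmall] with n hn
  have h2n : (0 : ℝ) < 2 ^ n := by positivity
  have hkk : k b₁ n ≤ k b₂ n := Int.floor_mono (by gcongr)
  -- the difference of the step functions is a sum of the scaled differences
  have htel : ∀ d : ℕ, stepFn a u j n ((2 ^ n)⁻¹ * ((k b₁ n + d : ℤ) : ℝ)) -
      stepFn a u j n ((2 ^ n)⁻¹ * (k b₁ n : ℝ)) = ∑ i ∈ Finset.range d, ((2 : ℝ) ^ n)⁻¹ •
        stepFn a (fwd u) (j + 1) n ((2 ^ n)⁻¹ * ((k b₁ n + i : ℤ) : ℝ)) := by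
    intro d
    induction d with
    | zero => simp
    | succ d ih =>
      rw [Finset.sum_range_succ, ← ih]
      simp only [stepFn, mul_inv_cancel_left₀ h2n.ne', Int.floor_intCast]
      rw [subdivData_fwd, add_mul, one_mul, pow_add, mul_comm _ ((2 : ℂ) ^ n), mul_smul,
        ← Complex.coe_smul (((2 : ℝ) ^ n)⁻¹), smul_smul _ ((2 : ℂ) ^ n)]
      push_cast
      rw [inv_mul_cancel₀ (pow_ne_zero _ two_ne_zero), one_smul, smul_sub, ← add_assoc]
      abel
  obtain ⟨d, hd⟩ := Int.eq_ofNat_of_zero_le (sub_nonneg.2 hkk)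
  have hd' : k b₂ n = k b₁ n + d := by omega
  have hstep : ∀ x, stepFn a u j n x = stepFn a u j n ((2 ^ n)⁻¹ * (k x n : ℝ)) := by
    intro x
    simp only [stepFn, mul_inv_cancel_left₀ h2n.ne', Int.floor_intCast, k]
  rw [hstep b₂, hstep b₁, hd', htel d, add_sub_cancel_left]
  have hc : ((2 ^ n : ℝ)⁻¹ * ((d : ℤ) : ℝ)) • c = ∑ _i ∈ Finset.range d, ((2 : ℝ) ^ n)⁻¹ • c := by
    rw [Finset.sum_const, Finset.card_range, ← Nat.cast_smul_eq_nsmul ℝ, smul_smul, mul_comm]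
    simp
  rw [hc, ← Finset.sum_sub_distrib]
  refine (norm_sum_le _ _).trans ?_
  have hterm : ∀ i ∈ Finset.range d, ‖((2 : ℝ) ^ n)⁻¹ •
      stepFn a (fwd u) (j + 1) n ((2 ^ n)⁻¹ * ((k b₁ n + i : ℤ) : ℝ)) - ((2 : ℝ) ^ n)⁻¹ • c‖ ≤
        ((2 : ℝ) ^ n)⁻¹ * (ε + C * q ^ n) := by
    intro i hi
    rw [Finset.mem_range] at hi
    rw [← smul_sub, norm_smul, norm_inv, norm_pow, Real.norm_ofNat]
    gcongr
    have hz := hε ((2 ^ n)⁻¹ * ((k b₁ n + i : ℤ) : ℝ)) ?_ ?_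
    · have hz' := hC n ((2 ^ n)⁻¹ * ((k b₁ n + i : ℤ) : ℝ))
      refine (norm_sub_le_norm_sub_add_norm_sub _ (limitFn a (fwd u) (j + 1)
        ((2 ^ n)⁻¹ * ((k b₁ n + i : ℤ) : ℝ))) _).trans ?_
      linarith
    · have h1 := Int.lt_floor_add_one ((2 : ℝ) ^ n * b₁)
      rw [one_mul, inv_pow] at hn
      rw [← mul_lt_mul_iff_right₀ h2n, mul_sub, mul_inv_cancel₀ h2n.ne'] at hn
      rw [← mul_lt_mul_iff_right₀ h2n, mul_inv_cancel_left₀ h2n.ne']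
      push_cast
      have h2 : (0 : ℝ) ≤ i := Nat.cast_nonneg i
      simp only [k]
      linarith
    · have h1 := Int.floor_le ((2 : ℝ) ^ n * b₂)
      have h2 : (k b₁ n : ℝ) + i ≤ k b₂ n := by
        rw [hd']
        push_cast
        have : (i : ℝ) ≤ d := by exact_mod_cast hi.le
        linarith
      rw [inv_mul_le_iff₀ h2n]
      push_cast
      exact h2.trans h1
  refine (Finset.sum_le_sum hterm).trans (le_of_eq ?_)
  rw [Finset.sum_const, Finset.card_range, nsmul_eq_mul]
  push_cast
  ring

theorem SmoothScheme.hasDerivAt_limitFn (h : SmoothScheme a y m ρ) {j : ℕ} (hj : j + 1 ≤ m)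
    (hu : pairing y u =O[𝓝 0] fun ξ : ℝ => ξ ^ j) (x : ℝ) :
    HasDerivAt (limitFn a u j) (limitFn a (fwd u) (j + 1) x) x := by
  rw [hasDerivAt_iff_isLittleO, isLittleO_iff]
  intro ε hε
  have hcont := h.continuous_limitFn hj (pairing_fwd_isBigO hu)
  obtain ⟨δ, hδ, hδ'⟩ := Metric.continuous_iff.1 hcont x ε hε
  filter_upwards [Metric.ball_mem_nhds x hδ] with z hz
  rw [Metric.mem_ball, Real.dist_eq, abs_lt] at hz
  have hbound : ∀ w, x - δ < w → w < x + δ → ‖limitFn a (fwd u) (j + 1) w -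
      limitFn a (fwd u) (j + 1) x‖ ≤ ε := fun w h1 h2 => by
    rw [← dist_eq_norm]
    refine (hδ' w ?_).le
    rw [Real.dist_eq, abs_lt]
    constructor <;> linarith
  rcases le_total x z with hxz | hxz
  · have h1 := h.norm_limitFn_sub_le hj hu hxz (b₀ := x - δ) (by linarith)
      fun w h1 h2 => hbound w h1 (by linarith)
    rwa [Real.norm_of_nonneg (sub_nonneg.2 hxz), mul_comm]
  · have h1 := h.norm_limitFn_sub_le hj hu hxz (b₀ := x - δ) (by linarith)
      fun w h1 h2 => hbound w h1 (by linarith)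
    rw [norm_sub_rev z x, Real.norm_of_nonneg (sub_nonneg.2 hxz), mul_comm, ← norm_neg]
    have h2 : -(limitFn a u j z - limitFn a u j x - (z - x) • limitFn a (fwd u) (j + 1) x) =
        limitFn a u j x - limitFn a u j z - (x - z) • limitFn a (fwd u) (j + 1) x := by module
    rwa [h2]

theorem pairing_iterate_fwd_isBigO {u₀ : ℤ →₀ (Fin r → ℂ)}
    (hu₀ : (fun ξ => pairing y u₀ ξ - 1) =O[𝓝 0] fun ξ : ℝ => ξ ^ 1) (j : ℕ) :
    pairing y (fwd^[j] u₀) =O[𝓝 0] fun ξ : ℝ => ξ ^ j :=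
  isBigO_of_leading j.le_succ (pairing_iterate_fwd_leading hu₀ j)

theorem contDiff_of_hasDerivAt_chain {E : Type*} [NormedAddCommGroup E] [NormedSpace ℝ E] {m : ℕ}
    {F : ℕ → ℝ → E} (hF : ∀ j < m, ∀ x, HasDerivAt (F j) (F (j + 1) x) x)
    (hc : Continuous (F m)) : ContDiff ℝ m (F 0) := by
  induction m generalizing F with
  | zero => simpa using (contDiff_zero (𝕜 := ℝ)).2 hc
  | succ m ih =>
    have hd : deriv (F 0) = F 1 := funext fun x => (hF 0 (by omega) x).deriv
    push_cast
    rw [contDiff_succ_iff_deriv]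
    refine ⟨fun x => (hF 0 (by omega) x).differentiableAt, by simp, ?_⟩
    rw [hd]
    exact ih (F := fun j => F (j + 1)) (fun j hj => hF (j + 1) (by omega)) hc

theorem iteratedDeriv_of_hasDerivAt_chain {E : Type*} [NormedAddCommGroup E] [NormedSpace ℝ E]
    {m : ℕ} {F : ℕ → ℝ → E} (hF : ∀ j < m, ∀ x, HasDerivAt (F j) (F (j + 1) x) x) {j : ℕ}
    (hj : j ≤ m) : iteratedDeriv j (F 0) = F j := by
  induction j with
  | zero => simp
  | succ j ih =>
    rw [iteratedDeriv_succ, ih (by omega)]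
    exact funext fun x => (hF j (by omega) x).deriv

theorem SmoothScheme.hasDerivAt_chain (h : SmoothScheme a y m ρ) {u₀ : ℤ →₀ (Fin r → ℂ)}
    (hu₀ : (fun ξ => pairing y u₀ ξ - 1) =O[𝓝 0] fun ξ : ℝ => ξ ^ 1) :
    ∀ j < m, ∀ x, HasDerivAt (limitFn a (fwd^[j] u₀) j)
      (limitFn a (fwd^[j + 1] u₀) (j + 1) x) x := fun j hj x => by
  rw [Function.iterate_succ_apply']
  exact h.hasDerivAt_limitFn hj (pairing_iterate_fwd_isBigO hu₀ j) x

/-- The basic limit function is `m` times continuously differentiable. -/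
theorem SmoothScheme.contDiff (h : SmoothScheme a y m ρ) {u₀ : ℤ →₀ (Fin r → ℂ)}
    (hu₀ : (fun ξ => pairing y u₀ ξ - 1) =O[𝓝 0] fun ξ : ℝ => ξ ^ 1) :
    ContDiff ℝ m (limitFn a u₀ 0) :=
  contDiff_of_hasDerivAt_chain (F := fun j => limitFn a (fwd^[j] u₀) j) (h.hasDerivAt_chain hu₀)
    (h.continuous_limitFn le_rfl (pairing_iterate_fwd_isBigO hu₀ m))

/-- The limits are multiples of the derivatives of the basic limit function. -/
theorem SmoothScheme.limitFn_eq_iteratedDeriv (h : SmoothScheme a y m ρ) {u₀ : ℤ →₀ (Fin r → ℂ)}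
    (hu₀ : (fun ξ => pairing y u₀ ξ - 1) =O[𝓝 0] fun ξ : ℝ => ξ ^ 1) {j : ℕ} (hj : j ≤ m) {β : ℂ}
    (hu : (fun ξ => pairing y u ξ - β * (Complex.I * (ξ : ℂ)) ^ j) =O[𝓝 0]
      fun ξ : ℝ => ξ ^ (j + 1)) (x : ℝ) :
    limitFn a u j x = β • iteratedDeriv j (limitFn a u₀ 0) x := by
  have h1 := iteratedDeriv_of_hasDerivAt_chain (F := fun j => limitFn a (fwd^[j] u₀) j)
    (h.hasDerivAt_chain hu₀) hj
  simp only [Function.iterate_zero, id] at h1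
  rw [h1]
  exact h.limitFn_eq_smul hj hu (pairing_iterate_fwd_leading hu₀ j) x

/-- The rate of convergence at the dyadic points, along which only the coset operator `T_0` acts. -/
theorem SmoothScheme.norm_sub_limitFn_le (h : SmoothScheme a y m ρ) {j s : ℕ} (hs : 1 ≤ s)
    (hjs : j + s ≤ m + 1) {β : ℂ}
    (hu : (fun ξ => pairing y u ξ - β * (Complex.I * (ξ : ℂ)) ^ j) =O[𝓝 0]
      fun ξ : ℝ => ξ ^ (j + s)) {p : ℝ} (hp : ρ < p) (hps : ((2 : ℝ) ^ (j + s))⁻¹ < p)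
    (hp1 : 2 ^ j * p < 1) : ∃ C : ℝ, ∀ (n : ℕ) (k : ℤ),
      ‖(2 : ℂ) ^ (j * n) • subdivData a u n k - limitFn a u j ((2 ^ n)⁻¹ * k)‖ ≤
        C * (2 ^ j * p) ^ n := by
  have hj : j ≤ m := by omega
  have hu' := isBigO_of_leading (by omega) hu
  have hp0 : 0 < p := h.pos.trans hp
  obtain ⟨C, hC0, hC⟩ := (h.decays (j + s) hjs _
    (pairing_coset_zero_sub_isBigO h.sumRules hjs hu) p hp hps).exists_scaled j
  refine ⟨C / (1 - 2 ^ j * p), fun n k => ?_⟩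
  have hfl : ∀ i : ℕ, ⌊(2 : ℝ) ^ (n + i) * ((2 ^ n)⁻¹ * k)⌋ = 2 ^ i * k := by
    intro i
    rw [pow_add, mul_comm ((2 : ℝ) ^ n), mul_assoc, mul_inv_cancel_left₀ (by positivity)]
    have : (2 : ℝ) ^ i * k = ((2 ^ i * k : ℤ) : ℝ) := by push_cast; rfl
    rw [this, Int.floor_intCast]
  have hstep : ∀ i : ℕ, stepFn a u j (n + i) ((2 ^ n)⁻¹ * k) =
      (2 : ℂ) ^ (j * (n + i)) • subdivData a u (n + i) (2 ^ i * k) := fun i => by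
    rw [stepFn, hfl]
  have h1 : Tendsto (fun i => stepFn a u j (n + i) ((2 ^ n)⁻¹ * k)) atTop
      (𝓝 (limitFn a u j ((2 ^ n)⁻¹ * k))) := by
    have := (tendsto_add_atTop_iff_nat n).2 (h.tendsto_stepFn hj hu' ((2 ^ n)⁻¹ * k))
    simpa only [add_comm _ n] using this
  have h2 : ∀ i : ℕ, dist (stepFn a u j (n + i) ((2 ^ n)⁻¹ * k))
      (stepFn a u j (n + (i + 1)) ((2 ^ n)⁻¹ * k)) ≤
        C * (2 ^ j * p) ^ n * (2 ^ j * p) ^ i := by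
    intro i
    rw [dist_eq_norm', hstep, hstep, ← add_assoc,
      show (2 : ℤ) ^ (i + 1) * k = 2 * (2 ^ i * k) + 0 by ring, scaled_succ_sub, mul_assoc,
      ← pow_add]
    exact hC _ _
  have h3 := dist_le_of_le_geometric_of_tendsto₀ _ _ hp1 h2 h1
  rw [hstep, dist_eq_norm] at h3
  simpa [div_mul_eq_mul_div] using h3

theorem stepFn_eq_zero {N : ℕ} (hN : ∀ k : ℤ, (N : ℤ) < |k| → a k = 0) {x : ℝ} (hx : N < |x|)
    (u : ℤ →₀ (Fin r → ℂ)) (j : ℕ) : ∀ᶠ n in atTop, stepFn a u j n x = 0 := by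
  obtain ⟨N', hN'⟩ := exists_support_bound u
  have h1 : Tendsto (fun n : ℕ => (2 : ℝ) ^ n * (|x| - N)) atTop atTop :=
    (tendsto_pow_atTop_atTop_of_one_lt one_lt_two).atTop_mul_const (by linarith)
  filter_upwards [h1.eventually_gt_atTop (N' + 1)] with n hn
  rw [stepFn, subdivData_eq_zero hN hN', smul_zero]
  have h2 : (2 : ℝ) ^ n * |x| - 1 ≤ |(⌊(2 : ℝ) ^ n * x⌋ : ℝ)| := by
    have h3 : |(2 : ℝ) ^ n * x| ≤ |(⌊(2 : ℝ) ^ n * x⌋ : ℝ)| + 1 := by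
      have h4 := abs_add_le (⌊(2 : ℝ) ^ n * x⌋ : ℝ) (Int.fract ((2 : ℝ) ^ n * x))
      rw [Int.floor_add_fract, abs_of_nonneg (a := Int.fract _) (Int.fract_nonneg _)] at h4
      linarith [Int.fract_lt_one ((2 : ℝ) ^ n * x)]
    rw [abs_mul, abs_of_pos (by positivity)] at h3
    linarith
  have h5 : (((2 ^ n - 1) * N + N' : ℤ) : ℝ) < ((|⌊(2 : ℝ) ^ n * x⌋| : ℤ) : ℝ) := by
    push_cast
    have : (0 : ℝ) ≤ N := Nat.cast_nonneg N
    linarith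
  exact_mod_cast h5

theorem limitFn_eq_zero_of_lt_abs {N : ℕ} (hN : ∀ k : ℤ, (N : ℤ) < |k| → a k = 0) {x : ℝ}
    (hx : N < |x|) (u : ℤ →₀ (Fin r → ℂ)) (j : ℕ) : limitFn a u j x = 0 :=
  Tendsto.limUnder_eq (tendsto_const_nhds.congr'
    ((stepFn_eq_zero hN hx u j).mono fun _ h => h.symm))

theorem hasCompactSupport_limitFn (a : ℤ →₀ Matrix (Fin r) (Fin r) ℂ) (u : ℤ →₀ (Fin r → ℂ))
    (j : ℕ) : HasCompactSupport (limitFn a u j) := by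
  obtain ⟨N, hN⟩ := exists_support_bound a
  refine HasCompactSupport.intro (isCompact_Icc (a := -(N : ℝ)) (b := N)) fun x hx => ?_
  refine limitFn_eq_zero_of_lt_abs hN ?_ u j
  by_contra! h
  exact hx (abs_le.1 h)

end Limit

/-! ### Compactly supported distributions and their Fourier transforms -/

section Distribution

/-- A linear functional on the smooth functions that is continuous in the sense of compactly
supported distributions. -/
def IsBounded (L : smoothFunctions →ₗ[ℂ] ℂ) : Prop :=
  ∃ (n : ℕ) (R C : ℝ), 0 ≤ R ∧ 0 ≤ C ∧ ∀ (ψ : smoothFunctions) (M : ℝ), 0 ≤ M →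
    (∀ k ≤ n, ∀ x : ℝ, |x| ≤ R → ‖iteratedDeriv k (ψ : ℝ → ℂ) x‖ ≤ M) → ‖L ψ‖ ≤ C * M

theorem CompactDistribution.isBounded (T : CompactDistribution) : IsBounded T.toLinearMap := by
  obtain ⟨n, R, C, h⟩ := T.bound
  refine ⟨n, max R 0, max C 0, le_max_right _ _, le_max_right _ _, fun ψ M hM hψ => ?_⟩
  refine (h ψ M fun k hk x hx => hψ k hk x (hx.trans (le_max_left _ _))).trans ?_
  gcongr
  exact le_max_left _ _

theorem IsBounded.sub {L L' : smoothFunctions →ₗ[ℂ] ℂ} (h : IsBounded L) (h' : IsBounded L') :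
    IsBounded (L - L') := by
  obtain ⟨n, R, C, hR, hC, hb⟩ := h
  obtain ⟨n', R', C', hR', hC', hb'⟩ := h'
  refine ⟨max n n', max R R', C + C', le_max_of_le_left hR, by positivity, fun ψ M hM hψ => ?_⟩
  have h1 := hb ψ M hM fun k hk x hx =>
    hψ k (hk.trans (le_max_left _ _)) x (hx.trans (le_max_left _ _))
  have h2 := hb' ψ M hM fun k hk x hx =>
    hψ k (hk.trans (le_max_right _ _)) x (hx.trans (le_max_right _ _))
  rw [LinearMap.sub_apply]
  exact (norm_sub_le _ _).trans (by linarith)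

theorem contDiff_polynomial_eval (P : Polynomial ℂ) :
    ContDiff ℝ ∞ fun x : ℝ => P.eval (x : ℂ) := by
  have h1 : ContDiff ℂ ∞ fun z : ℂ => P.eval z := by
    simpa using P.contDiff_aeval (𝕜 := ℂ) (n := ∞)
  exact (h1.restrict_scalars ℝ).comp Complex.ofRealCLM.contDiff

/-- The restriction of a complex polynomial to the real line. -/
noncomputable def polyFn (P : Polynomial ℂ) : smoothFunctions :=
  ⟨fun x => P.eval (x : ℂ), contDiff_polynomial_eval P⟩

theorem polyFn_add (P Q : Polynomial ℂ) : polyFn (P + Q) = polyFn P + polyFn Q := by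
  ext x
  change (P + Q).eval (x : ℂ) = P.eval (x : ℂ) + Q.eval (x : ℂ)
  simp

theorem polyFn_C_mul (c : ℂ) (P : Polynomial ℂ) : polyFn (Polynomial.C c * P) = c • polyFn P := by
  ext x
  change (Polynomial.C c * P).eval (x : ℂ) = c • P.eval (x : ℂ)
  simp

theorem polyFn_sum {ι : Type*} (s : Finset ι) (f : ι → Polynomial ℂ) :
    polyFn (∑ i ∈ s, f i) = ∑ i ∈ s, polyFn (f i) := by
  classical
  induction s using Finset.induction_on with
  | empty =>
    ext x
    change (0 : Polynomial ℂ).eval (x : ℂ) = 0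
    simp
  | insert i s hi ih => rw [Finset.sum_insert hi, Finset.sum_insert hi, polyFn_add, ih]

/-- The remainder of the Taylor expansion of the exponential function. -/
noncomputable def expRem (m : ℕ) (t : ℂ) : ℂ :=
  Complex.exp t - ∑ k ∈ Finset.range m, t ^ k / (k.factorial : ℂ)

/-- The truncated subtraction covers `m = 0`, where the remainder is the exponential function. -/
theorem hasDerivAt_expRem (m : ℕ) (t : ℂ) : HasDerivAt (expRem m) (expRem (m - 1) t) t := by
  cases m with
  | zero =>
    have h : expRem 0 = Complex.exp := by
      funext t
      simp [expRem]
    simpa [h] using Complex.hasDerivAt_exp t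
  | succ m =>
    unfold expRem
    refine (Complex.hasDerivAt_exp t).fun_sub ?_
    have h : ∀ k ∈ Finset.range (m + 1), HasDerivAt (fun t : ℂ => t ^ k / (k.factorial : ℂ))
        (k * t ^ (k - 1) / (k.factorial : ℂ)) t := fun k _ => (hasDerivAt_pow k t).div_const _
    refine (HasDerivAt.fun_sum h).congr_deriv ?_
    rw [Finset.sum_range_succ', Nat.add_sub_cancel]
    simp only [Nat.cast_zero, zero_mul, zero_div, add_zero, Nat.add_sub_cancel]
    refine Finset.sum_congr rfl fun k _ => ?_
    rw [Nat.factorial_succ]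
    push_cast
    have h1 : (k : ℂ) + 1 ≠ 0 := by exact_mod_cast k.succ_ne_zero
    have h2 : (k.factorial : ℂ) ≠ 0 := by exact_mod_cast k.factorial_ne_zero
    field_simp

theorem iteratedDeriv_expRem (m l : ℕ) (z : ℂ) :
    iteratedDeriv l (fun x : ℝ => expRem m (z * x)) =
      fun x : ℝ => z ^ l * expRem (m - l) (z * x) := by
  induction l with
  | zero => simp
  | succ l ih =>
    rw [iteratedDeriv_succ, ih]
    funext x
    have h1 : HasDerivAt (fun x : ℝ => z * (x : ℂ)) z x := by
      simpa using (Complex.ofRealCLM.hasDerivAt (x := x)).const_mul z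
    have h2 := ((hasDerivAt_expRem (m - l) (z * x)).comp x h1).const_mul (z ^ l)
    rw [Function.comp_def] at h2
    rw [h2.deriv, Nat.sub_sub]
    ring

theorem norm_expRem_le (m : ℕ) (t : ℂ) : ‖expRem m t‖ ≤ ‖t‖ ^ m * Real.exp ‖t‖ :=
  Complex.norm_exp_sub_sum_le_norm_mul_exp t m

/-- The Taylor polynomial of degree less than `m` of the function `x ↦ exp (-i x ξ)`. -/
noncomputable def expPoly (m : ℕ) (ξ : ℝ) : Polynomial ℂ :=
  ∑ k ∈ Finset.range m, Polynomial.C ((-(Complex.I * ξ)) ^ k / (k.factorial : ℂ)) * Polynomial.X ^ k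

theorem coe_expFunction_sub (m : ℕ) (ξ : ℝ) :
    ((expFunction ξ - polyFn (expPoly m ξ) : smoothFunctions) : ℝ → ℂ) =
      fun x : ℝ => expRem m (-(Complex.I * ξ) * x) := by
  funext x
  change Complex.exp (-(Complex.I * (x : ℂ) * (ξ : ℂ))) - (expPoly m ξ).eval (x : ℂ) = _
  rw [expRem, expPoly, Polynomial.eval_finsetSum]
  congr 1
  · congr 1
    ring
  · refine Finset.sum_congr rfl fun k _ => ?_
    simp only [Polynomial.eval_mul, Polynomial.eval_C, Polynomial.eval_pow, Polynomial.eval_X]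
    rw [mul_pow]
    ring

/-- The Taylor expansion in `ξ` of the Fourier transform, with the moments as coefficients. -/
theorem IsBounded.norm_expFunction_sub_le {L : smoothFunctions →ₗ[ℂ] ℂ} (h : IsBounded L) (m : ℕ) :
    ∃ C : ℝ, 0 ≤ C ∧ ∀ ξ : ℝ, |ξ| ≤ 1 →
      ‖L (expFunction ξ) - L (polyFn (expPoly m ξ))‖ ≤ C * |ξ| ^ m := by
  obtain ⟨n, R, C, hR, hC, hb⟩ := h
  refine ⟨C * (max 1 R ^ m * Real.exp R), by positivity, fun ξ hξ => ?_⟩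
  rw [← map_sub, mul_assoc]
  refine hb _ _ (by positivity) fun k hk x hx => ?_
  rw [coe_expFunction_sub, iteratedDeriv_expRem]
  have hz : ‖-(Complex.I * (ξ : ℂ))‖ = |ξ| := by simp
  rw [norm_mul, norm_pow, hz]
  refine (mul_le_mul_of_nonneg_left (norm_expRem_le _ _) (by positivity)).trans ?_
  rw [norm_mul, hz, Complex.norm_real, Real.norm_eq_abs, mul_pow, ← mul_assoc, ← mul_assoc,
    ← pow_add]
  have h1 : |ξ| ^ (k + (m - k)) ≤ |ξ| ^ m :=
    pow_le_pow_of_le_one (abs_nonneg _) hξ (by omega)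
  have h2 : |x| ^ (m - k) ≤ max 1 R ^ m :=
    (pow_le_pow_left₀ (abs_nonneg x) (hx.trans (le_max_right 1 R)) _).trans
      (pow_le_pow_right₀ (le_max_left 1 R) (Nat.sub_le _ _))
  have h3 : Real.exp (|ξ| * |x|) ≤ Real.exp R := by
    refine Real.exp_le_exp.2 ?_
    nlinarith [abs_nonneg x, abs_nonneg ξ]
  calc |ξ| ^ (k + (m - k)) * |x| ^ (m - k) * Real.exp (|ξ| * |x|)
      ≤ |ξ| ^ m * max 1 R ^ m * Real.exp R := by gcongr
    _ = _ := by ring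

/-- A functional that annihilates the exponentials annihilates the powers. -/
theorem IsBounded.polyFn_X_pow_eq_zero {L : smoothFunctions →ₗ[ℂ] ℂ} (h : IsBounded L)
    (h0 : ∀ ξ, L (expFunction ξ) = 0) (k : ℕ) : L (polyFn (Polynomial.X ^ k)) = 0 := by
  induction k using Nat.strong_induction_on with
  | _ k ih =>
    obtain ⟨C, hC, hb⟩ := h.norm_expFunction_sub_le (k + 1)
    have h1 : ∀ ξ : ℝ, L (polyFn (expPoly (k + 1) ξ)) =
        ξ ^ k • ((-Complex.I) ^ k / (k.factorial : ℂ) * L (polyFn (Polynomial.X ^ k))) := by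
      intro ξ
      rw [expPoly, polyFn_sum, map_sum, Finset.sum_range_succ, Finset.sum_eq_zero, zero_add,
        polyFn_C_mul, map_smul, smul_eq_mul, Complex.real_smul, ← neg_mul, mul_pow]
      · push_cast
        ring
      · intro i hi
        rw [polyFn_C_mul, map_smul, ih i (Finset.mem_range.1 hi), smul_zero]
    have h2 : (fun ξ : ℝ => ξ ^ k •
        ((-Complex.I) ^ k / (k.factorial : ℂ) * L (polyFn (Polynomial.X ^ k)))) =O[𝓝 0]
          fun ξ : ℝ => ξ ^ (k + 1) := by
      refine IsBigO.of_bound C ?_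
      filter_upwards [Metric.closedBall_mem_nhds (0 : ℝ) one_pos] with ξ hξ
      rw [mem_closedBall_zero_iff, Real.norm_eq_abs] at hξ
      have := hb ξ hξ
      rwa [h0, h1, zero_sub, norm_neg, ← abs_pow, ← Real.norm_eq_abs] at this
    have h3 := eq_zero_of_pow_smul_isBigO h2
    refine (mul_eq_zero.1 h3).resolve_left (div_ne_zero (pow_ne_zero _ ?_) ?_)
    · simp
    · exact_mod_cast k.factorial_ne_zero

theorem exists_polynomial_derivative_eq (P : Polynomial ℂ) :
    ∃ Q : Polynomial ℂ, Polynomial.derivative Q = P := by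
  induction P using Polynomial.induction_on' with
  | add P Q hP hQ =>
    obtain ⟨P', rfl⟩ := hP
    obtain ⟨Q', rfl⟩ := hQ
    exact ⟨P' + Q', by simp⟩
  | monomial n c =>
    refine ⟨Polynomial.monomial (n + 1) (c / (n + 1)), ?_⟩
    rw [Polynomial.derivative_monomial]
    congr 1
    push_cast
    field_simp [show (n : ℂ) + 1 ≠ 0 by exact_mod_cast n.succ_ne_zero]

theorem hasDerivAt_polynomial_eval (P : Polynomial ℂ) (x : ℝ) :
    HasDerivAt (fun x : ℝ => P.eval (x : ℂ)) ((Polynomial.derivative P).eval (x : ℂ)) x :=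
  (P.hasDerivAt (x : ℂ)).comp_ofReal

theorem exists_polynomial_near {f : ℝ → ℂ} (hf : Continuous f) (R : ℝ) {ε : ℝ} (hε : 0 < ε) :
    ∃ P : Polynomial ℂ, ∀ x : ℝ, |x| ≤ R → ‖f x - P.eval (x : ℂ)‖ ≤ ε := by
  obtain ⟨p, hp⟩ := exists_polynomial_near_of_continuousOn (-R) R (fun x => (f x).re)
    (by fun_prop) (ε / 2) (half_pos hε)
  obtain ⟨q, hq⟩ := exists_polynomial_near_of_continuousOn (-R) R (fun x => (f x).im)
    (by fun_prop) (ε / 2) (half_pos hε)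
  refine ⟨p.map Complex.ofRealHom + Polynomial.C Complex.I * q.map Complex.ofRealHom,
    fun x hx => ?_⟩
  have hx' : x ∈ Set.Icc (-R) R := abs_le.1 hx
  have h1 := hp x hx'
  have h2 := hq x hx'
  have he : ∀ p : Polynomial ℝ, (p.map Complex.ofRealHom).eval (x : ℂ) = ((p.eval x : ℝ) : ℂ) :=
    fun p => by
      have := Polynomial.eval_map_apply (p := p) Complex.ofRealHom x
      simpa using this
  rw [Polynomial.eval_add, Polynomial.eval_mul, Polynomial.eval_C, he, he]
  have h3 : f x - ((p.eval x : ℝ) + Complex.I * (q.eval x : ℝ)) =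
      (((f x).re - p.eval x : ℝ) : ℂ) + Complex.I * (((f x).im - q.eval x : ℝ) : ℂ) := by
    conv_lhs => rw [← Complex.re_add_im (f x)]
    push_cast
    ring
  rw [h3]
  refine (norm_add_le _ _).trans ?_
  rw [norm_mul, Complex.norm_I, one_mul, Complex.norm_real, Complex.norm_real, Real.norm_eq_abs,
    Real.norm_eq_abs, abs_sub_comm, abs_sub_comm (f x).im]
  linarith

/-- Polynomials are dense in the smooth functions, for uniform convergence of finitely many
derivatives on a compact interval. -/
theorem exists_polynomial_near_iteratedDeriv {f : ℝ → ℂ} (hf : ContDiff ℝ ∞ f) {R : ℝ} (hR : 0 ≤ R)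
    (n : ℕ) {ε : ℝ} (hε : 0 < ε) : ∃ P : Polynomial ℂ, ∀ k ≤ n, ∀ x : ℝ, |x| ≤ R →
      ‖iteratedDeriv k (fun x : ℝ => f x - P.eval (x : ℂ)) x‖ ≤ ε := by
  induction n generalizing f ε with
  | zero =>
    obtain ⟨P, hP⟩ := exists_polynomial_near hf.continuous R hε
    refine ⟨P, fun k hk x hx => ?_⟩
    obtain rfl : k = 0 := by omega
    simpa using hP x hx
  | succ n ih =>
    have hR1 : 0 < R + 1 := by linarith
    obtain ⟨P, hP⟩ := ih (f := deriv f) ((contDiff_infty_iff_deriv.1 hf).2)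
      (ε := ε / (R + 1)) (by positivity)
    obtain ⟨Q, hQ⟩ := exists_polynomial_derivative_eq P
    have hd : ∀ x : ℝ, HasDerivAt
        (fun x : ℝ => f x - (Q + Polynomial.C (f 0 - Q.eval 0)).eval (x : ℂ))
        (deriv f x - P.eval (x : ℂ)) x := fun x => by
      have h1 := hasDerivAt_polynomial_eval (Q + Polynomial.C (f 0 - Q.eval 0)) x
      rw [Polynomial.derivative_add, Polynomial.derivative_C, add_zero, hQ] at h1
      exact ((contDiff_infty_iff_deriv.1 hf).1 x).hasDerivAt.fun_sub h1
    refine ⟨Q + Polynomial.C (f 0 - Q.eval 0), fun k hk x hx => ?_⟩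
    cases k with
    | zero =>
      rw [iteratedDeriv_zero]
      have h0 := (convex_Icc (-R) R).norm_image_sub_le_of_norm_hasDerivWithin_le
        (f := fun x : ℝ => f x - (Q + Polynomial.C (f 0 - Q.eval 0)).eval (x : ℂ))
        (f' := fun x : ℝ => deriv f x - P.eval (x : ℂ)) (C := ε / (R + 1)) (x := 0) (y := x)
        (fun z _ => (hd z).hasDerivWithinAt)
        (fun z hz => by simpa using hP 0 (Nat.zero_le _) z (abs_le.2 hz))
        ⟨by linarith, hR⟩ (abs_le.1 hx)
      simp only [Complex.ofReal_zero, Polynomial.eval_add, Polynomial.eval_C, sub_zero,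
        Real.norm_eq_abs] at h0 ⊢
      rw [add_sub_cancel, sub_self, sub_zero] at h0
      refine h0.trans ?_
      rw [div_mul_eq_mul_div, div_le_iff₀ hR1]
      nlinarith
    | succ k =>
      rw [iteratedDeriv_succ', funext fun x => (hd x).deriv]
      refine (hP k (by omega) x hx).trans ?_
      rw [div_le_iff₀ hR1]
      nlinarith

theorem IsBounded.polyFn_eq_zero {L : smoothFunctions →ₗ[ℂ] ℂ} (h : IsBounded L)
    (h0 : ∀ ξ, L (expFunction ξ) = 0) (P : Polynomial ℂ) : L (polyFn P) = 0 := by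
  induction P using Polynomial.induction_on' with
  | add P Q hP hQ => rw [polyFn_add, map_add, hP, hQ, add_zero]
  | monomial n c =>
    rw [← Polynomial.C_mul_X_pow_eq_monomial, polyFn_C_mul, map_smul, h.polyFn_X_pow_eq_zero h0,
      smul_zero]

theorem IsBounded.eq_zero {L : smoothFunctions →ₗ[ℂ] ℂ} (h : IsBounded L)
    (h0 : ∀ ξ, L (expFunction ξ) = 0) : L = 0 := by
  have h' := h
  obtain ⟨n, R, C, hR, hC, hb⟩ := h
  refine LinearMap.ext fun ψ => ?_
  rw [LinearMap.zero_apply, ← norm_le_zero_iff]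
  refine le_of_forall_pos_le_add fun ε hε => ?_
  rw [zero_add]
  obtain ⟨P, hP⟩ := exists_polynomial_near_iteratedDeriv (f := ψ) ψ.2 hR n
    (ε := ε / (C + 1)) (by positivity)
  have h1 := hb (ψ - polyFn P) (ε / (C + 1)) (by positivity) hP
  rw [map_sub, h'.polyFn_eq_zero h0, sub_zero] at h1
  refine h1.trans ?_
  rw [mul_div_assoc', div_le_iff₀ (by positivity)]
  nlinarith

/-- A compactly supported distribution is determined by its Fourier transform. -/
theorem CompactDistribution.ext_fourier {T T' : CompactDistribution}
    (h : ∀ ξ, T.fourier ξ = T'.fourier ξ) : T = T' := by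
  have h1 := (T.isBounded.sub T'.isBounded).eq_zero fun ξ => by
    rw [LinearMap.sub_apply, sub_eq_zero]
    exact h ξ
  rw [sub_eq_zero] at h1
  cases T
  cases T'
  simp_all

theorem CompactDistribution.norm_fourier_sub_le (T : CompactDistribution) :
    ∃ C : ℝ, 0 ≤ C ∧ ∀ ξ : ℝ, |ξ| ≤ 1 → ‖T.fourier ξ - T.fourier 0‖ ≤ C * |ξ| := by
  obtain ⟨C, hC, hb⟩ := T.isBounded.norm_expFunction_sub_le 1
  refine ⟨C, hC, fun ξ hξ => ?_⟩
  have h1 : polyFn (expPoly 1 ξ) = expFunction 0 := by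
    ext x
    change (expPoly 1 ξ).eval (x : ℂ) = Complex.exp (-(Complex.I * (x : ℂ) * ((0 : ℝ) : ℂ)))
    simp [expPoly]
  have := hb ξ hξ
  rwa [h1, pow_one] at this

end Distribution

/-! ### The refinable distribution -/

section Refinable

open MeasureTheory

variable {r : ℕ}

/-- The distribution given by integration against a continuous function of compact support. -/
noncomputable def CompactDistribution.ofFunction (g : ℝ → ℂ) (hg : Continuous g)
    (hs : HasCompactSupport g) : CompactDistribution where
  toLinearMap :=
    { toFun := fun ψ => ∫ x, g x * (ψ : ℝ → ℂ) x
      map_add' := fun ψ ψ' => by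
        have h : ∀ ψ : smoothFunctions, Integrable fun x => g x * (ψ : ℝ → ℂ) x := fun ψ =>
          (hg.mul (show ContDiff ℝ ∞ (ψ : ℝ → ℂ) from
            ψ.2).continuous).integrable_of_hasCompactSupport hs.mul_right
        rw [← integral_add (h ψ) (h ψ')]
        refine integral_congr_ae (Eventually.of_forall fun x => ?_)
        exact mul_add _ _ _
      map_smul' := fun c ψ => by
        rw [RingHom.id_apply, ← integral_smul]
        refine integral_congr_ae (Eventually.of_forall fun x => ?_)
        exact mul_left_comm _ _ _ }
  bound := by
    obtain ⟨R, hR⟩ := hs.isCompact.isBounded.subset_closedBall (0 : ℝ)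
    have hint : Integrable fun x => ‖g x‖ := (hg.integrable_of_hasCompactSupport hs).norm
    refine ⟨0, R, ∫ x, ‖g x‖, fun ψ M h => ?_⟩
    refine (norm_integral_le_integral_norm _).trans ?_
    rw [← integral_mul_const]
    refine integral_mono_of_nonneg (Eventually.of_forall fun x => norm_nonneg _)
      (hint.mul_const M) (Eventually.of_forall fun x => ?_)
    simp only [norm_mul]
    by_cases hx : g x = 0
    · simp [hx]
    · have h1 := hR (subset_tsupport g hx)
      rw [mem_closedBall_zero_iff, Real.norm_eq_abs] at h1
      have h2 := h 0 le_rfl x h1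
      rw [iteratedDeriv_zero] at h2
      gcongr

theorem integral_comp_floor {S : Finset ℤ} {f : ℤ → ℂ} (hf : ∀ k ∉ S, f k = 0) :
    ∫ x : ℝ, f ⌊x⌋ = ∑ k ∈ S, f k := by
  have h1 : (fun x : ℝ => f ⌊x⌋) = fun x => ∑ k ∈ S,
      (Set.Ico (k : ℝ) (k + 1)).indicator (fun _ => f k) x := by
    funext x
    by_cases hx : ⌊x⌋ ∈ S
    · rw [Finset.sum_eq_single ⌊x⌋]
      · rw [Set.indicator_of_mem]
        exact ⟨Int.floor_le x, Int.lt_floor_add_one x⟩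
      · intro k _ hk
        refine Set.indicator_of_notMem (fun h => hk ?_) _
        exact (Int.floor_eq_iff.2 ⟨h.1, h.2⟩).symm
      · exact fun h => absurd hx h
    · rw [hf _ hx, Finset.sum_eq_zero]
      intro k hk
      refine Set.indicator_of_notMem (fun h => hx ?_) _
      rwa [Int.floor_eq_iff.2 ⟨h.1, h.2⟩]
  rw [h1, integral_finsetSum]
  · refine Finset.sum_congr rfl fun k _ => ?_
    rw [integral_indicator measurableSet_Ico, setIntegral_const]
    simp [Measure.real]
  · intro k _
    refine (integrable_indicator_iff measurableSet_Ico).2 ?_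
    exact integrableOn_const (by simp)

theorem integral_comp_floor_two_pow {S : Finset ℤ} {f : ℤ → ℂ} (hf : ∀ k ∉ S, f k = 0) (n : ℕ) :
    ∫ x : ℝ, f ⌊(2 : ℝ) ^ n * x⌋ = ((2 : ℂ) ^ n)⁻¹ * ∑ k ∈ S, f k := by
  rw [Measure.integral_comp_mul_left (fun x : ℝ => f ⌊x⌋), integral_comp_floor hf,
    abs_of_pos (by positivity), Complex.real_smul]
  push_cast
  rfl

variable {a : ℤ →₀ Matrix (Fin r) (Fin r) ℂ} {y u : ℤ →₀ (Fin r → ℂ)} {m : ℕ} {ρ : ℝ}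

theorem SmoothScheme.exists_norm_stepFn_le (h : SmoothScheme a y m ρ) (u : ℤ →₀ (Fin r → ℂ)) :
    ∃ B : ℝ, ∀ n x, ‖stepFn a u 0 n x‖ ≤ B := by
  have hu := pairing_isBigO_pow_zero y u
  obtain ⟨C, q, hC0, hq0, hq1, hC⟩ := h.norm_stepFn_sub_limitFn (Nat.zero_le m) hu
  obtain ⟨B, hB⟩ := (h.continuous_limitFn (Nat.zero_le m) hu).bounded_above_of_compact_support
    (hasCompactSupport_limitFn a u 0)
  refine ⟨C + B, fun n x => ?_⟩
  have h1 : C * q ^ n ≤ C := mul_le_of_le_one_right hC0 (pow_le_one₀ hq0.le hq1.le)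
  have h2 := norm_le_norm_sub_add (stepFn a u 0 n x) (limitFn a u 0 x)
  linarith [hC n x, hB x]

/-- The Fourier transform of the basic limit function, as a limit of Riemann sums. -/
theorem SmoothScheme.tendsto_symbol_iterSeq (h : SmoothScheme a y m ρ) (u : ℤ →₀ (Fin r → ℂ))
    (i : Fin r) (ξ : ℝ) :
    Tendsto (fun n : ℕ => ((2 : ℂ) ^ n)⁻¹ * symbol (iterSeq a u n) ((2 ^ n)⁻¹ * ξ) i) atTop
      (𝓝 (∫ x : ℝ, limitFn a u 0 x i * Complex.exp (-(Complex.I * (x : ℂ) * (ξ : ℂ))))) := by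
  have hu := pairing_isBigO_pow_zero y u
  obtain ⟨L, hL⟩ := exists_iterSeq_support_subset a u
  obtain ⟨B, hB⟩ := h.exists_norm_stepFn_le u
  let f : ℕ → ℤ → ℂ := fun n k => subdivData a u n k i *
    Complex.exp (-(Complex.I * (((2 ^ n)⁻¹ * (k : ℝ) : ℝ) : ℂ) * (ξ : ℂ)))
  have hsum : ∀ n : ℕ, ((2 : ℂ) ^ n)⁻¹ * symbol (iterSeq a u n) ((2 ^ n)⁻¹ * ξ) i =
      ∫ x : ℝ, f n ⌊(2 : ℝ) ^ n * x⌋ := by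
    intro n
    rw [integral_comp_floor_two_pow (S := (iterSeq a u n).support)]
    · congr 1
      rw [symbol, Finsupp.sum, Finset.sum_apply]
      refine Finset.sum_congr rfl fun k _ => ?_
      rw [Pi.smul_apply, smul_eq_mul, mul_comm, coe_iterSeq]
      simp only [f]
      congr 3
      push_cast
      ring
    · intro k hk
      simp only [f]
      rw [← coe_iterSeq, Finsupp.notMem_support_iff.1 hk, Pi.zero_apply, zero_mul]
  simp only [hsum]
  refine tendsto_integral_of_dominated_convergence
    ((Set.Icc (-(L + 1 : ℝ)) (L + 1)).indicator fun _ => B) ?_ ?_ ?_ ?_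
  · intro n
    exact ((measurable_of_countable (f n)).comp
      (Int.measurable_floor.comp (measurable_const_mul _))).aestronglyMeasurable
  · refine (integrable_indicator_iff measurableSet_Icc).2 ?_
    exact integrableOn_const (by simp)
  · intro n
    refine Eventually.of_forall fun x => ?_
    have hexp : ∀ t : ℝ, ‖Complex.exp (-(Complex.I * (t : ℂ) * (ξ : ℂ)))‖ = 1 := fun t => by
      have : -(Complex.I * (t : ℂ) * (ξ : ℂ)) = ((-(t * ξ) : ℝ) : ℂ) * Complex.I := by
        push_cast
        ring
      rw [this, Complex.norm_exp_ofReal_mul_I]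
    simp only [f]
    rw [norm_mul, hexp, mul_one]
    by_cases hx : x ∈ Set.Icc (-(L + 1 : ℝ)) (L + 1)
    · rw [Set.indicator_of_mem hx]
      refine (norm_le_pi_norm (subdivData a u n ⌊(2 : ℝ) ^ n * x⌋) i).trans ?_
      simpa [stepFn] using hB n x
    · rw [Set.indicator_of_notMem hx, ← coe_iterSeq, Finsupp.notMem_support_iff.1]
      · simp
      · intro hk
        apply hx
        have h1 := Finset.mem_Icc.1 (hL n hk)
        have h2n : (1 : ℝ) ≤ 2 ^ n := one_le_pow₀ (by norm_num)
        have h3 : -((2 : ℝ) ^ n * L) ≤ ⌊(2 : ℝ) ^ n * x⌋ := by exact_mod_cast h1.1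
        have h4 : (⌊(2 : ℝ) ^ n * x⌋ : ℝ) ≤ 2 ^ n * L := by exact_mod_cast h1.2
        have h5 := Int.floor_le ((2 : ℝ) ^ n * x)
        have h6 := Int.lt_floor_add_one ((2 : ℝ) ^ n * x)
        constructor
        · refine le_of_mul_le_mul_left ?_ (zero_lt_one.trans_le h2n)
          linarith
        · refine le_of_mul_le_mul_left ?_ (zero_lt_one.trans_le h2n)
          linarith
  · refine Eventually.of_forall fun x => ?_
    have h1 := h.tendsto_stepFn (Nat.zero_le m) hu x
    have h2 : Tendsto (fun n => subdivData a u n ⌊(2 : ℝ) ^ n * x⌋ i) atTop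
        (𝓝 (limitFn a u 0 x i)) := by
      have := (tendsto_pi_nhds.1 h1) i
      simpa [stepFn] using this
    have h3 : Continuous fun t : ℝ => Complex.exp (-(Complex.I * (t : ℂ) * (ξ : ℂ))) := by
      fun_prop
    exact h2.mul ((h3.tendsto x).comp (tendsto_inv_two_pow_mul_floor x))

/-- The distribution given by the limit function of the scheme. -/
noncomputable def SmoothScheme.limitDist (h : SmoothScheme a y m ρ) (u : ℤ →₀ (Fin r → ℂ))
    (i : Fin r) : CompactDistribution :=
  CompactDistribution.ofFunction (fun x => limitFn a u 0 x i)
    ((continuous_apply i).comp (h.continuous_limitFn (Nat.zero_le m) (pairing_isBigO_pow_zero y u)))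
    ((hasCompactSupport_limitFn a u 0).comp_left (g := fun v : Fin r → ℂ => v i) rfl)

theorem SmoothScheme.isGivenBy (h : SmoothScheme a y m ρ) (u : ℤ →₀ (Fin r → ℂ)) :
    IsGivenBy (h.limitDist u) (limitFn a u 0) := fun _ _ => rfl

theorem SmoothScheme.tendsto_fourier (h : SmoothScheme a y m ρ) (u : ℤ →₀ (Fin r → ℂ)) (ξ : ℝ) :
    Tendsto (fun n : ℕ => ((2 : ℂ) ^ n)⁻¹ • symbol (iterSeq a u n) ((2 ^ n)⁻¹ * ξ)) atTop
      (𝓝 fun i => (h.limitDist u i).fourier ξ) :=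
  tendsto_pi_nhds.2 fun i => h.tendsto_symbol_iterSeq u i ξ

theorem SmoothScheme.isNormalizedRefinable (h : SmoothScheme a y m ρ) {u₀ : ℤ →₀ (Fin r → ℂ)}
    (hu₀ : symbol y 0 ⬝ᵥ symbol u₀ 0 = 1) : IsNormalizedRefinable a y (h.limitDist u₀) := by
  constructor
  · intro ξ
    have h1 := (tendsto_add_atTop_iff_nat 1).2 (h.tendsto_fourier u₀ (2 * ξ))
    have hc : Continuous fun w : Fin r → ℂ => Matrix.mulVec (symbol a ξ) w := by fun_prop
    have h2 := (hc.tendsto _).comp (h.tendsto_fourier u₀ ξ)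
    refine tendsto_nhds_unique h1 (h2.congr fun n => ?_)
    have e1 : ((2 : ℝ) ^ (n + 1))⁻¹ * (2 * ξ) = (2 ^ n)⁻¹ * ξ := by
      rw [pow_succ]
      field_simp
    have e2 : (2 : ℝ) ^ n * ((2 ^ n)⁻¹ * ξ) = ξ := by
      rw [mul_inv_cancel_left₀ (by positivity)]
    have e3 : ((2 : ℂ) ^ (n + 1))⁻¹ * 2 = (2 ^ n)⁻¹ := by
      rw [pow_succ]
      field_simp
    rw [e1, symbol_iterSeq_succ, e2, smul_smul, e3, Function.comp_apply, Matrix.mulVec_smul]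
  · have hc : Continuous fun w : Fin r → ℂ => symbol y 0 ⬝ᵥ w := by
      unfold dotProduct
      fun_prop
    have h1 := (hc.tendsto _).comp (h.tendsto_fourier u₀ 0)
    refine tendsto_nhds_unique h1 (tendsto_const_nhds.congr fun n => ?_)
    have hy := vecMul_pow_of_vecMul_eq (h.sumRules.1.vecMul_zero m.succ_ne_zero) n
    rw [Function.comp_apply, mul_zero, symbol_iterSeq_zero, smul_smul,
      inv_mul_cancel₀ (pow_ne_zero _ two_ne_zero), one_smul, Matrix.dotProduct_mulVec, hy, hu₀]

theorem exists_symbol_iterSeq_eq_mulVec (a : ℤ →₀ Matrix (Fin r) (Fin r) ℂ) (n : ℕ) (ξ : ℝ) :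
    ∃ Q : Matrix (Fin r) (Fin r) ℂ, ∀ u,
      symbol (iterSeq a u n) ξ = Matrix.mulVec Q (symbol u ξ) := by
  induction n with
  | zero => exact ⟨1, fun u => by simp [iterSeq]⟩
  | succ n ih =>
    obtain ⟨Q, hQ⟩ := ih
    refine ⟨(2 : ℂ) • (symbol a (2 ^ n * ξ) * Q), fun u => ?_⟩
    rw [symbol_iterSeq_succ, hQ, Matrix.smul_mulVec, Matrix.mulVec_mulVec]

/-- The products of `n` values of the symbol grow slower than `2 ^ n`, uniformly: the left side is
`2 ^ n` times such a product applied to `w`, and the data are bounded by multiples of `(3 / 2) ^ n`,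
as for any ratio above `1`. -/
theorem SmoothScheme.norm_symbol_iterSeq_single_le (h : SmoothScheme a y m ρ) :
    ∃ C : ℝ, 0 ≤ C ∧ ∀ (n : ℕ) (ξ : ℝ) (w : Fin r → ℂ),
      ‖symbol (iterSeq a (Finsupp.single 0 w) n) ξ‖ ≤ C * ‖w‖ * 3 ^ n := by
  have hρ : ρ < 3 / 2 := by
    have : ((2 : ℝ) ^ m)⁻¹ ≤ 1 := inv_le_one_of_one_le₀ (one_le_pow₀ (by norm_num))
    linarith [h.lt]
  have hd : ∀ u, Decays a u (3 / 2) := fun u =>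
    h.decays 0 (Nat.zero_le _) u (pairing_isBigO_pow_zero y u) _ hρ (by norm_num)
  choose C hC using fun i : Fin r => (hd (Finsupp.single 0 (Pi.single i 1))).sum_norm_le
  have hC0 : ∀ i, 0 ≤ C i := fun i => by
    have h0 := (Finset.sum_nonneg fun _ _ => norm_nonneg _).trans (hC i 0)
    simpa using h0
  refine ⟨∑ i, C i, Finset.sum_nonneg fun i _ => hC0 i, fun n ξ w => ?_⟩
  obtain ⟨Q, hQ⟩ := exists_symbol_iterSeq_eq_mulVec a n ξ
  have hs : ∀ w : Fin r → ℂ, symbol (Finsupp.single (0 : ℤ) w) ξ = w := fun w => by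
    simp [symbol_single]
  have hw : w = ∑ i, w i • (Pi.single i 1 : Fin r → ℂ) := by
    conv_lhs => rw [← Finset.univ_sum_single w]
    refine Finset.sum_congr rfl fun i _ => ?_
    rw [← Pi.single_smul, smul_eq_mul, mul_one]
  have h1 : symbol (iterSeq a (Finsupp.single 0 w) n) ξ =
      ∑ i, w i • symbol (iterSeq a (Finsupp.single 0 (Pi.single i 1)) n) ξ := by
    simp only [hQ, hs]
    conv_lhs => rw [hw, Matrix.mulVec_sum]
    exact Finset.sum_congr rfl fun i _ => Matrix.mulVec_smul _ _ _
  rw [h1, Finset.sum_mul, Finset.sum_mul]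
  refine (norm_sum_le _ _).trans (Finset.sum_le_sum fun i _ => ?_)
  rw [norm_smul, mul_comm (C i), mul_assoc]
  gcongr
  · exact norm_le_pi_norm w i
  · have := (norm_symbol_le _ ξ).trans (hC i n)
    norm_num at this
    exact this

theorem eq_symbol_iterSeq_of_refinable {D : ℝ → Fin r → ℂ}
    (hD : ∀ ξ, D (2 * ξ) = Matrix.mulVec (symbol a ξ) (D ξ)) (n : ℕ) (ξ : ℝ) :
    (2 : ℂ) ^ n • D (2 ^ n * ξ) = symbol (iterSeq a (Finsupp.single 0 (D ξ)) n) ξ := by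
  induction n with
  | zero => simp [iterSeq, symbol_single]
  | succ n ih =>
    rw [symbol_iterSeq_succ, ← ih, Matrix.mulVec_smul, ← hD, smul_smul, pow_succ', pow_succ',
      mul_assoc]

/-- A solution of the refinement equation that is Lipschitz at `0` and orthogonal to `y` at `0`
vanishes. -/
theorem SmoothScheme.eq_zero_of_refinable (h : SmoothScheme a y m ρ) {D : ℝ → Fin r → ℂ}
    (hD : ∀ ξ, D (2 * ξ) = Matrix.mulVec (symbol a ξ) (D ξ)) (hD0 : symbol y 0 ⬝ᵥ D 0 = 0)
    {C : ℝ} (hC : ∀ ξ, |ξ| ≤ 1 → ‖D ξ - D 0‖ ≤ C * |ξ|) (ξ : ℝ) : D ξ = 0 := by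
  obtain ⟨p, hp0, hp1, hp2, hp3⟩ := h.exists_rate le_rfl
  have hp : p < 1 := by
    have h2 : (1 : ℝ) ≤ 2 ^ m := one_le_pow₀ (by norm_num)
    nlinarith
  have hker := kerDecay_of_decays h.sumRules.1.1 fun u hu => h.decays (m + 1) le_rfl u hu p hp1 hp2
  have h0 : D 0 = 0 := by
    have h1 : Matrix.mulVec (symbol a 0) (D 0) = (1 : ℂ) • D 0 := by
      rw [one_smul, ← hD, mul_zero]
    have h2 := hker.tendsto hp0 hp hD0
    simp only [pow_mulVec_of_eigen h1, one_pow, one_smul] at h2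
    exact tendsto_nhds_unique tendsto_const_nhds h2
  obtain ⟨B, hB0, hB⟩ := h.norm_symbol_iterSeq_single_le
  -- from `2 ^ (-n) ξ` to `ξ`, the Lipschitz bound beats the growth `(3 / 2) ^ n` of the products
  have hbound : ∀ᶠ n : ℕ in atTop, ‖D ξ‖ ≤ B * C * |ξ| * (3 / 4) ^ n := by
    have hsmall : Tendsto (fun n : ℕ => (2⁻¹ : ℝ) ^ n * |ξ|) atTop (𝓝 (0 * |ξ|)) :=
      (tendsto_pow_atTop_nhds_zero_of_lt_one (by norm_num) (by norm_num)).mul_const _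
    rw [zero_mul] at hsmall
    filter_upwards [hsmall.eventually_lt_const one_pos] with n hn
    have h2n : (0 : ℝ) < 2 ^ n := by positivity
    have e1 : |(2⁻¹ : ℝ) ^ n * ξ| = 2⁻¹ ^ n * |ξ| := by
      rw [abs_mul, abs_of_pos (by positivity)]
    have h1 := hC ((2⁻¹ : ℝ) ^ n * ξ) (by rw [e1]; exact hn.le)
    rw [h0, sub_zero, e1] at h1
    have h2 := hB n ((2⁻¹ : ℝ) ^ n * ξ) (D ((2⁻¹ : ℝ) ^ n * ξ))
    rw [← eq_symbol_iterSeq_of_refinable hD, inv_pow, mul_inv_cancel_left₀ h2n.ne', norm_smul,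
      norm_pow, Complex.norm_ofNat, ← inv_pow] at h2
    have h3 : 2 ^ n * ‖D ξ‖ ≤ B * (C * (2⁻¹ ^ n * |ξ|)) * 3 ^ n := by
      refine h2.trans ?_
      gcongr
    refine le_of_mul_le_mul_left (h3.trans (le_of_eq ?_)) h2n
    rw [show (3 / 4 : ℝ) = 2⁻¹ * 2⁻¹ * 3 by norm_num, mul_pow, mul_pow, inv_pow]
    field_simp
  have hlim : Tendsto (fun n : ℕ => B * C * |ξ| * (3 / 4 : ℝ) ^ n) atTop (𝓝 0) := by
    simpa using (tendsto_pow_atTop_nhds_zero_of_lt_one (by norm_num : (0 : ℝ) ≤ 3 / 4)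
      (by norm_num)).const_mul (B * C * |ξ|)
  exact norm_le_zero_iff.1 (ge_of_tendsto hlim hbound)

theorem SmoothScheme.eq_of_isNormalizedRefinable (h : SmoothScheme a y m ρ)
    {T T' : Fin r → CompactDistribution} (hT : IsNormalizedRefinable a y T)
    (hT' : IsNormalizedRefinable a y T') : T' = T := by
  choose C hC0 hC using fun i => (T i).norm_fourier_sub_le
  choose C' hC0' hC' using fun i => (T' i).norm_fourier_sub_le
  have key := h.eq_zero_of_refinable
    (D := fun ξ => (fun i => (T' i).fourier ξ) - fun i => (T i).fourier ξ)
    (fun ξ => by rw [hT.1, hT'.1, Matrix.mulVec_sub])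
    (by rw [dotProduct_sub, hT.2, hT'.2, sub_self])
    (C := ∑ i, (C i + C' i)) (fun ξ hξ => by
      have hS : ∀ i, C i + C' i ≤ ∑ i, (C i + C' i) := fun i =>
        Finset.single_le_sum (f := fun i => C i + C' i)
          (fun i _ => add_nonneg (hC0 i) (hC0' i)) (Finset.mem_univ i)
      refine (pi_norm_le_iff_of_nonneg (mul_nonneg (Finset.sum_nonneg fun i _ =>
        add_nonneg (hC0 i) (hC0' i)) (abs_nonneg ξ))).2 fun i => ?_
      have h1 := hC i ξ hξ
      have h2 := hC' i ξ hξ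
      have h3 := norm_sub_le ((T' i).fourier ξ - (T' i).fourier 0)
        ((T i).fourier ξ - (T i).fourier 0)
      have h4 : (((fun i => (T' i).fourier ξ) - fun i => (T i).fourier ξ) -
          ((fun i => (T' i).fourier 0) - fun i => (T i).fourier 0)) i =
          ((T' i).fourier ξ - (T' i).fourier 0) - ((T i).fourier ξ - (T i).fourier 0) := by
        simp only [Pi.sub_apply]
        ring
      rw [h4]
      have h5 := mul_le_mul_of_nonneg_right (hS i) (abs_nonneg ξ)
      linarith)
  funext i
  refine CompactDistribution.ext_fourier fun ξ => ?_
  exact sub_eq_zero.1 (congrFun (key ξ) i)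

end Refinable

/-! ### Superpositions of shifts -/

section ShiftSum

variable {r : ℕ}

theorem shiftSum_eq_sum {N : ℕ} {G : ℝ → Fin r → ℂ} (hG : ∀ x, (N : ℝ) < |x| → G x = 0)
    (w : ℤ → Matrix (Fin 1) (Fin r) ℂ) {x : ℝ} {S : Finset ℤ}
    (hS : ∀ l ∉ S, (N : ℝ) < |x - l|) : shiftSum w G x = ∑ l ∈ S, w l 0 ⬝ᵥ G (x - l) :=
  tsum_eq_sum fun l hl => by rw [hG _ (hS l hl), dotProduct_zero]

/-- Near each point, a superposition of shifts of a compactly supported function is a finite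
sum. -/
theorem exists_shiftSum_eventuallyEq (N : ℕ) (w : ℤ → Matrix (Fin 1) (Fin r) ℂ) (x₀ : ℝ) :
    ∃ S : Finset ℤ, ∀ G : ℝ → Fin r → ℂ, (∀ x, (N : ℝ) < |x| → G x = 0) →
      shiftSum w G =ᶠ[𝓝 x₀] fun x => ∑ l ∈ S, w l 0 ⬝ᵥ G (x - l) := by
  refine ⟨Finset.Icc (⌊x₀⌋ - N - 2) (⌊x₀⌋ + N + 2), fun G hG => ?_⟩
  filter_upwards [Metric.ball_mem_nhds x₀ one_pos] with x hx
  refine shiftSum_eq_sum hG w fun l hl => ?_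
  rw [Metric.mem_ball, Real.dist_eq, abs_lt] at hx
  have h1 := Int.floor_le x₀
  have h2 := Int.lt_floor_add_one x₀
  by_contra! h
  rw [abs_le] at h
  refine hl (Finset.mem_Icc.2 ⟨?_, ?_⟩)
  · have h3 : ((⌊x₀⌋ - N - 2 : ℤ) : ℝ) ≤ l := by push_cast; linarith
    exact_mod_cast h3
  · have h3 : (l : ℝ) ≤ ((⌊x₀⌋ + N + 2 : ℤ) : ℝ) := by push_cast; linarith
    exact_mod_cast h3

theorem continuous_shiftSum {N : ℕ} {G : ℝ → Fin r → ℂ} (hG : ∀ x, (N : ℝ) < |x| → G x = 0)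
    (hc : Continuous G) (w : ℤ → Matrix (Fin 1) (Fin r) ℂ) : Continuous (shiftSum w G) := by
  refine continuous_iff_continuousAt.2 fun x₀ => ?_
  obtain ⟨S, hS⟩ := exists_shiftSum_eventuallyEq N w x₀
  refine ContinuousAt.congr ?_ (hS G hG).symm
  unfold dotProduct
  fun_prop

theorem hasDerivAt_shiftSum {N : ℕ} {G G' : ℝ → Fin r → ℂ} (hG : ∀ x, (N : ℝ) < |x| → G x = 0)
    (hG' : ∀ x, (N : ℝ) < |x| → G' x = 0) (hd : ∀ x, HasDerivAt G (G' x) x)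
    (w : ℤ → Matrix (Fin 1) (Fin r) ℂ) (x₀ : ℝ) :
    HasDerivAt (shiftSum w G) (shiftSum w G' x₀) x₀ := by
  obtain ⟨S, hS⟩ := exists_shiftSum_eventuallyEq N w x₀
  refine HasDerivAt.congr_of_eventuallyEq ?_ (hS G hG)
  rw [(hS G' hG').eq_of_nhds]
  refine HasDerivAt.fun_sum fun l _ => ?_
  unfold dotProduct
  refine HasDerivAt.fun_sum fun i _ => ?_
  exact ((hasDerivAt_pi.1 ((hd (x₀ - l)).comp_sub_const x₀ (l : ℝ))) i).const_mul _

end ShiftSum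

/-! ### The scheme of the mask -/

section Main

variable {r m : ℕ}

theorem rpow_neg_lt {σ : ℝ} (h : (m : ℝ) < σ) : (2 : ℝ) ^ (-σ) < ((2 : ℝ) ^ m)⁻¹ := by
  rw [← Real.rpow_natCast, ← Real.rpow_neg two_pos.le]
  exact Real.rpow_lt_rpow_of_exponent_lt one_lt_two (by linarith)

theorem spectralCondition_of_smInfty {a : ℤ →₀ Matrix (Fin r) (Fin r) ℂ}
    (ha : (symbol a 0).charpoly.IsRoot 1) {v : ℤ →₀ (Fin r → ℂ)} (hv : HasSumRules a v (sr a))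
    {σ : ℝ} (hσ : smInfty a v = (σ : EReal)) (hmσ : (m : ℝ) < σ) :
    SpectralCondition a m ∧ m < sr a := by
  obtain ⟨p, hp1, hp2⟩ := exists_between (rpow_neg_lt hmσ)
  exact spectralCondition_and_lt ha hv.1 ((Real.rpow_pos_of_pos two_pos _).trans hp1) hp2
    fun u hu => decays_of_smInfty hσ hu hp1

/-- The hypotheses of the convergence theory hold with each matching filter of order `m + 1`,
since it is a multiple of `v` up to `O(ξ ^ (m + 1))`. -/
theorem smoothScheme_of_smInfty {a : ℤ →₀ Matrix (Fin r) (Fin r) ℂ}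
    (ha : (symbol a 0).charpoly.IsRoot 1) {v : ℤ →₀ (Fin r → ℂ)} (hv : HasSumRules a v (sr a))
    {σ : ℝ} (hσ : smInfty a v = (σ : EReal)) (hmσ : (m : ℝ) < σ) {y : ℤ →₀ (Fin r → ℂ)}
    (hy : IsMatchingFilter a y (m + 1)) : SmoothScheme a y m ((2 : ℝ) ^ (-σ)) := by
  obtain ⟨hsp, hm⟩ := spectralCondition_of_smInfty ha hv hσ hmσ
  have hρ : (0 : ℝ) < 2 ^ (-σ) := Real.rpow_pos_of_pos two_pos _
  obtain ⟨p, hp1, hp2⟩ := exists_between (rpow_neg_lt hmσ)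
  have hp0 : 0 < p := hρ.trans hp1
  have hp : p < 1 := hp2.trans_le (inv_le_one_of_one_le₀ (one_le_pow₀ (by norm_num)))
  have hker := kerDecay_of_decays hv.1.1 fun u hu => decays_of_smInfty hσ hu hp1
  obtain ⟨t, ht⟩ := hker.exists_eq_smul hp0 hp hv.1.1 (hy.vecMul_zero m.succ_ne_zero)
  have ht0 : t ≠ 0 := fun h => hy.1 (by rw [ht, h, zero_smul])
  have hyv := (hv.mono hm).1.sub_isBigO hy ht fun n hn hn' => hsp.det_ne_zero hn (by omega)
  have hvy : (fun ξ => symbol v ξ - t⁻¹ • symbol y ξ) =O[𝓝 0] fun ξ : ℝ => ξ ^ (m + 1) := by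
    refine (hyv.const_smul_left (-t⁻¹)).congr_left fun ξ => ?_
    rw [Pi.smul_apply, smul_sub, smul_smul, neg_mul, inv_mul_cancel₀ ht0, neg_smul, neg_smul,
      one_smul]
    abel
  refine ⟨hy.hasSumRules (hv.mono hm) hyv, hρ, rpow_neg_lt hmσ, fun l hl u hu p hp hpl => ?_⟩
  exact decays_of_isBigO hv hρ (fun u hu p hp => decays_of_smInfty hσ hu hp) (by omega : l ≤ sr a) u
    (isBigO_pairing_of_sub hl hvy hu) p hp hpl

variable {a : ℤ →₀ Matrix (Fin r) (Fin r) ℂ} {y : ℤ →₀ (Fin r → ℂ)} {ρ : ℝ}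

theorem SmoothScheme.contDiff_shiftSum (h : SmoothScheme a y m ρ) {u₀ : ℤ →₀ (Fin r → ℂ)}
    (hu₀ : (fun ξ => pairing y u₀ ξ - 1) =O[𝓝 0] fun ξ : ℝ => ξ ^ 1)
    (w : ℤ → Matrix (Fin 1) (Fin r) ℂ) :
    ContDiff ℝ m (shiftSum w (limitFn a u₀ 0)) ∧ ∀ j ≤ m,
      iteratedDeriv j (shiftSum w (limitFn a u₀ 0)) =
        shiftSum w (iteratedDeriv j (limitFn a u₀ 0)) := by
  obtain ⟨N, hN⟩ := exists_support_bound a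
  have hz : ∀ j x, (N : ℝ) < |x| → limitFn a (fwd^[j] u₀) j x = 0 := fun j x hx =>
    limitFn_eq_zero_of_lt_abs hN hx _ _
  have hchain : ∀ j < m, ∀ x, HasDerivAt (shiftSum w (limitFn a (fwd^[j] u₀) j))
      (shiftSum w (limitFn a (fwd^[j + 1] u₀) (j + 1)) x) x := fun j hj x =>
    hasDerivAt_shiftSum (hz j) (hz (j + 1)) (h.hasDerivAt_chain hu₀ j hj) w x
  refine ⟨contDiff_of_hasDerivAt_chain (F := fun j => shiftSum w (limitFn a (fwd^[j] u₀) j)) hchain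
    (continuous_shiftSum (hz m)
      (h.continuous_limitFn le_rfl (pairing_iterate_fwd_isBigO hu₀ m)) w), fun j hj => ?_⟩
  have h1 := iteratedDeriv_of_hasDerivAt_chain
    (F := fun j => shiftSum w (limitFn a (fwd^[j] u₀) j)) hchain hj
  have h2 := iteratedDeriv_of_hasDerivAt_chain (F := fun j => limitFn a (fwd^[j] u₀) j)
    (h.hasDerivAt_chain hu₀) hj
  simp only [Function.iterate_zero, id] at h1 h2
  rw [h1, h2]

/-- The passage from the initial data `δ I_r` to arbitrary initial data. -/
theorem norm_conv_sub_shiftSum_le {u : ℤ →₀ (Fin r → ℂ)} {G : ℝ → Fin r → ℂ} {j n N : ℕ} {β : ℂ}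
    {B K : ℝ}
    (hB : ∀ k : ℤ, ‖(2 : ℂ) ^ (j * n) • subdivData a u n k - β • G ((2 ^ n)⁻¹ * k)‖ ≤ B)
    (hN : ∀ k : ℤ, (N : ℤ) < |k| → a k = 0 ∧ u k = 0) (hG : ∀ x, (N : ℝ) < |x| → G x = 0)
    (w : ℤ → Matrix (Fin 1) (Fin r) ℂ) {k : ℤ} (hk : |(k : ℝ)| ≤ 2 ^ n * K) :
    ‖(2 : ℂ) ^ (j * n) * conv ((subdiv a)^[n] w) u k 0 - β * shiftSum w G ((2 ^ n)⁻¹ * k)‖ ≤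
      r * B * ∑ l ∈ Finset.Icc ⌈-(K + N)⌉ ⌊K + N⌋, ‖w l 0‖ := by
  set S := Finset.Icc ⌈-(K + N)⌉ ⌊K + N⌋ with hS
  have h2n : (0 : ℝ) < 2 ^ n := by positivity
  have hx : |(2 ^ n : ℝ)⁻¹ * k| ≤ K := by
    rw [abs_mul, abs_of_pos (by positivity), inv_mul_le_iff₀ h2n]
    exact hk
  have hout : ∀ l ∉ S, (N : ℝ) < |(2 ^ n : ℝ)⁻¹ * k - l| := by
    intro l hl
    by_contra! h
    have h1 : |(l : ℝ)| ≤ K + N := by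
      have h2 := abs_sub_le (l : ℝ) ((2 ^ n : ℝ)⁻¹ * k) 0
      rw [sub_zero, sub_zero, abs_sub_comm] at h2
      linarith
    rw [abs_le] at h1
    exact hl (Finset.mem_Icc.2 ⟨Int.ceil_le.2 h1.1, Int.le_floor.2 h1.2⟩)
  have hconv : conv ((subdiv a)^[n] w) u k 0 =
      ∑ l ∈ S, w l 0 ⬝ᵥ subdivData a u n (k - 2 ^ n * l) := by
    rw [conv_iterate_subdiv, finsum_eq_sum_of_support_subset (s := S), Finset.sum_apply]
    · rfl
    · intro l hl
      by_contra hlS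
      refine hl ?_
      have h1 := hout l hlS
      simp only
      rw [subdivData_eq_zero (fun k hk => (hN k hk).1) (fun k hk => (hN k hk).2),
        Matrix.mulVec_zero]
      have h2 : (2 : ℝ) ^ n * N < |((k - 2 ^ n * l : ℤ) : ℝ)| := by
        have h3 : ((k - 2 ^ n * l : ℤ) : ℝ) = 2 ^ n * ((2 ^ n : ℝ)⁻¹ * k - l) := by
          push_cast
          rw [mul_sub, mul_inv_cancel_left₀ h2n.ne']
        rw [h3, abs_mul, abs_of_pos h2n]
        gcongr
      have h4 : (2 : ℤ) ^ n * N < |k - 2 ^ n * l| := by exact_mod_cast h2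
      linarith
  rw [hconv, shiftSum_eq_sum hG w hout, Finset.mul_sum, Finset.mul_sum, ← Finset.sum_sub_distrib,
    Finset.mul_sum]
  refine (norm_sum_le _ _).trans (Finset.sum_le_sum fun l _ => ?_)
  have h1 : (2 : ℂ) ^ (j * n) * (w l 0 ⬝ᵥ subdivData a u n (k - 2 ^ n * l)) -
      β * (w l 0 ⬝ᵥ G ((2 ^ n)⁻¹ * k - l)) =
      w l 0 ⬝ᵥ ((2 : ℂ) ^ (j * n) • subdivData a u n (k - 2 ^ n * l) -
        β • G ((2 ^ n)⁻¹ * ((k - 2 ^ n * l : ℤ) : ℝ))) := by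
    have h2 : (2 ^ n : ℝ)⁻¹ * ((k - 2 ^ n * l : ℤ) : ℝ) = (2 ^ n)⁻¹ * k - l := by
      push_cast
      rw [mul_sub, inv_mul_cancel_left₀ h2n.ne']
    rw [h2, dotProduct_sub, dotProduct_smul, dotProduct_smul, smul_eq_mul, smul_eq_mul]
  rw [h1]
  refine (norm_dotProduct_le_card _ _).trans ?_
  rw [mul_assoc, mul_comm B]
  gcongr
  exact hB _

/-- The rate of convergence, in terms of the exponents of the theorem. -/
theorem SmoothScheme.exists_rate_bound {σ : ℝ} (h : SmoothScheme a y m ((2 : ℝ) ^ (-σ)))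
    {u₀ u : ℤ →₀ (Fin r → ℂ)} (hu₀ : (fun ξ => pairing y u₀ ξ - 1) =O[𝓝 0] fun ξ : ℝ => ξ ^ 1)
    {j s : ℕ} (hs : 1 ≤ s) (hjs : j + s ≤ m + 1) {β : ℂ}
    (hu : (fun ξ => pairing y u ξ - β * (Complex.I * (ξ : ℂ)) ^ j) =O[𝓝 0]
      fun ξ : ℝ => ξ ^ (j + s)) {μ : ℝ} (hμ : 0 < μ) (hμs : μ < s) (hμσ : μ < σ - j) :
    ∃ C : ℝ, 0 ≤ C ∧ ∀ (n : ℕ) (k : ℤ), ‖(2 : ℂ) ^ (j * n) • subdivData a u n k -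
      β • iteratedDeriv j (limitFn a u₀ 0) ((2 ^ n)⁻¹ * k)‖ ≤ C * (2 : ℝ) ^ (-μ * n) := by
  have h2j : (2 : ℝ) ^ j * 2 ^ (-(j + μ)) = 2 ^ (-μ) := by
    rw [← Real.rpow_natCast, ← Real.rpow_add two_pos]
    congr 1
    ring
  obtain ⟨C, hC⟩ := h.norm_sub_limitFn_le hs hjs hu (p := (2 : ℝ) ^ (-(j + μ)))
    (Real.rpow_lt_rpow_of_exponent_lt one_lt_two (by linarith))
    (by
      rw [← Real.rpow_natCast, ← Real.rpow_neg two_pos.le]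
      refine Real.rpow_lt_rpow_of_exponent_lt one_lt_two ?_
      push_cast
      linarith)
    (by
      rw [h2j]
      exact Real.rpow_lt_one_of_one_lt_of_neg one_lt_two (by linarith))
  rw [h2j] at hC
  refine ⟨C, by simpa using (norm_nonneg _).trans (hC 0 0), fun n k => ?_⟩
  rw [Real.rpow_mul_natCast two_pos.le,
    ← h.limitFn_eq_iteratedDeriv hu₀ (by omega)
      (hu.trans (isBigO_pow_pow_nhds_zero (by omega : j + 1 ≤ j + s)))]
  exact hC n k

theorem analyticAt_const_mul_I_pow (β : ℂ) (j : ℕ) :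
    AnalyticAt ℝ (fun ξ : ℝ => β * (Complex.I * (ξ : ℂ)) ^ j) 0 :=
  analyticAt_const.fun_mul ((analyticAt_const.fun_mul (Complex.ofRealCLM.analyticAt 0)).fun_pow j)

end Main

end VecSubdiv

theorem mainTheorem3 {r m : ℕ} (a : ℤ →₀ Matrix (Fin r) (Fin r) ℂ)
    (ha : (symbol a 0).charpoly.IsRoot 1)
    (v : ℤ →₀ (Fin r → ℂ)) (hv : HasSumRules a v (sr a))
    (σ : ℝ) (hσ : smInfty a v = (σ : EReal)) (hmσ : (m : ℝ) < σ) (hσm : σ ≤ (m : ℝ) + 1) :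
    SpectralCondition a m ∧
    (∃ vgu : ℤ →₀ (Fin r → ℂ), IsMatchingFilter a vgu (m + 1)) ∧
    ∀ vgu : ℤ →₀ (Fin r → ℂ), IsMatchingFilter a vgu (m + 1) →
      ∃ T : Fin r → CompactDistribution,
        IsNormalizedRefinable a vgu T ∧
        (∀ T' : Fin r → CompactDistribution, IsNormalizedRefinable a vgu T' → T' = T) ∧
        ∃ φ : ℝ → Fin r → ℂ,
          ContDiff ℝ m φ ∧ HasCompactSupport φ ∧ IsGivenBy T φ ∧
          ∀ (u : ℤ →₀ (Fin r → ℂ)) (j : ℕ) (β : ℂ) (s : ℕ) (ν : ℝ),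
            j = ld m (pairing vgu u) → β = taylorCoeff j (pairing vgu u) →
            1 ≤ s → j + s ≤ m + 1 →
            AgreeToOrder (j + s) (pairing vgu u) (fun ξ => β * (Complex.I * (ξ : ℂ)) ^ j) →
            ν = min (s : ℝ) (σ - j) →
            0 < ν ∧ ∀ ε : ℝ, 0 < ε → ε < ν →
              ∃ C : ℝ, 0 < C ∧
                (∀ (n : ℕ) (k : ℤ),
                  ‖(2 : ℂ) ^ (j * n) • subdivData a u n k
                      - β • iteratedDeriv j φ ((2 : ℝ) ^ (-(n : ℤ)) * k)‖
                    ≤ C * (2 : ℝ) ^ (-(ν - ε) * n)) ∧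
                ∀ (w₀ : ℤ → Matrix (Fin 1) (Fin r) ℂ) (K : ℝ) (N : ℕ), 0 < K →
                  (∀ k : ℤ, (N : ℤ) < |k| → a k = 0 ∧ u k = 0) →
                  ContDiff ℝ m (shiftSum w₀ φ) ∧
                  ∀ (n : ℕ) (k : ℤ), |(k : ℝ)| ≤ 2 ^ n * K →
                    ‖(2 : ℂ) ^ (j * n) * conv ((subdiv a)^[n] w₀) u k 0
                        - β * iteratedDeriv j (shiftSum w₀ φ) ((2 : ℝ) ^ (-(n : ℤ)) * k)‖
                      ≤ C * (∑ l ∈ Finset.Icc ⌈-(K + N)⌉ ⌊K + N⌋, ‖w₀ l 0‖)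
                          * (2 : ℝ) ^ (-(ν - ε) * n) := by
  obtain ⟨hsp, hm⟩ := spectralCondition_of_smInfty ha hv hσ hmσ
  refine ⟨hsp, ⟨v, hv.1.mono hm⟩, fun vgu hy => ?_⟩
  have h := smoothScheme_of_smInfty ha hv hσ hmσ hy
  obtain ⟨u₀, hu₀⟩ := exists_pairing_eq_one hy.1 0
  have hu₀' : symbol vgu 0 ⬝ᵥ symbol u₀ 0 = 1 := by
    have h1 := (isBigO_pow_iff_iteratedDeriv
      ((analyticAt_pairing vgu u₀ 0).fun_sub analyticAt_const) 1).1 hu₀ 0 one_pos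
    rw [iteratedDeriv_zero, sub_eq_zero] at h1
    exact h1
  have hT := h.isNormalizedRefinable hu₀'
  refine ⟨h.limitDist u₀, hT, fun T' hT' => h.eq_of_isNormalizedRefinable hT hT', limitFn a u₀ 0,
    h.contDiff hu₀, hasCompactSupport_limitFn a u₀ 0, h.isGivenBy u₀, ?_⟩
  intro u j β s ν _ _ hs hjs hagree hν
  have hj : (j : ℝ) ≤ m := by
    have : j ≤ m := by omega
    exact_mod_cast this
  have hs' : (1 : ℝ) ≤ s := by exact_mod_cast hs
  refine ⟨by rw [hν]; exact lt_min (by linarith) (by linarith), fun ε hε hεν => ?_⟩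
  have hν1 : ν ≤ s := hν ▸ min_le_left _ _
  have hν2 : ν ≤ σ - j := hν ▸ min_le_right _ _
  have hu := (agreeToOrder_iff_isBigO (analyticAt_pairing vgu u 0)
    (analyticAt_const_mul_I_pow β j) (j + s)).1 hagree
  obtain ⟨C, hC0, hC⟩ := h.exists_rate_bound hu₀ hs hjs hu (μ := ν - ε) (by linarith) (by linarith)
    (by linarith)
  have hpow : ∀ n : ℕ, (2 : ℝ) ^ (-(n : ℤ)) = (2 ^ n)⁻¹ := fun n => by
    rw [zpow_neg, zpow_natCast]
  simp only [hpow]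
  -- the factor `r` bounds a dot product by the supremum norms of its factors
  refine ⟨(r + 1) * C + 1, by positivity, fun n k => (hC n k).trans ?_, ?_⟩
  · gcongr
    have : 0 ≤ (r : ℝ) * C := by positivity
    linarith
  · intro w₀ K N hK hN
    obtain ⟨h1, h2⟩ := h.contDiff_shiftSum hu₀ w₀
    refine ⟨h1, fun n k hk => ?_⟩
    have hz : ∀ x, (N : ℝ) < |x| → iteratedDeriv j (limitFn a u₀ 0) x = 0 := fun x hx => by
      have h3 := h.limitFn_eq_iteratedDeriv hu₀ (by omega : j ≤ m)
        (pairing_iterate_fwd_leading hu₀ j) x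
      rw [one_smul] at h3
      rw [← h3]
      exact limitFn_eq_zero_of_lt_abs (fun k hk => (hN k hk).1) hx _ _
    rw [h2 j (by omega)]
    refine (norm_conv_sub_shiftSum_le (hC n) hN hz w₀ hk).trans ?_
    have h4 : 0 ≤ (∑ l ∈ Finset.Icc ⌈-(K + N)⌉ ⌊K + N⌋, ‖w₀ l 0‖) * (2 : ℝ) ^ (-(ν - ε) * n) := by
      positivity
    nlinarith
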